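/- **Setting.** Fix $L>0$. For a real $L$-periodic function let $\hat u(k)=\frac1L\int_0^L u(x)e^{-2\pi ikx/L}dx$, let $(u,v)=\int_0^L uv\,dx$, $\|u\|^2=(u,u)$, and for $s\ge 0$ let $H^s_{per}=H^s_{per}([0,L])$ be the space of real $u\in L^2_{per}$ with $\|u\|_s^2=L\sum_{k\in\mathbb Z}(1+k^2)^s|\hat u(k)|^2<\infty$. Let $\mathcal M$ be the Fourier multiplier $\widehat{\mathcal Mu}(k)=\theta(k)\hat u(k)$, where $\theta:\mathbb R\to\mathbb R$ is even and continuous and, for some $m>0$, $\kappa_0$ and $\upsilon_1,\upsilon_2>0$, satisfies $\upsilon_1|\kappa|^m\le\theta(\kappa)\le\upsilon_2|\kappa|^m$ for $|\kappa|\ge\kappa_0$. Let $f:\mathbb R\to\mathbb R$ be smooth with primitive $W$, $W'=f$; if $m\le 1$ suppose also that $|f'(x)|\le C(1+|x|^p)$ for some $C$ and some $p\ge0$ with $p(1-m)\le 2m$ (so that the functional $P$ below is defined and $C^2$ on $H^{m/2}_{per}$). Consider $$u_t+(f(u))_x-(\mathcal Mu)_x=0. \qquad (1)$$ Let $\omega,A\in\mathbb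 R$ and let $\phi\in C^\infty_{per}([0,L])$ solve $\mathcal M\phi+\omega\phi-f(\phi)+A=0$. Let $(\mu,\nu)\in\mathbb R^2\setminus\{0\}$ and, on $H^{m/2}_{per}$, put $$P(u)=\tfrac12\int_0^L\big(u\mathcal Mu-2W(u)\big)dx,\quad F(u)=\tfrac12\int_0^Lu^2dx,\quad M(u)=\int_0^Lu\,dx,$$ $$G=P+\omega F+AM,\qquad Q=\mu M+\nu F,$$ where $\int_0^L u\mathcal Mu\,dx$ denotes the duality pairing $L\sum_k\theta(k)|\hat u(k)|^2$; thus $Q'(\phi)=\mu+\nu\phi$. Let $\mathcal L=\mathcal M+\omega-f'(\phi)$ on $L^2_{per}$ with domain $H^m_{per}$, and assume: - $(H_0)$ $\mathcal L$ has exactly one negative eigenvalue, which is simple, and $0$ is a simple eigenvalue with eigenfunction $\phi'$; - $(H_1)$ there are $c_1,c_2>0$ with $(\mathcal Lv,v)\ge c_1\|v\|_{m/2}^2-c_2\|v\|^2$ for all $v\in C^\infty_{per}([0,L])$; - $(H_2)$ there is $c_3>0$ with $(\mathcal Lv,v)\ge c_3\|v\|^2$ for all $v\in H^m_{per}$ with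 $(v,\phi')=(v,Q'(\phi))=0$. Let $s\ge m/2$ and assume that the Cauchy problem for (1) is globally well-posed in $H^s_{per}$, in the following sense, where a *global solution* is a curve $u\in C([0,\infty);H^s_{per})$ satisfying (1) in the sense of periodic distributions, and belonging to a fixed class $X$ of curves (all curves, or a smaller class in which uniqueness holds): for each $u_0\in H^s_{per}$ there is exactly one global solution with $u(0)=u_0$; it depends continuously on $u_0$, in $C([0,T];H^s_{per})$ for every $T>0$; and if $u_0\in C^\infty_{per}$, then $u\in C([0,\infty);H^r_{per})$ for every $r$. Let $\Omega_\phi=\{\phi(\cdot+r):r\in\mathbb R\}$, $d(v,\Omega_\phi)=\inf_{r}\|v-\phi(\cdot+r)\|_{m/2}$ and $\Omega_\phi^\rho=\{v\in H^{m/2}_{per}:d(v,\Omega_\phi)<\rho\}$. **Proposition.** There exists $\sigma>0$ such that $$V(v)=G(v)-G(\phi)+\sigma\,(Q(v)-Q(\phi))^2,\qquad v\in H^{m/2}_{per},$$ is a Lyapunov function for the orbit $\Omega_\phi$. That is, there is $\rho>0$ such that 1. $V$ is of class $C^2$ on $\Omega_\phi^\rho$, and $V(v)=0$, $V'(v)=0$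 for all $v\in\Omega_\phi$; 2. there is $c>0$ with $V(v)\ge c\,[d(v,\Omega_\phi)]^2$ for all $v\in\Omega_\phi^\rho$; 3. $\langle V'(v),\partial_xv\rangle=0$ for all $v\in\Omega_\phi^\rho$ with $\partial_xv\in H^{m/2}_{per}$; moreover $V(v(\cdot+r))=V(v)$ for all $v\in H^{m/2}_{per}$ and $r\in\mathbb R$; 4. every global solution $u$ satisfies $V(u(t))=V(u(0))$ for all $t\ge0$. -/

import Mathlib

open MeasureTheory Set
open scoped ContDiff

noncomputable section

namespace PeriodicWave

/-! ### Real `L`-periodic square integrable functions and their Fourier coefficients -/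

section L2

/-- Real `L`-periodic square integrable functions, with the usual inner product
`(u, v) = ∫₀ᴸ u v dx` (`AddCircle L` carries the Lebesgue measure of total mass `L`). -/
abbrev L2Per (L : ℝ) [Fact (0 < L)] : Type := Lp ℝ 2 (volume : Measure (AddCircle L))

variable {L : ℝ} [Fact (0 < L)]

/-- The `k`-th Fourier coefficient `(1/L) ∫₀ᴸ g(x) exp(-2πikx/L) dx` of a real function. -/
def fc (g : AddCircle L → ℝ) (k : ℤ) : ℂ := fourierCoeff (fun x => (g x : ℂ)) k

theorem memLp_ofReal (u : L2Per L) :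
    MemLp (fun x => ((u x : ℝ) : ℂ)) 2 (AddCircle.haarAddCircle (T := L)) :=
  memLp_haarAddCircle_iff.2 (Lp.memLp u).ofReal

theorem integrable_ofReal (u : L2Per L) :
    Integrable (fun x => ((u x : ℝ) : ℂ)) (AddCircle.haarAddCircle (T := L)) :=
  (memLp_ofReal u).integrable one_le_two

theorem ae_haar {p : AddCircle L → Prop} (h : ∀ᵐ x, p x) :
    ∀ᵐ x ∂(AddCircle.haarAddCircle (T := L)), p x := by
  have hL : (0 : ℝ) < L := Fact.out
  rw [AddCircle.volume_eq_smul_haarAddCircle] at h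
  exact (Measure.ae_ennreal_smul_measure_iff (by simpa using hL)).1 h

theorem haar_ae {p : AddCircle L → Prop} (h : ∀ᵐ x ∂(AddCircle.haarAddCircle (T := L)), p x) :
    ∀ᵐ x, p x := by
  have hL : (0 : ℝ) < L := Fact.out
  rw [AddCircle.volume_eq_smul_haarAddCircle]
  exact (Measure.ae_ennreal_smul_measure_iff (by simpa using hL)).2 h

theorem fc_congr {g h : AddCircle L → ℝ} (e : g =ᵐ[volume] h) (k : ℤ) : fc g k = fc h k := by
  have e' : ∀ᵐ x ∂(AddCircle.haarAddCircle (T := L)), (g x : ℂ) = (h x : ℂ) := by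
    filter_upwards [ae_haar e] with x hx
    rw [hx]
  exact congrFun (fourierCoeff_congr_ae e') k

theorem fc_add (u v : L2Per L) (k : ℤ) : fc (⇑(u + v)) k = fc u k + fc v k := by
  rw [fc_congr (Lp.coeFn_add u v) k]
  unfold fc
  rw [← Pi.add_apply, ← fourierCoeff.add (integrable_ofReal u) (integrable_ofReal v)]
  congr 1
  ext x
  simp

theorem fc_smul (a : ℝ) (u : L2Per L) (k : ℤ) : fc (⇑(a • u)) k = (a : ℂ) * fc u k := by
  rw [fc_congr (Lp.coeFn_smul a u) k]
  unfold fc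
  rw [← fourierCoeff.const_mul]
  congr 1
  ext x
  simp

theorem fc_zero (k : ℤ) : fc (⇑(0 : L2Per L)) k = 0 := by
  have h := fc_smul 0 (0 : L2Per L) k
  simpa using h

theorem fc_neg_index (g : AddCircle L → ℝ) (k : ℤ) :
    fc g (-k) = (starRingEnd ℂ) (fc g k) := by
  unfold fc fourierCoeff
  rw [← integral_conj]
  congr 1
  ext x
  simp only [smul_eq_mul, map_mul, Complex.conj_ofReal, ← fourier_neg]

theorem summable_fc_sq (u : L2Per L) : Summable fun k : ℤ => ‖fc u k‖ ^ 2 := by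
  have h := hasSum_sq_fourierCoeff ((memLp_ofReal u).toLp _)
  have e : ∀ k, fourierCoeff ((memLp_ofReal u).toLp _) k = fc u k := fun k =>
    congrFun (fourierCoeff_congr_ae (MemLp.coeFn_toLp (memLp_ofReal u))) k
  simpa only [e] using h.summable

theorem fc_injective {u v : L2Per L} (h : ∀ k, fc u k = fc v k) : u = v := by
  have e : ∀ w : L2Per L, ∀ k, fourierBasis.repr ((memLp_ofReal w).toLp _) k = fc w k := by
    intro w k
    rw [fourierBasis_repr]
    exact congrFun (fourierCoeff_congr_ae (MemLp.coeFn_toLp (memLp_ofReal w))) k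
  have h1 : (memLp_ofReal u).toLp _ = (memLp_ofReal v).toLp _ := by
    apply fourierBasis.repr.injective
    ext k
    rw [e, e, h]
  rw [MemLp.toLp_eq_toLp_iff] at h1
  apply Lp.ext
  filter_upwards [haar_ae h1] with x hx
  exact_mod_cast hx

/-- Square summable coefficients with the symmetry of a real function belong to a real
square integrable function. -/
theorem exists_fc_eq (c : ℤ → ℂ) (hc : Summable fun k => ‖c k‖ ^ 2)
    (hr : ∀ k, c (-k) = (starRingEnd ℂ) (c k)) : ∃ u : L2Per L, ∀ k, fc u k = c k := by
  have hm : Memℓp c 2 := by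
    rw [memℓp_gen_iff (by norm_num)]
    simpa using hc
  let G : Lp ℂ 2 (AddCircle.haarAddCircle (T := L)) := fourierBasis.repr.symm ⟨c, hm⟩
  have hG : ∀ k, fourierCoeff G k = c k := by
    intro k
    rw [← fourierBasis_repr, LinearIsometryEquiv.apply_symm_apply]
  have hGm : MemLp (fun x => (G x).re) 2 (volume : Measure (AddCircle L)) :=
    (memLp_haarAddCircle_iff.1 (Lp.memLp G)).re
  refine ⟨hGm.toLp _, fun k => ?_⟩
  rw [fc_congr hGm.coeFn_toLp k]
  have hi : Integrable (fun x => G x) (AddCircle.haarAddCircle (T := L)) :=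
    (Lp.memLp G).integrable one_le_two
  have hi' : Integrable (fun x => (starRingEnd ℂ) (G x)) (AddCircle.haarAddCircle (T := L)) :=
    (Lp.memLp G).star.integrable one_le_two
  have h1 : (fun x => (((G x).re : ℝ) : ℂ)) =
      (1 / 2 : ℂ) • ((fun x => G x) + fun x => (starRingEnd ℂ) (G x)) := by
    ext x
    simp only [Pi.smul_apply, Pi.add_apply, smul_eq_mul, Complex.re_eq_add_conj]
    ring
  have h2 : fourierCoeff (fun x => (starRingEnd ℂ) (G x)) k = (starRingEnd ℂ) (c (-k)) := by
    rw [← hG (-k)]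
    unfold fourierCoeff
    rw [← integral_conj]
    congr 1
    ext x
    simp only [smul_eq_mul, map_mul, ← fourier_neg, neg_neg]
  unfold fc
  rw [h1]
  have h3 := fourierCoeff.const_smul ((fun x => G x) + fun x => (starRingEnd ℂ) (G x))
    (1 / 2 : ℂ) k
  rw [h3, fourierCoeff.add hi hi', Pi.add_apply, h2, hG, hr, Complex.conj_conj, smul_eq_mul]
  ring

end L2

/-! ### The Sobolev spaces `H^s_per([0, L])` -/

section Sobolev

/-- The Sobolev weight `(1 + k²)^s`. -/
def wt (s : ℝ) (k : ℤ) : ℝ := (1 + (k : ℝ) ^ 2) ^ s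

theorem wt_pos (s : ℝ) (k : ℤ) : 0 < wt s k := Real.rpow_pos_of_pos (by positivity) s

theorem wt_mono {r s : ℝ} (h : r ≤ s) (k : ℤ) : wt r k ≤ wt s k :=
  Real.rpow_le_rpow_of_exponent_le (by nlinarith [sq_nonneg (k : ℝ)]) h

/-- For `s ≥ 0`: the square integrable functions with `∑ (1 + k²)^s |û(k)|² < ∞`. -/
def sobolev (L : ℝ) [Fact (0 < L)] (s : ℝ) : Submodule ℝ (L2Per L) where
  carrier := {u | Summable fun k : ℤ => wt s k * ‖fc u k‖ ^ 2}
  zero_mem' := by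
    change Summable fun k : ℤ => wt s k * ‖fc (⇑(0 : L2Per L)) k‖ ^ 2
    simp only [fc_zero, norm_zero, ne_eq, OfNat.ofNat_ne_zero, not_false_eq_true, zero_pow,
      mul_zero]
    exact summable_zero
  add_mem' := by
    intro u v hu hv
    refine Summable.of_nonneg_of_le (fun k => mul_nonneg (wt_pos s k).le (sq_nonneg _))
      (fun k => ?_) ((hu.add hv).mul_left 2)
    have h1 : ‖fc (⇑(u + v)) k‖ ≤ ‖fc u k‖ + ‖fc v k‖ := by
      rw [fc_add]
      exact norm_add_le _ _
    have h2 : ‖fc (⇑(u + v)) k‖ ^ 2 ≤ 2 * (‖fc u k‖ ^ 2 + ‖fc v k‖ ^ 2) := by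
      nlinarith [norm_nonneg (fc (⇑(u + v)) k), sq_nonneg (‖fc u k‖ - ‖fc v k‖)]
    calc wt s k * ‖fc (⇑(u + v)) k‖ ^ 2
        ≤ wt s k * (2 * (‖fc u k‖ ^ 2 + ‖fc v k‖ ^ 2)) :=
          mul_le_mul_of_nonneg_left h2 (wt_pos s k).le
      _ = _ := by ring
  smul_mem' := by
    intro a u hu
    have e : (fun k : ℤ => wt s k * ‖fc (⇑(a • u)) k‖ ^ 2) =
        fun k => a ^ 2 * (wt s k * ‖fc u k‖ ^ 2) := by
      ext k
      rw [fc_smul, norm_mul, mul_pow, Complex.norm_real, Real.norm_eq_abs, sq_abs]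
      ring
    change Summable fun k : ℤ => wt s k * ‖fc (⇑(a • u)) k‖ ^ 2
    rw [e]
    exact Summable.mul_left _ hu

/-- The space `H^s_per([0, L])`. It carries its own norm (defined below), not that of `L²`. -/
def HPer (L : ℝ) [Fact (0 < L)] (s : ℝ) : Type := sobolev L s

instance (L : ℝ) [Fact (0 < L)] (s : ℝ) : AddCommGroup (HPer L s) :=
  inferInstanceAs (AddCommGroup (sobolev L s))

instance (L : ℝ) [Fact (0 < L)] (s : ℝ) : Module ℝ (HPer L s) :=
  inferInstanceAs (Module ℝ (sobolev L s))

variable {L : ℝ} [Fact (0 < L)]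

/-- An element of `H^s_per`, seen in `L²_per`. -/
def toL2 {s : ℝ} : HPer L s →ₗ[ℝ] L2Per L := (sobolev L s).subtype

theorem toL2_injective {s : ℝ} : Function.Injective (toL2 : HPer L s → L2Per L) :=
  Subtype.val_injective

theorem toL2_mem {s : ℝ} (u : HPer L s) : toL2 u ∈ sobolev L s := u.2

theorem sobolev_mono {r s : ℝ} (h : r ≤ s) : sobolev L s ≤ sobolev L r := fun _ hu =>
  Summable.of_nonneg_of_le (fun k => mul_nonneg (wt_pos r k).le (sq_nonneg _))
    (fun k => mul_le_mul_of_nonneg_right (wt_mono h k) (sq_nonneg _)) hu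

/-- The inclusion `H^s_per ⊆ H^r_per` for `r ≤ s`. -/
def incl {r s : ℝ} (h : r ≤ s) : HPer L s →ₗ[ℝ] HPer L r :=
  Submodule.inclusion (sobolev_mono h)

/-- The `k`-th Fourier coefficient of an element of `H^s_per`. -/
def hat {s : ℝ} (u : HPer L s) (k : ℤ) : ℂ := fc (toL2 u) k

theorem hat_add {s : ℝ} (u v : HPer L s) (k : ℤ) : hat (u + v) k = hat u k + hat v k := by
  simp only [hat, map_add, fc_add]

theorem hat_smul {s : ℝ} (a : ℝ) (u : HPer L s) (k : ℤ) :
    hat (a • u) k = (a : ℂ) * hat u k := by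
  simp only [hat, map_smul, fc_smul]

theorem hat_neg_index {s : ℝ} (u : HPer L s) (k : ℤ) :
    hat u (-k) = (starRingEnd ℂ) (hat u k) := fc_neg_index _ _

theorem summable_hat {s : ℝ} (u : HPer L s) : Summable fun k : ℤ => wt s k * ‖hat u k‖ ^ 2 :=
  toL2_mem u

theorem summable_inner {s : ℝ} (u v : HPer L s) :
    Summable fun k : ℤ => wt s k * ((starRingEnd ℂ) (hat u k) * hat v k).re := by
  refine Summable.of_norm_bounded ((summable_hat u).add (summable_hat v)) (fun k => ?_)
  have h1 : |((starRingEnd ℂ) (hat u k) * hat v k).re| ≤ ‖hat u k‖ * ‖hat v k‖ := by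
    refine (Complex.abs_re_le_norm _).trans ?_
    rw [norm_mul, RCLike.norm_conj]
  rw [norm_mul, Real.norm_eq_abs, Real.norm_eq_abs, abs_of_pos (wt_pos s k), ← mul_add]
  refine mul_le_mul_of_nonneg_left (h1.trans ?_) (wt_pos s k).le
  nlinarith [sq_nonneg (‖hat u k‖ - ‖hat v k‖), sq_nonneg ‖hat u k‖, sq_nonneg ‖hat v k‖]

theorem conj_mul_self_re (z : ℂ) : ((starRingEnd ℂ) z * z).re = ‖z‖ ^ 2 := by
  rw [← Complex.normSq_eq_conj_mul_self, Complex.ofReal_re, Complex.normSq_eq_norm_sq]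

/-- The inner product `(u, v)_s = L ∑ (1 + k²)^s conj(û(k)) v̂(k)` of `H^s_per([0, L])`
(the sum is real, `u` and `v` being real functions; it is the `L²` inner product for `s = 0`). -/
@[reducible] def innerCore (L : ℝ) [Fact (0 < L)] (s : ℝ) : InnerProductSpace.Core ℝ (HPer L s) where
  inner u v := L * ∑' k : ℤ, wt s k * ((starRingEnd ℂ) (hat u k) * hat v k).re
  conj_inner_symm u v := by
    simp only [conj_trivial]
    congr 2
    ext k
    simp only [Complex.mul_re, Complex.conj_re, Complex.conj_im]
    ring
  re_inner_nonneg u := by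
    have hL : (0 : ℝ) < L := Fact.out
    simp only [conj_mul_self_re]
    exact mul_nonneg hL.le (tsum_nonneg fun k => mul_nonneg (wt_pos s k).le (sq_nonneg _))
  add_left u v w := by
    rw [← mul_add, ← (summable_inner u w).tsum_add (summable_inner v w)]
    congr 2
    ext k
    rw [hat_add, map_add, add_mul, Complex.add_re]
    ring
  smul_left u v a := by
    rw [conj_trivial, mul_left_comm]
    congr 1
    rw [← tsum_mul_left]
    congr 1
    funext k
    rw [hat_smul, map_mul, Complex.conj_ofReal, mul_assoc, Complex.re_ofReal_mul]
    ring
  definite u hu := by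
    have hL : (0 : ℝ) < L := Fact.out
    simp only [conj_mul_self_re] at hu
    have h0 : ∑' k : ℤ, wt s k * ‖hat u k‖ ^ 2 = 0 := (mul_eq_zero.1 hu).resolve_left hL.ne'
    have h1 := ((summable_hat u).hasSum_iff.2 h0)
    have h2 := (hasSum_zero_iff_of_nonneg
      (fun k => mul_nonneg (wt_pos s k).le (sq_nonneg _))).1 h1
    apply toL2_injective
    apply fc_injective
    intro k
    have h3 : wt s k * ‖hat u k‖ ^ 2 = 0 := congrFun h2 k
    have h4 : hat u k = 0 := by
      simpa using (mul_eq_zero.1 h3).resolve_left (wt_pos s k).ne'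
    rw [map_zero, fc_zero]
    exact h4

instance (L : ℝ) [Fact (0 < L)] (s : ℝ) : NormedAddCommGroup (HPer L s) :=
  (innerCore L s).toNormedAddCommGroup

instance (L : ℝ) [Fact (0 < L)] (s : ℝ) : InnerProductSpace ℝ (HPer L s) :=
  InnerProductSpace.ofCore (innerCore L s).toCore

theorem hper_norm_sq {s : ℝ} (u : HPer L s) :
    ‖u‖ ^ 2 = L * ∑' k : ℤ, wt s k * ‖hat u k‖ ^ 2 := by
  rw [← real_inner_self_eq_norm_sq]
  change L * ∑' k : ℤ, wt s k * ((starRingEnd ℂ) (hat u k) * hat u k).re = _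
  simp only [conj_mul_self_re]

end Sobolev

/-! ### Smooth periodic functions -/

section Smooth

/-- The space `C^∞_per([0, L])` of smooth `L`-periodic functions on the line. -/
structure SmoothPer (L : ℝ) where
  toFun : ℝ → ℝ
  smooth : ContDiff ℝ ∞ toFun
  periodic : Function.Periodic toFun L

namespace SmoothPer

/-- The derivative `g'`. -/
def derivative {L : ℝ} (g : SmoothPer L) : SmoothPer L where
  toFun := deriv g.toFun
  smooth := (contDiff_infty_iff_deriv.1 g.smooth).2
  periodic := fun x => by
    have h : (fun y => g.toFun (y + L)) = g.toFun := funext g.periodic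
    rw [← deriv_comp_add_const, h]

/-- The composition `h ∘ g` with a smooth function `h` on the line. -/
def comp {L : ℝ} (h : ℝ → ℝ) (hh : ContDiff ℝ ∞ h) (g : SmoothPer L) : SmoothPer L where
  toFun := fun x => h (g.toFun x)
  smooth := hh.comp g.smooth
  periodic := fun x => congrArg h (g.periodic x)

/-- The constant function `1`. -/
def one (L : ℝ) : SmoothPer L where
  toFun := fun _ => 1
  smooth := contDiff_const
  periodic := fun _ => rfl

variable {L : ℝ}

/-- A periodic function as a function on the circle `ℝ / Lℤ`. -/
def onCircle (g : SmoothPer L) : AddCircle L → ℝ := g.periodic.lift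

theorem onCircle_coe (g : SmoothPer L) (x : ℝ) : g.onCircle (x : AddCircle L) = g.toFun x := rfl

theorem continuous_onCircle (g : SmoothPer L) : Continuous g.onCircle :=
  continuous_coinduced_dom.2 g.smooth.continuous

variable [Fact (0 < L)]

theorem memLp_onCircle (g : SmoothPer L) :
    MemLp g.onCircle 2 (volume : Measure (AddCircle L)) :=
  g.continuous_onCircle.memLp_of_hasCompactSupport (HasCompactSupport.of_compactSpace _)

/-- A smooth periodic function as an element of `L²_per`. -/
def inL2 (g : SmoothPer L) : L2Per L := g.memLp_onCircle.toLp _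

theorem coeFn_inL2 (g : SmoothPer L) : g.inL2 =ᵐ[volume] g.onCircle :=
  g.memLp_onCircle.coeFn_toLp

theorem fc_derivative (g : SmoothPer L) (k : ℤ) :
    fc g.derivative.onCircle k = (2 * Real.pi * Complex.I * k / L) * fc g.onCircle k := by
  have hL : (0 : ℝ) < L := Fact.out
  have hd : ∀ x : ℝ, HasDerivAt (fun y : ℝ => ((g.toFun y : ℝ) : ℂ))
      ((g.derivative.toFun x : ℝ) : ℂ) x := fun x =>
    ((g.smooth.differentiable (by simp)) x).hasDerivAt.ofReal_comp
  have hc : Continuous fun x : ℝ => ((g.derivative.toFun x : ℝ) : ℂ) :=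
    Complex.continuous_ofReal.comp g.derivative.smooth.continuous
  have hf : Continuous fun x : ℝ => (fourier (-k) (x : AddCircle L) : ℂ) :=
    (fourier (-k)).continuous.comp (AddCircle.continuous_mk' L)
  have hp := intervalIntegral.integral_mul_deriv_eq_deriv_mul (a := 0) (b := 0 + L)
    (fun x _ => hasDerivAt_fourier_neg L k x) (fun x _ => hd x)
    ((continuous_const.mul hf).intervalIntegrable _ _) (hc.intervalIntegrable _ _)
  have hb : (fourier (-k) (((0 : ℝ) + L : ℝ) : AddCircle L) : ℂ) * ((g.toFun (0 + L) : ℝ) : ℂ)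
      - (fourier (-k) ((0 : ℝ) : AddCircle L) : ℂ) * ((g.toFun 0 : ℝ) : ℂ) = 0 := by
    rw [g.periodic 0, AddCircle.coe_add_period, sub_self]
  rw [hb, zero_sub, ← intervalIntegral.integral_neg] at hp
  unfold fc
  rw [fourierCoeff_eq_intervalIntegral _ k 0, fourierCoeff_eq_intervalIntegral _ k 0]
  simp only [smul_eq_mul, onCircle_coe]
  rw [hp, mul_smul_comm, ← intervalIntegral.integral_const_mul]
  congr 2
  funext x
  ring

theorem inL2_mem_sobolev (g : SmoothPer L) (s : ℝ) : g.inL2 ∈ sobolev L s := by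
  have hL : (0 : ℝ) < L := Fact.out
  have key : ∀ n : ℕ, ∀ g : SmoothPer L, g.inL2 ∈ sobolev L (n : ℝ) := by
    intro n
    induction n with
    | zero =>
      intro g
      change Summable fun k : ℤ => wt ((0 : ℕ) : ℝ) k * ‖fc g.inL2 k‖ ^ 2
      simpa [wt] using summable_fc_sq g.inL2
    | succ n ih =>
      intro g
      have h1 : Summable fun k : ℤ => wt n k * ‖fc g.inL2 k‖ ^ 2 := ih g
      have h2 : Summable fun k : ℤ => wt n k * ‖fc g.derivative.inL2 k‖ ^ 2 := ih g.derivative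
      change Summable fun k : ℤ => wt ((n + 1 : ℕ) : ℝ) k * ‖fc g.inL2 k‖ ^ 2
      refine (h1.add (h2.mul_left ((L / (2 * Real.pi)) ^ 2))).congr (fun k => ?_)
      rw [fc_congr g.derivative.coeFn_inL2, fc_derivative, fc_congr g.coeFn_inL2]
      have h3 : wt ((n + 1 : ℕ) : ℝ) k = wt n k * (1 + (k : ℝ) ^ 2) := by
        unfold wt
        push_cast
        rw [Real.rpow_add (by positivity), Real.rpow_one]
      have h4 : ‖(2 * Real.pi * Complex.I * k / L : ℂ)‖ ^ 2
          = (2 * Real.pi / L) ^ 2 * (k : ℝ) ^ 2 := by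
        simp only [norm_div, norm_mul, Complex.norm_I, Complex.norm_real, Complex.norm_intCast,
          Complex.norm_ofNat, Real.norm_eq_abs, div_pow, mul_pow, sq_abs]
        ring
      rw [norm_mul, mul_pow, h4, h3]
      have hpi := Real.pi_pos
      field_simp
  obtain ⟨n, hn⟩ := exists_nat_ge s
  exact sobolev_mono hn (key n g)

/-- A smooth periodic function as an element of `H^s_per`. -/
def inH (g : SmoothPer L) (s : ℝ) : HPer L s := ⟨g.inL2, g.inL2_mem_sobolev s⟩

theorem memLp_mul (g : SmoothPer L) (u : L2Per L) :
    MemLp (fun x => g.onCircle x * u x) 2 (volume : Measure (AddCircle L)) := by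
  obtain ⟨C, hC⟩ := isCompact_univ.exists_bound_of_continuousOn
    (f := g.onCircle) g.continuous_onCircle.continuousOn
  exact (Lp.memLp u).of_le_mul (c := C)
    (g.continuous_onCircle.aestronglyMeasurable.mul (Lp.memLp u).1)
    (Filter.Eventually.of_forall fun x => by
      rw [norm_mul]
      exact mul_le_mul_of_nonneg_right (hC x (mem_univ x)) (norm_nonneg _))

/-- Multiplication by a smooth periodic function on `L²_per`. -/
def mulL2 (g : SmoothPer L) : L2Per L →ₗ[ℝ] L2Per L where
  toFun u := (g.memLp_mul u).toLp _
  map_add' u v := by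
    rw [← MemLp.toLp_add, MemLp.toLp_eq_toLp_iff]
    filter_upwards [Lp.coeFn_add u v] with x hx
    simp only [hx, Pi.add_apply]
    ring
  map_smul' a u := by
    rw [RingHom.id_apply, ← MemLp.toLp_const_smul, MemLp.toLp_eq_toLp_iff]
    filter_upwards [Lp.coeFn_smul a u] with x hx
    simp only [hx, Pi.smul_apply, smul_eq_mul]
    ring

end SmoothPer

end Smooth

/-! ### Translations -/

section Translation

variable {L : ℝ} [Fact (0 < L)]

/-- The translate `u(· + r)` of an element of `L²_per`. -/
def translateL2 (r : ℝ) (u : L2Per L) : L2Per L :=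
  Lp.compMeasurePreserving (fun x : AddCircle L => x + (r : AddCircle L))
    (measurePreserving_add_right volume (r : AddCircle L)) u

theorem fc_translateL2 (r : ℝ) (u : L2Per L) (k : ℤ) :
    fc (translateL2 r u) k = fourier k (r : AddCircle L) * fc u k := by
  rw [translateL2, fc_congr (Lp.coeFn_compMeasurePreserving u
    (measurePreserving_add_right volume (r : AddCircle L))) k]
  unfold fc fourierCoeff
  rw [← integral_const_mul, ← integral_add_right_eq_self
    (fun t => (fourier k (r : AddCircle L) : ℂ) * ((fourier (-k)) t • ((u t : ℝ) : ℂ)))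
    (r : AddCircle L)]
  congr 1
  funext t
  have h : (fourier k (r : AddCircle L) : ℂ) * (fourier (-k) (t + (r : AddCircle L)) : ℂ)
      = fourier (-k) t := by
    rw [fourier_apply, fourier_apply, fourier_apply, ← Circle.coe_mul, ← AddCircle.toCircle_add]
    congr 2
    rw [smul_add, neg_smul, neg_smul]
    abel
  simp only [smul_eq_mul, Function.comp_apply]
  rw [← mul_assoc, h]

theorem norm_fc_translateL2 (r : ℝ) (u : L2Per L) (k : ℤ) :
    ‖fc (translateL2 r u) k‖ = ‖fc u k‖ := by
  rw [fc_translateL2, norm_mul, fourier_apply, Circle.norm_coe, one_mul]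

/-- The translate `u(· + r)` of an element of `H^s_per`. -/
def translate {s : ℝ} (r : ℝ) (u : HPer L s) : HPer L s :=
  ⟨translateL2 r (toL2 u), by
    change Summable fun k : ℤ => wt s k * ‖fc (translateL2 r (toL2 u)) k‖ ^ 2
    simp only [norm_fc_translateL2]
    exact toL2_mem u⟩

/-- `w = ∂ₓ v`, for `v, w ∈ H^s_per`. -/
def IsDerivativeOf {s : ℝ} (w v : HPer L s) : Prop :=
  ∀ k : ℤ, hat w k = (2 * Real.pi * Complex.I * k / L) * hat v k

end Translation

/-! ### The dispersion operator and the linearized operator -/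

section Operators

/-- The symbol `θ` of the dispersion operator `𝓜`, of order `m > 0`. -/
structure DispersionSymbol where
  θ : ℝ → ℝ
  m : ℝ
  m_pos : 0 < m
  continuous_θ : Continuous θ
  even_θ : ∀ κ, θ (-κ) = θ κ
  bounds : ∃ κ₀ υ₁ υ₂ : ℝ, 0 < υ₁ ∧ 0 < υ₂ ∧
    ∀ κ : ℝ, κ₀ ≤ |κ| → υ₁ * |κ| ^ m ≤ θ κ ∧ θ κ ≤ υ₂ * |κ| ^ m

variable {L : ℝ} [Fact (0 < L)] (S : DispersionSymbol)

theorem DispersionSymbol.sq_le : ∃ C : ℝ, ∀ k : ℤ, S.θ k ^ 2 ≤ C * wt S.m k := by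
  obtain ⟨κ₀, υ₁, υ₂, h1, h2, hb⟩ := S.bounds
  obtain ⟨B, hB⟩ := (isCompact_Icc (a := -κ₀) (b := κ₀)).exists_bound_of_continuousOn
    S.continuous_θ.continuousOn
  refine ⟨B ^ 2 + υ₂ ^ 2, fun k => ?_⟩
  have hw : 1 ≤ wt S.m k :=
    Real.one_le_rpow (by nlinarith [sq_nonneg (k : ℝ)]) S.m_pos.le
  rcases le_total κ₀ |(k : ℝ)| with h | h
  · obtain ⟨ha, hc⟩ := hb k h
    have h0 : 0 ≤ S.θ k := le_trans (by positivity) ha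
    have h3 : (|(k : ℝ)| ^ S.m) ^ 2 ≤ wt S.m k := by
      unfold wt
      rw [← Real.rpow_natCast, ← Real.rpow_mul (abs_nonneg _), mul_comm, Real.rpow_mul
        (abs_nonneg _)]
      apply Real.rpow_le_rpow (by positivity) _ S.m_pos.le
      simp
    calc S.θ k ^ 2 ≤ (υ₂ * |(k : ℝ)| ^ S.m) ^ 2 := pow_le_pow_left₀ h0 hc 2
      _ = υ₂ ^ 2 * (|(k : ℝ)| ^ S.m) ^ 2 := by ring
      _ ≤ υ₂ ^ 2 * wt S.m k := mul_le_mul_of_nonneg_left h3 (sq_nonneg _)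
      _ ≤ (B ^ 2 + υ₂ ^ 2) * wt S.m k := by nlinarith [sq_nonneg B]
  · have h3 := hB k (by rw [mem_Icc]; exact abs_le.1 h)
    rw [Real.norm_eq_abs] at h3
    have h4 : S.θ k ^ 2 ≤ B ^ 2 := sq_le_sq' (by linarith [(abs_le.1 h3).1]) (abs_le.1 h3).2
    nlinarith [sq_nonneg B, sq_nonneg υ₂]

theorem DispersionSymbol.exists_M (u : HPer L S.m) :
    ∃ g : L2Per L, ∀ k : ℤ, fc g k = (S.θ k : ℂ) * hat u k := by
  apply exists_fc_eq
  · obtain ⟨C, hC⟩ := S.sq_le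
    refine Summable.of_nonneg_of_le (fun k => sq_nonneg _) (fun k => ?_)
      ((summable_hat u).mul_left C)
    rw [norm_mul, mul_pow, Complex.norm_real, Real.norm_eq_abs, sq_abs, ← mul_assoc]
    exact mul_le_mul_of_nonneg_right (hC k) (sq_nonneg _)
  · intro k
    rw [hat_neg_index, map_mul, Complex.conj_ofReal]
    push_cast
    rw [S.even_θ]

/-- The operator `𝓜`, with domain `H^m_per`: the function `𝓜 u ∈ L²_per` is the one with
Fourier coefficients `θ(k) û(k)`. -/
def DispersionSymbol.M : HPer L S.m →ₗ[ℝ] L2Per L where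
  toFun u := (S.exists_M u).choose
  map_add' u v := fc_injective fun k => by
    rw [fc_add, (S.exists_M u).choose_spec, (S.exists_M v).choose_spec,
      (S.exists_M (u + v)).choose_spec, hat_add, mul_add]
  map_smul' a u := fc_injective fun k => by
    rw [RingHom.id_apply, fc_smul, (S.exists_M u).choose_spec, (S.exists_M (a • u)).choose_spec,
      hat_smul, mul_left_comm]

theorem DispersionSymbol.fc_M (u : HPer L S.m) (k : ℤ) :
    fc (S.M u) k = (S.θ k : ℂ) * hat u k := (S.exists_M u).choose_spec k

/-- The traveling wave equation `𝓜φ + ωφ - f(φ) + A = 0`. -/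
def IsWave (f : ℝ → ℝ) (hf : ContDiff ℝ ∞ f) (speed A : ℝ) (φ : SmoothPer L) : Prop :=
  S.M (φ.inH S.m) + speed • φ.inL2 - (φ.comp f hf).inL2 + A • (SmoothPer.one L).inL2 = 0

/-- The linearized operator `𝓛 = 𝓜 + ω - f'(φ)` on `L²_per`, with domain `H^m_per`. -/
def linOp (f : ℝ → ℝ) (hf : ContDiff ℝ ∞ f) (speed : ℝ) (φ : SmoothPer L) :
    HPer L S.m →ₗ[ℝ] L2Per L :=
  S.M + speed • toL2 - (φ.comp (deriv f) (contDiff_infty_iff_deriv.1 hf).2).mulL2 ∘ₗ toL2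

/-- The eigenspace `ker (T - lam)` of an operator `T` on `L²_per` with domain `H^s_per`. -/
def eigenspace {s : ℝ} (T : HPer L s →ₗ[ℝ] L2Per L) (lam : ℝ) : Submodule ℝ (HPer L s) :=
  LinearMap.ker (T - lam • toL2)

/-- The spectral assumption: `𝓛` has exactly one negative eigenvalue, which is simple, and `0` is
a simple eigenvalue with eigenfunction `φ'`. -/
structure SpectralHyp (f : ℝ → ℝ) (hf : ContDiff ℝ ∞ f) (speed : ℝ) (φ : SmoothPer L) : Prop where
  negative : ∃ lam < 0, Module.finrank ℝ (eigenspace (linOp S f hf speed φ) lam) = 1 ∧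
    ∀ lam' < 0, eigenspace (linOp S f hf speed φ) lam' ≠ ⊥ → lam' = lam
  zero_simple : Module.finrank ℝ (eigenspace (linOp S f hf speed φ) 0) = 1
  derivative_mem : φ.derivative.inH S.m ∈ eigenspace (linOp S f hf speed φ) 0
  derivative_ne : φ.derivative.inH S.m ≠ 0

/-- The Gårding type inequality `(𝓛v, v) ≥ c₁ ‖v‖²_{m/2} - c₂ ‖v‖²` on `C^∞_per`. -/
def GardingHyp (f : ℝ → ℝ) (hf : ContDiff ℝ ∞ f) (speed : ℝ) (φ : SmoothPer L) : Prop :=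
  ∃ c₁ > 0, ∃ c₂ > 0, ∀ v : SmoothPer L,
    c₁ * ‖v.inH (S.m / 2)‖ ^ 2 - c₂ * ‖v.inL2‖ ^ 2
      ≤ inner ℝ (linOp S f hf speed φ (v.inH S.m)) v.inL2

/-- `Q'(φ) = μ + νφ`, as an element of `L²_per`. -/
def derivQ (μ ν : ℝ) (φ : SmoothPer L) : L2Per L := μ • (SmoothPer.one L).inL2 + ν • φ.inL2

/-- Positivity of `𝓛`: `(𝓛v, v) ≥ c₃ ‖v‖²` if `(v, φ') = (v, Q'(φ)) = 0`. -/
def PositivityHyp (f : ℝ → ℝ) (hf : ContDiff ℝ ∞ f) (speed μ ν : ℝ) (φ : SmoothPer L) : Prop :=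
  ∃ c₃ > 0, ∀ v : HPer L S.m,
    inner ℝ (toL2 v) φ.derivative.inL2 = 0 → inner ℝ (toL2 v) (derivQ μ ν φ) = 0 →
    c₃ * ‖toL2 v‖ ^ 2 ≤ inner ℝ (linOp S f hf speed φ v) (toL2 v)

end Operators

/-! ### The functionals on the energy space `H^{m/2}_per` -/

section Functionals

variable {L : ℝ} [Fact (0 < L)] (S : DispersionSymbol)

/-- The condition under which `u ↦ ∫ W(u) dx`, `W' = f`, is a `C²` functional on `H^{m/2}_per`:
no condition for `m > 1` (then `H^{m/2}_per ⊆ L^∞`), and for `m ≤ 1` a bound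
`|f'(x)| ≤ C (1 + |x|^p)` with an exponent such that `H^{m/2}_per ⊆ L^{p+2}`
(any `p ≥ 0` for `m = 1`, and `p ≤ 2m/(1-m)` for `m < 1`). -/
def GrowthCondition (m : ℝ) (f : ℝ → ℝ) : Prop :=
  1 < m ∨ ∃ p C : ℝ, 0 ≤ p ∧ p * (1 - m) ≤ 2 * m ∧ ∀ x, |deriv f x| ≤ C * (1 + |x| ^ p)

/-- `∫₀ᴸ u 𝓜u dx` on the energy space, that is, the duality pairing `⟨𝓜u, u⟩` of `H^{-m/2}_per`
and `H^{m/2}_per`, which is `L ∑ θ(k) |û(k)|²`. -/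
def quadM (u : HPer L (S.m / 2)) : ℝ := L * ∑' k : ℤ, S.θ k * ‖hat u k‖ ^ 2

/-- The energy `P(u) = ½ ∫₀ᴸ (u 𝓜u - 2 W(u)) dx`, where `W' = f`. -/
def energyP (W : ℝ → ℝ) (u : HPer L (S.m / 2)) : ℝ :=
  1 / 2 * quadM S u - ∫ x, W (toL2 u x)

/-- `F(u) = ½ ∫₀ᴸ u² dx`. -/
def momentumF {s : ℝ} (u : HPer L s) : ℝ := 1 / 2 * ∫ x, toL2 u x ^ 2

/-- `M(u) = ∫₀ᴸ u dx`. -/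
def massM {s : ℝ} (u : HPer L s) : ℝ := ∫ x, toL2 u x

/-- The constrained energy `G = P + ωF + AM`. -/
def functionalG (W : ℝ → ℝ) (speed A : ℝ) (u : HPer L (S.m / 2)) : ℝ :=
  energyP S W u + speed * momentumF u + A * massM u

/-- `Q = μM + νF`. -/
def functionalQ {s : ℝ} (μ ν : ℝ) (u : HPer L s) : ℝ := μ * massM u + ν * momentumF u

/-- `V(v) = G(v) - G(φ) + σ (Q(v) - Q(φ))²`. -/
def functionalV (W : ℝ → ℝ) (speed A μ ν σ : ℝ) (φ : SmoothPer L) (v : HPer L (S.m / 2)) : ℝ :=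
  functionalG S W speed A v - functionalG S W speed A (φ.inH (S.m / 2))
    + σ * (functionalQ μ ν v - functionalQ μ ν (φ.inH (S.m / 2))) ^ 2

end Functionals

/-! ### The Cauchy problem -/

section Cauchy

variable {L : ℝ} [Fact (0 < L)] (S : DispersionSymbol)

/-- `u ∈ C([0,∞); H^s_per)` is a global solution of `u_t + (f(u))_x - (𝓜u)_x = 0`, in the sense
of periodic distributions: the equation holds tested against every `exp(-2πikx/L)`. -/
structure IsGlobalSolution (f : ℝ → ℝ) {s : ℝ} (u : ℝ → HPer L s) : Prop where
  continuousOn : ContinuousOn u (Ici 0)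
  equation : ∀ t ≥ 0, ∀ k : ℤ, HasDerivWithinAt (fun τ => hat (u τ) k)
    (-(2 * Real.pi * Complex.I * k / L) *
      (fc (fun x => f (toL2 (u t) x)) k - (S.θ k : ℂ) * hat (u t) k)) (Ici 0) t

/-- Global well-posedness in `H^s_per`: existence, uniqueness, continuous dependence on the data
and persistence of smoothness. Uniqueness is required in a class `X` of curves, which may be the
class of all curves or a smaller one (as when uniqueness is known in an auxiliary space only). -/
structure GloballyWellPosed (f : ℝ → ℝ) (s : ℝ) (X : Set (ℝ → HPer L s)) : Prop where
  existence : ∀ u₀ : HPer L s, ∃ u ∈ X, IsGlobalSolution S f u ∧ u 0 = u₀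
  uniqueness : ∀ u ∈ X, ∀ v ∈ X, IsGlobalSolution S f u → IsGlobalSolution S f v →
    u 0 = v 0 → EqOn u v (Ici 0)
  continuous_dependence : ∀ u ∈ X, IsGlobalSolution S f u → ∀ T > 0, ∀ ε > 0, ∃ δ > 0,
    ∀ v ∈ X, IsGlobalSolution S f v → ‖v 0 - u 0‖ < δ → ∀ t ∈ Icc 0 T, ‖v t - u t‖ < ε
  persistence : ∀ u ∈ X, IsGlobalSolution S f u → (∃ g : SmoothPer L, u 0 = g.inH s) →
    ∀ r : ℝ, ∃ w : ℝ → HPer L r, ContinuousOn w (Ici 0) ∧ ∀ t ≥ 0, toL2 (w t) = toL2 (u t)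

end Cauchy

/-! ### Lyapunov functions for the orbit -/

section Lyapunov

variable {L : ℝ} [Fact (0 < L)] (S : DispersionSymbol)

/-- The orbit `Ω_φ = {φ(· + r) : r ∈ ℝ}`. -/
def orbit (s : ℝ) (φ : SmoothPer L) : Set (HPer L s) :=
  range fun r : ℝ => translate r (φ.inH s)

/-- The `ε`-neighborhood of the orbit in `H^s_per`; `infDist v Ω_φ = inf_r ‖v - φ(· + r)‖_s`. -/
def orbitNhd (s : ℝ) (φ : SmoothPer L) (ε : ℝ) : Set (HPer L s) :=
  {v | Metric.infDist v (orbit s φ) < ε}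

/-- `V` is a Lyapunov function for the orbit of `φ`, with respect to the solutions of class `X`
in `C([0,∞); H^s_per)`, `s ≥ m/2`. -/
structure IsLyapunov (f : ℝ → ℝ) {s : ℝ} (hs : S.m / 2 ≤ s) (X : Set (ℝ → HPer L s))
    (φ : SmoothPer L) (V : HPer L (S.m / 2) → ℝ) : Prop where
  near_orbit : ∃ ρ > 0,
    ContDiffOn ℝ 2 V (orbitNhd (S.m / 2) φ ρ) ∧
    (∀ v ∈ orbit (S.m / 2) φ, V v = 0 ∧ fderiv ℝ V v = 0) ∧
    (∃ c > 0, ∀ v ∈ orbitNhd (S.m / 2) φ ρ,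
      c * Metric.infDist v (orbit (S.m / 2) φ) ^ 2 ≤ V v) ∧
    (∀ v ∈ orbitNhd (S.m / 2) φ ρ, ∀ w, IsDerivativeOf w v → fderiv ℝ V v w = 0)
  translation_invariant : ∀ (v : HPer L (S.m / 2)) (r : ℝ), V (translate r v) = V v
  conserved : ∀ u ∈ X, IsGlobalSolution S f u → ∀ t ≥ 0, V (incl hs (u t)) = V (incl hs (u 0))

end Lyapunov

end PeriodicWave

end

set_option linter.unusedSectionVars false

namespace PeriodicWave
-- Parseval's identity and Fourier series of real periodic functions.
section Parseval
open Filter Topology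

variable {L : ℝ} [Fact (0 < L)]

/-! The wave equation says that `φ` is a critical point of `G`, and `𝓛` is the second variation of
`G` there. By `(H₂)` this form controls the `L²` norm once the directions `φ'` and `Q'(φ)` are
excluded. The direction `Q'(φ)` is repaired by the term `σ (Q - Q(φ))²`, whose second variation is
`2σ (h, Q'(φ))²`. The direction `φ'` is harmless: it is tangent to the orbit, and translating `v`
suitably makes the difference with `φ` orthogonal to it.

Lower bound. Penalizing both components makes the form positive in `L²`
(`exists_penalized_lower_bound`), the Gårding inequality upgrades this to the `H^{m/2}` norm on
smooth functions, and density carries it to the energy space (`exists_coercive`). Together with a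
second order Taylor expansion of `G` this gives `V(φ + h) ≥ c ‖h‖²` for small `h` with `(h, φ') =
0`. To reach such an `h` from `v`, the translation is chosen to minimize the `L²` distance and not
the energy distance, since `(H₂)` is stated with `L²` orthogonality. Interpolation between `L²` and
`H^m` shows that the chosen translate of `φ` is still close in `H^{m/2}` (`exists_close_translate`).
Now `V` vanishes on the orbit and is nonnegative near it, so the orbit consists of local minima and
`V' = 0` there. The identity `⟨V'(v), ∂ₓv⟩ = 0` is the derivative of translation invariance.

Regularity. The only nontrivial point is that `u ↦ ∫ W(u)` is `C²`. The energy space embeds in some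
`L^{p+2}` on which `f'` may be taken to grow like `|x|^p`. For `m < 1` this is the critical Sobolev
embedding, proved by cutting the frequencies at a threshold that depends on the level of the
distribution function. For `m = 1` a subcritical exponent suffices. For `m > 1` the space embeds in
`L^∞` and `W` can be cut off. On `L^{p+2}` the derivatives come from continuity of superposition
operators and Hölder's inequality (`HasGrowth.taylor`, `HasGrowth.contDiff_two`).

Conservation. The equation is `u_t = ∂ₓ P'(u)`. For smooth data the flow is a differentiable curve
in `H^{m/2}`, and the three invariants have zero derivative: `P` because `∂ₓ` is skew, `F` because
`P` is translation invariant, and `M` because the zero mode of a derivative vanishes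
(`tangent_levels`). Density of smooth data and continuous dependence extend this to all solutions
(`functionalV_conserved`). -/

theorem integral_volume_eq_haar (g : AddCircle L → ℝ) :
    ∫ x, g x = L * ∫ x, g x ∂(AddCircle.haarAddCircle (T := L)) := by
  have hL : (0 : ℝ) < L := Fact.out
  rw [AddCircle.volume_eq_smul_haarAddCircle, integral_smul_measure, ENNReal.toReal_ofReal hL.le,
    smul_eq_mul]

/-- The factor `L` appears because the coefficients are taken against normalized Haar measure, while
the norm uses Lebesgue measure of mass `L`. -/
theorem norm_sq_eq_tsum_fc (u : L2Per L) : ‖u‖ ^ 2 = L * ∑' k : ℤ, ‖fc u k‖ ^ 2 := by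
  have h := hasSum_sq_fourierCoeff ((memLp_ofReal u).toLp _)
  have e : ∀ k, fourierCoeff ((memLp_ofReal u).toLp _) k = fc u k := fun k =>
    congrFun (fourierCoeff_congr_ae (MemLp.coeFn_toLp (memLp_ofReal u))) k
  simp only [e] at h
  rw [h.tsum_eq, ← real_inner_self_eq_norm_sq, L2.inner_def, integral_volume_eq_haar]
  congr 1
  apply integral_congr_ae
  filter_upwards [MemLp.coeFn_toLp (memLp_ofReal u)] with x hx
  rw [hx]
  simp [sq]

theorem summable_conj_mul_re {a b : ℤ → ℂ} (ha : Summable fun k => ‖a k‖ ^ 2)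
    (hb : Summable fun k => ‖b k‖ ^ 2) :
    Summable fun k : ℤ => ((starRingEnd ℂ) (a k) * b k).re := by
  refine Summable.of_norm_bounded (ha.add hb) (fun k => ?_)
  have h1 : |((starRingEnd ℂ) (a k) * b k).re| ≤ ‖a k‖ * ‖b k‖ := by
    refine (Complex.abs_re_le_norm _).trans ?_
    rw [norm_mul, RCLike.norm_conj]
  rw [Real.norm_eq_abs]
  nlinarith [sq_nonneg (‖a k‖ - ‖b k‖), sq_nonneg ‖a k‖, sq_nonneg ‖b k‖]

/-- Polarization of the norm identity, by expanding `‖u + v‖²` on both sides. -/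
theorem inner_eq_tsum_fc (u v : L2Per L) :
    inner ℝ u v = L * ∑' k : ℤ, ((starRingEnd ℂ) (fc u k) * fc v k).re := by
  have hs := summable_conj_mul_re (summable_fc_sq u) (summable_fc_sq v)
  have h1 := norm_add_sq_real u v
  rw [norm_sq_eq_tsum_fc, norm_sq_eq_tsum_fc u, norm_sq_eq_tsum_fc v] at h1
  have h2 : ∀ k, ‖fc (⇑(u + v)) k‖ ^ 2 = ‖fc u k‖ ^ 2
      + 2 * ((starRingEnd ℂ) (fc u k) * fc v k).re + ‖fc v k‖ ^ 2 := by
    intro k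
    rw [fc_add, ← Complex.normSq_eq_norm_sq, ← Complex.normSq_eq_norm_sq,
      ← Complex.normSq_eq_norm_sq]
    simp only [Complex.normSq_apply, Complex.add_re, Complex.add_im, Complex.mul_re,
      Complex.conj_re, Complex.conj_im]
    ring
  simp only [h2] at h1
  rw [((summable_fc_sq u).add (hs.mul_left 2)).tsum_add (summable_fc_sq v),
    (summable_fc_sq u).tsum_add (hs.mul_left 2), tsum_mul_left] at h1
  linarith

theorem fc_zero_index (u : L2Per L) : ((∫ x, u x : ℝ) : ℂ) = L * fc u 0 := by
  have hL : (0 : ℝ) < L := Fact.out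
  rw [integral_volume_eq_haar]
  unfold fc fourierCoeff
  push_cast
  rw [← integral_complex_ofReal]
  simp

/-- A function with absolutely summable Fourier coefficients is the sum of its Fourier series. -/
theorem ae_eq_tsum_fourier (u : L2Per L) (h : Summable fun k => ‖fc u k‖) :
    ∀ᵐ x, ((u x : ℝ) : ℂ) = ∑' k : ℤ, fc u k * fourier k x := by
  set v := (memLp_ofReal u).toLp _ with hv
  have e : ∀ k, fourierCoeff v k = fc u k := fun k =>
    congrFun (fourierCoeff_congr_ae (MemLp.coeFn_toLp (memLp_ofReal u))) k
  have h1 : HasSum (fun k : ℤ => fc u k • (fourierLp 2 k)) v := by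
    have := hasSum_fourier_series_L2 v
    simpa only [e] using this
  have hs : Summable fun k : ℤ => fc u k • (fourier k : C(AddCircle L, ℂ)) := by
    apply Summable.of_norm
    simpa [norm_smul, fourier_norm] using h
  have h2 := hs.hasSum.mapL (ContinuousMap.toLp 2 (AddCircle.haarAddCircle (T := L)) ℂ)
  have h3 : v = ContinuousMap.toLp 2 (AddCircle.haarAddCircle (T := L)) ℂ
      (∑' k : ℤ, fc u k • (fourier k : C(AddCircle L, ℂ))) := by
    apply h1.unique
    simpa only [map_smul] using h2
  apply haar_ae
  filter_upwards [MemLp.coeFn_toLp (memLp_ofReal u), ContinuousMap.coeFn_toLp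
    (p := 2) (𝕜 := ℂ) (AddCircle.haarAddCircle (T := L))
    (∑' k : ℤ, fc u k • (fourier k : C(AddCircle L, ℂ)))] with x hx1 hx2
  rw [← hx1, ← hv, h3, hx2, ← ContinuousMap.tsum_apply hs]
  simp

/-- The source of all pointwise bounds: it serves both the embedding in `L^∞` and the control of the
low modes in the critical embedding. -/
theorem ae_abs_le_tsum_fc (u : L2Per L) (h : Summable fun k => ‖fc u k‖) :
    ∀ᵐ x, |u x| ≤ ∑' k, ‖fc u k‖ := by
  filter_upwards [ae_eq_tsum_fourier u h] with x hx
  rw [← Real.norm_eq_abs, ← Complex.norm_real, hx]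
  have hn : ∀ k : ℤ, ‖fc u k * fourier k x‖ = ‖fc u k‖ := fun k => by
    rw [norm_mul, fourier_apply, Circle.norm_coe, mul_one]
  refine (norm_tsum_le_tsum_norm (by simpa only [hn] using h)).trans ?_
  simp only [hn, le_refl]

end Parseval

/-! ### Sobolev spaces: inclusions, translations, differentiation of curves mode by mode. -/

noncomputable section SobolevBasics
open Filter Topology

variable {L : ℝ} [Fact (0 < L)]

theorem hper_ext {s : ℝ} {u v : HPer L s} (h : ∀ k, hat u k = hat v k) : u = v :=
  toL2_injective (fc_injective h)

theorem hat_sub {s : ℝ} (u v : HPer L s) (k : ℤ) : hat (u - v) k = hat u k - hat v k := by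
  have h := hat_add (u - v) v k
  rw [sub_add_cancel] at h
  rw [h, add_sub_cancel_right]

theorem toL2_eq_val {s : ℝ} (u : HPer L s) : toL2 u = Subtype.val u := rfl

theorem toL2_incl {r s : ℝ} (h : r ≤ s) (u : HPer L s) : toL2 (incl h u) = toL2 u := by
  rw [toL2_eq_val, toL2_eq_val]
  exact Submodule.coe_inclusion (sobolev_mono h) u

theorem hat_incl {r s : ℝ} (h : r ≤ s) (u : HPer L s) (k : ℤ) : hat (incl h u) k = hat u k := by
  unfold hat
  rw [toL2_incl]

theorem toL2_inH (g : SmoothPer L) (s : ℝ) : toL2 (g.inH s) = g.inL2 := rfl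

theorem incl_inH {r s : ℝ} (h : r ≤ s) (g : SmoothPer L) : incl h (g.inH s) = g.inH r :=
  toL2_injective (by rw [toL2_incl, toL2_inH, toL2_inH])

theorem hat_inH (g : SmoothPer L) (s : ℝ) (k : ℤ) : hat (g.inH s) k = fc g.onCircle k :=
  fc_congr g.coeFn_inL2 k

theorem fc_inL2 (g : SmoothPer L) (k : ℤ) : fc g.inL2 k = fc g.onCircle k :=
  fc_congr g.coeFn_inL2 k

theorem hat_translate {s : ℝ} (r : ℝ) (u : HPer L s) (k : ℤ) :
    hat (translate r u) k = fourier k (r : AddCircle L) * hat u k := fc_translateL2 r (toL2 u) k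

theorem one_le_wt {s : ℝ} (hs : 0 ≤ s) (k : ℤ) : 1 ≤ wt s k :=
  Real.one_le_rpow (by nlinarith [sq_nonneg (k : ℝ)]) hs

theorem wt_mul_wt (r s : ℝ) (k : ℤ) : wt r k * wt s k = wt (r + s) k :=
  (Real.rpow_add (by positivity) r s).symm

theorem wt_zero (k : ℤ) : wt 0 k = 1 := Real.rpow_zero _

/-- Coefficients with the symmetry of a real function and enough decay define an element of
`H^s_per`. -/
theorem exists_hat_eq {s : ℝ} (hs : 0 ≤ s) (c : ℤ → ℂ)
    (hc : Summable fun k => wt s k * ‖c k‖ ^ 2)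
    (hr : ∀ k, c (-k) = (starRingEnd ℂ) (c k)) : ∃ u : HPer L s, ∀ k, hat u k = c k := by
  have h0 : Summable fun k => ‖c k‖ ^ 2 :=
    Summable.of_nonneg_of_le (fun k => sq_nonneg _)
      (fun k => le_mul_of_one_le_left (sq_nonneg _) (one_le_wt hs k)) hc
  obtain ⟨u, hu⟩ := exists_fc_eq (L := L) c h0 hr
  refine ⟨⟨u, ?_⟩, hu⟩
  change Summable fun k : ℤ => wt s k * ‖fc u k‖ ^ 2
  simpa only [hu] using hc

theorem norm_toL2_le {s : ℝ} (hs : 0 ≤ s) (u : HPer L s) : ‖toL2 u‖ ≤ ‖u‖ := by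
  have hL : (0 : ℝ) < L := Fact.out
  apply le_of_sq_le_sq _ (norm_nonneg u)
  rw [norm_sq_eq_tsum_fc, hper_norm_sq]
  refine mul_le_mul_of_nonneg_left ?_ hL.le
  exact (summable_fc_sq _).tsum_le_tsum
    (fun k => le_mul_of_one_le_left (sq_nonneg _) (one_le_wt hs k)) (summable_hat u)

theorem norm_incl_le {r s : ℝ} (h : r ≤ s) (u : HPer L s) : ‖incl h u‖ ≤ ‖u‖ := by
  have hL : (0 : ℝ) < L := Fact.out
  apply le_of_sq_le_sq _ (norm_nonneg u)
  rw [hper_norm_sq, hper_norm_sq]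
  refine mul_le_mul_of_nonneg_left ?_ hL.le
  refine (summable_hat (incl h u)).tsum_le_tsum (fun k => ?_) (summable_hat u)
  rw [hat_incl]
  exact mul_le_mul_of_nonneg_right (wt_mono h k) (sq_nonneg _)

/-- The inclusion `H^s_per ⊆ L²_per` as a continuous linear map. -/
def toL2CLM {s : ℝ} (hs : 0 ≤ s) : HPer L s →L[ℝ] L2Per L :=
  toL2.mkContinuous 1 fun u => by rw [one_mul]; exact norm_toL2_le hs u

theorem toL2CLM_apply {s : ℝ} (hs : 0 ≤ s) (u : HPer L s) : toL2CLM hs u = toL2 u := rfl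

/-- The inclusion `H^s_per ⊆ H^r_per` as a continuous linear map. -/
def inclCLM {r s : ℝ} (h : r ≤ s) : HPer L s →L[ℝ] HPer L r :=
  (incl h).mkContinuous 1 fun u => by rw [one_mul]; exact norm_incl_le h u

theorem norm_hat_translate {s : ℝ} (r : ℝ) (u : HPer L s) (k : ℤ) :
    ‖hat (translate r u) k‖ = ‖hat u k‖ := norm_fc_translateL2 r (toL2 u) k

theorem norm_translate {s : ℝ} (r : ℝ) (u : HPer L s) : ‖translate r u‖ = ‖u‖ := by
  have h : ‖translate r u‖ ^ 2 = ‖u‖ ^ 2 := by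
    rw [hper_norm_sq, hper_norm_sq]
    simp only [norm_hat_translate]
  exact (pow_left_inj₀ (norm_nonneg _) (norm_nonneg _) two_ne_zero).1 h

theorem translate_sub {s : ℝ} (r : ℝ) (u v : HPer L s) :
    translate r (u - v) = translate r u - translate r v :=
  hper_ext fun k => by rw [hat_sub, hat_translate, hat_translate, hat_translate, hat_sub, mul_sub]

theorem fourier_coe_add (k : ℤ) (x y : AddCircle L) :
    (fourier k (x + y) : ℂ) = fourier k x * fourier k y := by
  rw [fourier_apply, fourier_apply, fourier_apply, smul_add, AddCircle.toCircle_add,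
    Circle.coe_mul]

theorem translate_translate {s : ℝ} (r r' : ℝ) (u : HPer L s) :
    translate r (translate r' u) = translate (r + r') u :=
  hper_ext fun k => by
    rw [hat_translate, hat_translate, hat_translate, AddCircle.coe_add, fourier_coe_add, mul_assoc]

theorem translate_zero {s : ℝ} (u : HPer L s) : translate 0 u = u :=
  hper_ext fun k => by
    rw [hat_translate, AddCircle.coe_zero, fourier_apply, smul_zero, AddCircle.toCircle_zero,
      Circle.coe_one, one_mul]

theorem translate_period {s : ℝ} (u : HPer L s) : translate L u = u :=
  hper_ext fun k => by
    rw [hat_translate, AddCircle.coe_period, fourier_apply, smul_zero, AddCircle.toCircle_zero,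
      Circle.coe_one, one_mul]

theorem norm_sub_translate {s : ℝ} (r r' : ℝ) (u v : HPer L s) :
    ‖translate r u - translate r' v‖ = ‖u - translate (r' - r) v‖ := by
  have h : translate r' v = translate r (translate (r' - r) v) := by
    rw [translate_translate]
    congr 1
    ring
  rw [h, ← translate_sub, norm_translate]

/-- A curve in `H^s_per` is differentiable if its Fourier coefficients are, and if their increments
are dominated. -/
theorem hasDerivWithinAt_of_hat {s : ℝ} {u : ℝ → HPer L s} {g : HPer L s} {D : Set ℝ} {t : ℝ}
    {b : ℤ → ℝ} (hb : Summable fun k => wt s k * b k ^ 2)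
    (hd : ∀ k, HasDerivWithinAt (fun τ => hat (u τ) k) (hat g k) D t)
    (hdom : ∀ᶠ τ in 𝓝[D] t, ∀ k, ‖hat (u τ) k - hat (u t) k‖ ≤ b k * |τ - t|) :
    HasDerivWithinAt u g D t := by
  have hL : (0 : ℝ) < L := Fact.out
  rw [hasDerivWithinAt_iff_tendsto_slope]
  rw [tendsto_iff_norm_sub_tendsto_zero]
  have hslope : ∀ τ k, hat (slope u t τ) k = slope (fun τ => hat (u τ) k) t τ := by
    intro τ k
    rw [slope_def_module, slope_def_module, hat_smul, hat_sub, Complex.real_smul]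
  have hd' : ∀ k, Tendsto (fun τ => hat (slope u t τ - g) k) (𝓝[D \ {t}] t) (𝓝 0) := by
    intro k
    have := hasDerivWithinAt_iff_tendsto_slope.1 (hd k)
    simp only [hat_sub, hslope]
    simpa using this.sub_const (hat g k)
  -- The majorant does not depend on `τ` and is summable, so dominated convergence applies to the
  -- series for `‖slope - g‖²`.
  have hdom' : ∀ᶠ τ in 𝓝[D \ {t}] t, ∀ k,
      ‖wt s k * ‖hat (slope u t τ - g) k‖ ^ 2‖ ≤ 2 * (wt s k * b k ^ 2 + wt s k * ‖hat g k‖ ^ 2) := by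
    filter_upwards [nhdsWithin_mono t sdiff_subset hdom, self_mem_nhdsWithin] with τ hτ hτ' k
    have hne : 0 < |τ - t| := abs_pos.2 (sub_ne_zero.2 hτ'.2)
    have h1 : ‖hat (slope u t τ) k‖ ≤ b k := by
      rw [hslope, slope_def_module, norm_smul, norm_inv, Real.norm_eq_abs,
        inv_mul_le_iff₀ hne, mul_comm]
      exact hτ k
    have h2 : ‖hat (slope u t τ - g) k‖ ≤ b k + ‖hat g k‖ := by
      rw [hat_sub]
      exact (norm_sub_le _ _).trans (by gcongr)
    have h3 : ‖hat (slope u t τ - g) k‖ ^ 2 ≤ 2 * (b k ^ 2 + ‖hat g k‖ ^ 2) := by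
      nlinarith [norm_nonneg (hat (slope u t τ - g) k), sq_nonneg (b k - ‖hat g k‖)]
    rw [Real.norm_eq_abs, abs_of_nonneg (mul_nonneg (wt_pos s k).le (sq_nonneg _))]
    calc _ ≤ wt s k * (2 * (b k ^ 2 + ‖hat g k‖ ^ 2)) :=
          mul_le_mul_of_nonneg_left h3 (wt_pos s k).le
      _ = _ := by ring
  have h0 : Tendsto (fun τ => ‖slope u t τ - g‖ ^ 2) (𝓝[D \ {t}] t) (𝓝 0) := by
    simp only [hper_norm_sq]
    have := (tendsto_tsum_of_dominated_convergence
      ((hb.add (summable_hat g)).mul_left 2)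
      (fun k => (((hd' k).norm.pow 2).const_mul (wt s k))) hdom').const_mul L
    simpa using this
  have := h0.sqrt
  simpa [Real.sqrt_sq (norm_nonneg _)] using this

/-- Differentiation of translations: `d/dr v(· + r) = ∂ₓ v` at `r = 0`, if `∂ₓ v ∈ H^s_per`. -/
theorem hasDerivAt_translate {s : ℝ} {v w : HPer L s} (h : IsDerivativeOf w v) :
    HasDerivAt (fun r => translate r v) w 0 := by
  have hL : (0 : ℝ) < L := Fact.out
  have hf : ∀ (k : ℤ) (r : ℝ), HasDerivAt (fun r : ℝ => (fourier k (r : AddCircle L) : ℂ))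
      ((2 * Real.pi * Complex.I * k / L) * fourier k (r : AddCircle L)) r := fun k r =>
    hasDerivAt_fourier L k r
  rw [← hasDerivWithinAt_univ]
  -- For every `r`, the derivative of `e^{2πikr/L} v̂(k)` has modulus `|ŵ(k)|`. By the mean value
  -- inequality `ŵ` itself dominates the increments.
  refine hasDerivWithinAt_of_hat (b := fun k => ‖hat w k‖) (summable_hat w) (fun k => ?_) ?_
  · rw [hasDerivWithinAt_univ]
    simp only [hat_translate]
    have h1 := (hf k 0).mul_const (hat v k)
    rwa [AddCircle.coe_zero, fourier_apply (T := L) (x := 0), smul_zero, AddCircle.toCircle_zero,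
      Circle.coe_one, mul_one, ← h k] at h1
  · refine Eventually.of_forall fun τ k => ?_
    have := Convex.norm_image_sub_le_of_norm_hasDerivWithin_le (s := univ) (x := (0 : ℝ)) (y := τ)
      (C := ‖hat w k‖) (f := fun r : ℝ => (fourier k (r : AddCircle L) : ℂ) * hat v k)
      (fun r _ => ((hf k r).mul_const (hat v k)).hasDerivWithinAt)
      (fun r _ => by
        rw [h k, norm_mul, norm_mul, norm_mul, fourier_apply, Circle.norm_coe, mul_one])
      convex_univ (mem_univ _) (mem_univ _)
    simpa only [hat_translate, Real.norm_eq_abs] using this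

theorem summable_wt {s : ℝ} (hs : 1 / 2 < s) : Summable fun k : ℤ => wt (-s) k := by
  have h1 : Summable fun k : ℤ => |(k : ℝ)| ^ (-(2 * s)) :=
    Real.summable_abs_int_rpow (by linarith)
  refine Summable.of_norm_bounded_eventually h1 ?_
  have : ∀ᶠ k : ℤ in cofinite, k ≠ 0 :=
    (finite_singleton (0 : ℤ)).compl_mem_cofinite
  filter_upwards [this] with k hk
  have hk' : 0 < |(k : ℝ)| := abs_pos.2 (by exact_mod_cast hk)
  rw [Real.norm_eq_abs, abs_of_pos (wt_pos _ _)]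
  have e : |(k : ℝ)| ^ (-(2 * s)) = (((k : ℝ)) ^ 2) ^ (-s) := by
    rw [← sq_abs, ← Real.rpow_natCast, ← Real.rpow_mul hk'.le]
    congr 1
    push_cast
    ring
  rw [e]
  exact Real.rpow_le_rpow_of_nonpos (by positivity) (by linarith) (by linarith)

end SobolevBasics

/-! ### Smooth functions and rapidly decaying Fourier coefficients. -/

noncomputable section SmoothRealization
open Filter Topology

variable {L : ℝ} [Fact (0 < L)]

theorem iteratedDeriv_const_mul_cexp (c a : ℂ) (n : ℕ) :
    iteratedDeriv n (fun x : ℝ => c * Complex.exp (a * x)) =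
      fun x : ℝ => a ^ n * (c * Complex.exp (a * x)) := by
  induction n with
  | zero => simp
  | succ n ih =>
    rw [iteratedDeriv_succ, ih]
    funext x
    have h1 : HasDerivAt (fun x : ℝ => a * (x : ℂ)) a x := by
      simpa using (Complex.ofRealCLM.hasDerivAt (x := x)).const_mul a
    have h2 := ((h1.cexp.const_mul c).const_mul (a ^ n)).deriv
    rw [h2, pow_succ]
    ring

/-- The series of derivatives of a Fourier series is dominated by the moments of the
coefficients. -/
theorem norm_iteratedFDeriv_fourier_mode (c : ℂ) (k : ℤ) (n : ℕ) (x : ℝ) :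
    ‖iteratedFDeriv ℝ n (fun x : ℝ => c * Complex.exp (2 * Real.pi * Complex.I * k / L * x)) x‖
      = (2 * Real.pi * |(k : ℝ)| / L) ^ n * ‖c‖ := by
  have hL : (0 : ℝ) < L := Fact.out
  rw [norm_iteratedFDeriv_eq_norm_iteratedDeriv, iteratedDeriv_const_mul_cexp]
  have e : (2 * Real.pi * Complex.I * k / L * x : ℂ) = ((2 * Real.pi * k / L * x : ℝ) : ℂ)
      * Complex.I := by
    push_cast
    ring
  beta_reduce
  rw [e, norm_mul, norm_mul, Complex.norm_exp_ofReal_mul_I, mul_one, norm_pow]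
  congr 2
  simp [abs_of_pos Real.pi_pos, abs_of_pos hL]

/-- A function with rapidly decaying Fourier coefficients is smooth. -/
theorem exists_smoothPer (u : L2Per L)
    (h : ∀ n : ℕ, Summable fun k : ℤ => (2 * Real.pi * |(k : ℝ)| / L) ^ n * ‖fc u k‖) :
    ∃ g : SmoothPer L, g.inL2 = u ∧ ∀ (n : ℕ) (x : ℝ),
      ‖iteratedFDeriv ℝ n g.toFun x‖ ≤ ∑' k : ℤ, (2 * Real.pi * |(k : ℝ)| / L) ^ n * ‖fc u k‖ := by
  have hL : (0 : ℝ) < L := Fact.out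
  let F : ℤ → ℝ → ℂ := fun k x => fc u k * Complex.exp (2 * Real.pi * Complex.I * k / L * x)
  have hF : ∀ k, ContDiff ℝ ∞ (F k) := by
    intro k
    have : ContDiff ℝ ∞ fun x : ℝ => (x : ℂ) := Complex.ofRealCLM.contDiff
    exact contDiff_const.mul (contDiff_const.mul this).cexp
  have hb : ∀ (n : ℕ) (k : ℤ) (x : ℝ), (n : ℕ∞) ≤ (⊤ : ℕ∞) →
      ‖iteratedFDeriv ℝ n (F k) x‖ ≤ (2 * Real.pi * |(k : ℝ)| / L) ^ n * ‖fc u k‖ :=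
    fun n k x _ => (norm_iteratedFDeriv_fourier_mode (L := L) (fc u k) k n x).le
  let G : ℝ → ℂ := fun x => ∑' k, F k x
  have hG : ContDiff ℝ ∞ G := contDiff_tsum (N := ⊤) hF (fun n _ => h n) hb
  have hper : Function.Periodic G L := by
    intro x
    change ∑' k, F k (x + L) = ∑' k, F k x
    congr 1
    funext k
    change fc u k * _ = fc u k * _
    congr 1
    rw [Complex.exp_eq_exp_iff_exists_int]
    refine ⟨k, ?_⟩
    have : (L : ℂ) ≠ 0 := by exact_mod_cast hL.ne'
    push_cast
    field_simp
  have hre : ContDiff ℝ ∞ (fun x => (G x).re) := Complex.reCLM.contDiff.comp hG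
  let g : SmoothPer L := ⟨fun x => (G x).re, hre, fun x => congrArg Complex.re (hper x)⟩
  have hs : Summable fun k => ‖fc u k‖ := by simpa using h 0
  refine ⟨g, ?_, fun n x => ?_⟩
  · apply Lp.ext
    filter_upwards [g.coeFn_inL2, ae_eq_tsum_fourier u hs] with x hx1 hx2
    rw [hx1]
    obtain ⟨y, rfl⟩ := QuotientAddGroup.mk_surjective x
    have h1 : g.onCircle (y : AddCircle L) = (G y).re := rfl
    have h2 : G y = ∑' k : ℤ, fc u k * fourier k (y : AddCircle L) := by
      change ∑' k, F k y = _
      congr 1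
      funext k
      rw [fourier_coe_apply]
      change fc u k * _ = _
      congr 2
      ring
    erw [h1, h2, ← hx2]
    exact Complex.ofReal_re _
  · have h1 : ‖iteratedFDeriv ℝ n g.toFun x‖ ≤ ‖iteratedFDeriv ℝ n G x‖ := by
      have := Complex.reCLM.norm_iteratedFDeriv_comp_left (x := x) hG.contDiffAt
        (n := n) (by exact_mod_cast le_top)
      rwa [Complex.reCLM_norm, one_mul] at this
    refine h1.trans ?_
    have h2 := iteratedFDeriv_tsum_apply (N := ⊤) hF (fun n _ => h n) hb (k := n) le_top x
    change ‖iteratedFDeriv ℝ n (fun x => ∑' k, F k x) x‖ ≤ _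
    rw [h2]
    have hn : Summable fun k => ‖iteratedFDeriv ℝ n (F k) x‖ :=
      Summable.of_nonneg_of_le (fun k => norm_nonneg _) (fun k => hb n k x le_top) (h n)
    exact (norm_tsum_le_tsum_norm hn).trans (hn.tsum_le_tsum (fun k => hb n k x le_top) (h n))

/-- Smooth functions are dense in `H^s_per`. -/
theorem exists_smoothPer_near {s : ℝ} (hs : 0 ≤ s) (u : HPer L s) {ε : ℝ} (hε : 0 < ε) :
    ∃ g : SmoothPer L, ‖g.inH s - u‖ < ε := by
  have hL : (0 : ℝ) < L := Fact.out
  -- Truncation of the Fourier series. The cut is symmetric in `k`, so the truncation is real, and a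
  -- trigonometric polynomial is smooth.
  let c : ℕ → ℤ → ℂ := fun N k => if |k| ≤ N then hat u k else 0
  have hfin : ∀ N : ℕ, {k : ℤ | |k| ≤ N}.Finite := fun N =>
    (finite_Icc (-N : ℤ) N).subset fun k hk => abs_le.1 hk
  have hsupp : ∀ (N : ℕ) (a : ℤ → ℝ), Summable fun k => a k * ‖c N k‖ := fun N a =>
    summable_of_hasFiniteSupport ((hfin N).subset fun k hk => by
      by_contra hk'
      exact hk (by simp only [c]; rw [if_neg (show ¬ |k| ≤ (N : ℤ) from hk'), norm_zero, mul_zero]))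
  have hc2 : ∀ (N : ℕ), Summable fun k => wt s k * ‖c N k‖ ^ 2 := fun N =>
    (hsupp N fun k => wt s k * ‖c N k‖).congr fun k => by ring
  have hr : ∀ N k, c N (-k) = (starRingEnd ℂ) (c N k) := by
    intro N k
    simp only [c, abs_neg]
    split_ifs
    · exact hat_neg_index u k
    · exact (map_zero _).symm
  choose v hv using fun N => exists_hat_eq (L := L) hs (c N) (hc2 N) (hr N)
  have hlim : Tendsto (fun N => ‖v N - u‖ ^ 2) atTop (𝓝 0) := by
    simp only [hper_norm_sq, hat_sub, hv]
    have h1 : ∀ k, Tendsto (fun N => wt s k * ‖c N k - hat u k‖ ^ 2) atTop (𝓝 0) := by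
      intro k
      apply tendsto_const_nhds.congr'
      filter_upwards [eventually_ge_atTop k.natAbs] with N hN
      have : |k| ≤ N := by
        rw [Int.abs_eq_natAbs]
        exact_mod_cast hN
      simp [c, this]
    have := (tendsto_tsum_of_dominated_convergence (summable_hat u) h1
      (Eventually.of_forall fun N k => ?_)).const_mul L
    · simpa using this
    · rw [Real.norm_eq_abs, abs_of_nonneg (mul_nonneg (wt_pos s k).le (sq_nonneg _))]
      refine mul_le_mul_of_nonneg_left ?_ (wt_pos s k).le
      simp only [c]
      split_ifs
      · simp
      · simp
  obtain ⟨N, hN⟩ := (hlim.eventually (gt_mem_nhds (pow_pos hε 2))).exists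
  obtain ⟨g, hg, -⟩ := exists_smoothPer (toL2 (v N)) fun n => by
    have := hsupp N fun k => (2 * Real.pi * |(k : ℝ)| / L) ^ n
    refine this.congr fun k => ?_
    rw [← hv N k]
    rfl
  refine ⟨g, ?_⟩
  have : g.inH s = v N := toL2_injective hg
  rw [this]
  exact lt_of_pow_lt_pow_left₀ 2 hε.le hN

/-- A function belonging to all Sobolev spaces is smooth, with bounds on the derivatives that
depend only on the decay of the coefficients. -/
theorem summable_moments {u : L2Per L} {n : ℕ} {C : ℝ}
    (h : ∀ k, wt ((n : ℝ) + 2) k * ‖fc u k‖ ^ 2 ≤ C ^ 2) (hC : 0 ≤ C) :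
    (Summable fun k : ℤ => (2 * Real.pi * |(k : ℝ)| / L) ^ n * ‖fc u k‖) ∧
    ∑' k : ℤ, (2 * Real.pi * |(k : ℝ)| / L) ^ n * ‖fc u k‖
      ≤ (2 * Real.pi / L) ^ n * C * ∑' k : ℤ, wt (-1) k := by
  have hL : (0 : ℝ) < L := Fact.out
  have hpi := Real.pi_pos
  have hw : Summable fun k : ℤ => wt (-1) k := summable_wt (by norm_num)
  have key : ∀ k : ℤ, (2 * Real.pi * |(k : ℝ)| / L) ^ n * ‖fc u k‖
      ≤ (2 * Real.pi / L) ^ n * C * wt (-1) k := by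
    intro k
    have h1 : |(k : ℝ)| ^ n ≤ wt ((n : ℝ) / 2) k := by
      unfold wt
      rw [← Real.rpow_natCast, show (n : ℝ) / 2 = (1 / 2) * n by ring,
        Real.rpow_mul (by positivity)]
      apply Real.rpow_le_rpow (abs_nonneg _) _ (by positivity)
      rw [← Real.sqrt_eq_rpow]
      apply Real.le_sqrt_of_sq_le
      rw [sq_abs]
      linarith
    -- Square root of the hypothesis. In the weight `(1 + k²)^{n/2+1}` the exponent `n/2` absorbs
    -- `|k|^n`, and the remaining `1` yields the summable factor `(1 + k²)^{-1}`.
    have h2 : wt ((n : ℝ) / 2 + 1) k * ‖fc u k‖ ≤ C := by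
      apply le_of_sq_le_sq _ hC
      refine le_trans (le_of_eq ?_) (h k)
      rw [mul_pow, sq (wt _ k), wt_mul_wt]
      congr 2
      ring
    have h3 : wt ((n : ℝ) / 2) k = wt (-1) k * wt ((n : ℝ) / 2 + 1) k := by
      rw [wt_mul_wt]
      congr 1
      ring
    calc (2 * Real.pi * |(k : ℝ)| / L) ^ n * ‖fc u k‖
        = (2 * Real.pi / L) ^ n * (|(k : ℝ)| ^ n * ‖fc u k‖) := by
          rw [show 2 * Real.pi * |(k : ℝ)| / L = 2 * Real.pi / L * |(k : ℝ)| by ring, mul_pow]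
          ring
      _ ≤ (2 * Real.pi / L) ^ n * (wt (-1) k * C) := by
          refine mul_le_mul_of_nonneg_left ?_ (by positivity)
          calc |(k : ℝ)| ^ n * ‖fc u k‖ ≤ wt ((n : ℝ) / 2) k * ‖fc u k‖ :=
                mul_le_mul_of_nonneg_right h1 (norm_nonneg _)
            _ = wt (-1) k * (wt ((n : ℝ) / 2 + 1) k * ‖fc u k‖) := by rw [h3]; ring
            _ ≤ _ := mul_le_mul_of_nonneg_left h2 (wt_pos _ k).le
      _ = _ := by ring
  have hs : Summable fun k : ℤ => (2 * Real.pi * |(k : ℝ)| / L) ^ n * ‖fc u k‖ :=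
    Summable.of_nonneg_of_le (fun k => by positivity) key (hw.mul_left _)
  refine ⟨hs, ?_⟩
  rw [← tsum_mul_left]
  exact hs.tsum_le_tsum key (hw.mul_left _)

/-- The Fourier coefficients of a smooth function are bounded by its derivatives. -/
theorem norm_fc_mul_pow_le (g : SmoothPer L) (n : ℕ) {C : ℝ}
    (h : ∀ x, ‖iteratedFDeriv ℝ n g.toFun x‖ ≤ C) (k : ℤ) :
    (2 * Real.pi * |(k : ℝ)| / L) ^ n * ‖fc g.onCircle k‖ ≤ C := by
  have hL : (0 : ℝ) < L := Fact.out
  induction n generalizing g with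
  | zero =>
    simp only [norm_iteratedFDeriv_zero] at h
    rw [pow_zero, one_mul]
    unfold fc fourierCoeff
    have h1 : ∀ x : AddCircle L, ‖(fourier (-k) x : ℂ) • ((g.onCircle x : ℝ) : ℂ)‖ ≤ C := by
      intro x
      obtain ⟨y, rfl⟩ := QuotientAddGroup.mk_surjective x
      rw [norm_smul, fourier_apply, Circle.norm_coe, one_mul, Complex.norm_real]
      exact h y
    refine (norm_integral_le_of_norm_le_const (Eventually.of_forall h1)).trans ?_
    simp
  | succ n ih =>
    have h1 := ih g.derivative (fun x => by
      have := h x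
      rw [norm_iteratedFDeriv_eq_norm_iteratedDeriv, iteratedDeriv_succ'] at this
      rwa [norm_iteratedFDeriv_eq_norm_iteratedDeriv])
    rw [SmoothPer.fc_derivative, norm_mul] at h1
    have h2 : ‖(2 * Real.pi * Complex.I * k / L : ℂ)‖ = 2 * Real.pi * |(k : ℝ)| / L := by
      simp [abs_of_pos Real.pi_pos, abs_of_pos hL]
    rw [h2] at h1
    rw [pow_succ, mul_assoc]
    exact h1

end SmoothRealization

/-! ### Sobolev embeddings into `L^q` and `L^∞`. -/

noncomputable section CriticalSobolev
open Filter Topology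

variable {L : ℝ} [Fact (0 < L)]

/-- A discrete form of `∫ x^{-2s} dx`. In the induction the two new modes `±(n+1)` are paid for by
the increment of `(1 + n)^{1-2s}`. -/
theorem sum_wt_neg_le {s : ℝ} (h0 : 0 < s) (h1 : s < 1 / 2) (n : ℕ) :
    ∑ k ∈ Finset.Icc (-n : ℤ) n, wt (-s) k ≤ 4 / (1 - 2 * s) * (1 + n : ℝ) ^ (1 - 2 * s) := by
  set b := 1 - 2 * s with hb
  have hb0 : 0 < b := by linarith
  have hb1 : b ≤ 1 := by linarith
  induction n with
  | zero =>
    have : (1 : ℝ) ≤ 4 / b := by rw [le_div_iff₀ hb0]; linarith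
    simpa [wt] using this
  | succ n ih =>
    have e : Finset.Icc (-((n + 1 : ℕ) : ℤ)) ((n + 1 : ℕ) : ℤ)
        = insert ((n : ℤ) + 1) (insert (-((n : ℤ) + 1)) (Finset.Icc (-n : ℤ) n)) := by
      ext k
      simp only [Finset.mem_Icc, Finset.mem_insert]
      push_cast
      omega
    rw [e, Finset.sum_insert, Finset.sum_insert]
    · have hw : wt (-s) (-((n : ℤ) + 1)) = wt (-s) ((n : ℤ) + 1) := by
        unfold wt
        congr 1
        push_cast
        ring
      rw [hw]
      have hx : (0 : ℝ) < n + 2 := by positivity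
      have hwb : wt (-s) ((n : ℤ) + 1) ≤ 2 * (n + 2 : ℝ) ^ (b - 1) := by
        have h4 : (n + 2 : ℝ) ^ (b - 1) = ((n + 2 : ℝ) ^ 2) ^ (-s) := by
          rw [← Real.rpow_natCast, ← Real.rpow_mul hx.le]
          congr 1
          push_cast
          linarith
        rw [h4]
        have h5 : ((n + 2 : ℝ) ^ 2) ≤ 4 * (1 + ((n : ℝ) + 1) ^ 2) := by nlinarith
        have h6 : (4 * (1 + ((n : ℝ) + 1) ^ 2)) ^ (-s) ≤ ((n + 2 : ℝ) ^ 2) ^ (-s) :=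
          Real.rpow_le_rpow_of_nonpos (by positivity) h5 (by linarith)
        rw [Real.mul_rpow (by norm_num) (by positivity)] at h6
        have h7 : (1 : ℝ) / 2 ≤ 4 ^ (-s) := by
          have : (4 : ℝ) ^ (-(1 / 2) : ℝ) ≤ 4 ^ (-s) :=
            Real.rpow_le_rpow_of_exponent_le (by norm_num) (by linarith)
          refine le_trans (le_of_eq ?_) this
          rw [show (4 : ℝ) = 2 ^ (2 : ℝ) by norm_num, ← Real.rpow_mul (by norm_num)]
          norm_num [Real.rpow_neg_one]
        have h8 : 0 < wt (-s) ((n : ℤ) + 1) := wt_pos _ _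
        have h9 : wt (-s) ((n : ℤ) + 1) = (1 + ((n : ℝ) + 1) ^ 2) ^ (-s) := by
          simp [wt]
        rw [← h9] at h6
        nlinarith
      -- Bernoulli's inequality for the exponent `b ≤ 1` at `-1/(n+2)`, which is the tangent line
      -- bound for the concave power.
      have hB : b * (n + 2 : ℝ) ^ (b - 1) ≤ (n + 2 : ℝ) ^ b - (n + 1 : ℝ) ^ b := by
        have h2 := rpow_one_add_le_one_add_mul_self (s := -(1 / (n + 2 : ℝ)))
          (by rw [neg_le_neg_iff, div_le_one hx]; linarith) hb0.le hb1
        have h3 : 1 + -(1 / (n + 2 : ℝ)) = (n + 1) / (n + 2) := by field_simp; ring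
        rw [h3, Real.div_rpow (by positivity) hx.le,
          div_le_iff₀ (Real.rpow_pos_of_pos hx b)] at h2
        rw [Real.rpow_sub_one hx.ne']
        have h4 : (1 + b * -(1 / (n + 2 : ℝ))) * (n + 2 : ℝ) ^ b
            = (n + 2 : ℝ) ^ b - b * ((n + 2 : ℝ) ^ b / (n + 2)) := by ring
        linarith
      have h10 : 2 * wt (-s) ((n : ℤ) + 1) ≤ 4 / b * ((n + 2 : ℝ) ^ b - (n + 1 : ℝ) ^ b) := by
        have h11 := mul_le_mul_of_nonneg_left hB (show (0 : ℝ) ≤ 4 / b by positivity)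
        have h12 : 4 / b * (b * (n + 2 : ℝ) ^ (b - 1)) = 4 * (n + 2 : ℝ) ^ (b - 1) := by
          field_simp
        linarith
      have h13 : (1 + ((n + 1 : ℕ) : ℝ)) = n + 2 := by push_cast; ring
      rw [h13]
      rw [add_comm (1 : ℝ) n] at ih
      linarith
    · simp only [Finset.mem_Icc]
      omega
    · simp only [Finset.mem_Icc, Finset.mem_insert]
      omega

/-- Cauchy–Schwarz, with the weight split as `wt (-s) * wt s = 1`. -/
theorem sum_low_modes_le {s : ℝ} (h0 : 0 < s) (h1 : s < 1 / 2) (u : HPer L s) (n : ℕ) :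
    ∑ k ∈ Finset.Icc (-n : ℤ) n, ‖hat u k‖
      ≤ √(4 / (1 - 2 * s) / L) * (1 + n : ℝ) ^ (1 / 2 - s) * ‖u‖ := by
  have hL : (0 : ℝ) < L := Fact.out
  have hb0 : 0 < 1 - 2 * s := by linarith
  have hn : (0 : ℝ) < 1 + n := by positivity
  apply le_of_sq_le_sq _ (by positivity)
  have hcs := Finset.sum_mul_sq_le_sq_mul_sq (Finset.Icc (-n : ℤ) n)
    (fun k => √(wt (-s) k)) (fun k => √(wt s k) * ‖hat u k‖)
  have e1 : ∀ k, √(wt (-s) k) * (√(wt s k) * ‖hat u k‖) = ‖hat u k‖ := by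
    intro k
    rw [← mul_assoc, ← Real.sqrt_mul (wt_pos _ _).le, wt_mul_wt, neg_add_cancel, wt_zero,
      Real.sqrt_one, one_mul]
  simp only [e1, mul_pow, Real.sq_sqrt (wt_pos _ _).le] at hcs
  refine hcs.trans ?_
  have h2 : ∑ k ∈ Finset.Icc (-n : ℤ) n, wt s k * ‖hat u k‖ ^ 2 ≤ ‖u‖ ^ 2 / L := by
    rw [hper_norm_sq, mul_div_cancel_left₀ _ hL.ne']
    exact (summable_hat u).sum_le_tsum _
      (fun k _ => mul_nonneg (wt_pos s k).le (sq_nonneg _))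
  have h3 := mul_le_mul (sum_wt_neg_le h0 h1 n) h2
    (Finset.sum_nonneg fun k _ => mul_nonneg (wt_pos s k).le (sq_nonneg _)) (by positivity)
  refine h3.trans (le_of_eq ?_)
  rw [mul_pow, mul_pow, Real.sq_sqrt (by positivity), ← Real.rpow_mul_natCast hn.le]
  have : (1 / 2 - s) * (2 : ℕ) = 1 - 2 * s := by push_cast; ring
  rw [this]
  ring

/-- Removal of the low modes: a weak type estimate for the distribution function. -/
theorem measure_lt_abs_le {s : ℝ} (h0 : 0 < s) (h1 : s < 1 / 2) (u : HPer L s) (hu : 0 < ‖u‖)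
    {lam : ℝ} (hlam : 0 < lam) :
    volume {x | lam < |toL2 u x|} ≤ ∑' k : ℤ, ENNReal.ofReal (4 * L * ‖hat u k‖ ^ 2) *
      (Iio (2 * √(4 / (1 - 2 * s) / L) * ‖u‖ * (1 + |(k : ℝ)|) ^ (1 / 2 - s))).indicator
        (fun t => ENNReal.ofReal (t ^ (-2 : ℝ))) lam := by
  have hL : (0 : ℝ) < L := Fact.out
  have hb0 : 0 < 1 - 2 * s := by linarith
  have ha0 : 0 < 1 / 2 - s := by linarith
  set C := √(4 / (1 - 2 * s) / L) with hC
  have hC0 : 0 < C := Real.sqrt_pos.2 (by positivity)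
  set ev : ℤ → ℝ := fun k => 2 * C * ‖u‖ * (1 + |(k : ℝ)|) ^ (1 / 2 - s) with hev
  -- The low part at level `lam`. The threshold is arranged so that this part is at most `lam / 2`
  -- almost everywhere; where `|u| > lam`, the high part then exceeds `lam / 2`.
  let c : ℤ → ℂ := fun k => if lam < ev k then 0 else hat u k
  have hcle : ∀ k, ‖c k‖ ≤ ‖hat u k‖ := fun k => by
    simp only [c]
    split_ifs
    · simp
    · exact le_rfl
  obtain ⟨v, hv⟩ := exists_fc_eq (L := L) c
    (Summable.of_nonneg_of_le (fun k => sq_nonneg _)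
      (fun k => pow_le_pow_left₀ (norm_nonneg _) (hcle k) 2) (summable_fc_sq (toL2 u)))
    (by
      intro k
      have : ev (-k) = ev k := by simp [hev]
      simp only [c, this]
      split_ifs
      · exact (map_zero _).symm
      · exact hat_neg_index u k)
  obtain ⟨n, hn⟩ : ∃ n : ℕ, (∀ k, k ∉ Finset.Icc (-n : ℤ) n → c k = 0) ∧
      ∑ k ∈ Finset.Icc (-n : ℤ) n, ‖c k‖ ≤ lam / 2 := by
    -- Only modes with `1 + |k| ≤ X` are kept, and `C X^{1/2-s} ‖u‖ = lam / 2`. If `X < 1` there are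
    -- none.
    set X := (lam / (2 * C * ‖u‖)) ^ (1 / 2 - s)⁻¹ with hX
    have hX0 : 0 < X := by positivity
    have hXa : X ^ (1 / 2 - s) = lam / (2 * C * ‖u‖) := by
      rw [hX, ← Real.rpow_mul (by positivity), inv_mul_cancel₀ ha0.ne', Real.rpow_one]
    have hlow : ∀ k : ℤ, c k ≠ 0 → 1 + |(k : ℝ)| ≤ X := by
      intro k hk
      by_contra hcon
      push Not at hcon
      apply hk
      have h2 : X ^ (1 / 2 - s) < (1 + |(k : ℝ)|) ^ (1 / 2 - s) :=
        Real.rpow_lt_rpow hX0.le hcon ha0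
      rw [hXa, div_lt_iff₀ (by positivity)] at h2
      have : lam < ev k := by simp only [hev]; linarith
      simp only [c, if_pos this]
    by_cases hX1 : 1 ≤ X
    · refine ⟨⌊X - 1⌋₊, fun k hk => ?_, ?_⟩
      · by_contra hne
        apply hk
        have h2 := hlow k hne
        have h3 : k.natAbs ≤ ⌊X - 1⌋₊ := by
          apply Nat.le_floor
          rw [Nat.cast_natAbs, Int.cast_abs]
          linarith
        rw [Finset.mem_Icc]
        omega
      · calc ∑ k ∈ Finset.Icc (-(⌊X - 1⌋₊ : ℤ)) ⌊X - 1⌋₊, ‖c k‖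
            ≤ ∑ k ∈ Finset.Icc (-(⌊X - 1⌋₊ : ℤ)) ⌊X - 1⌋₊, ‖hat u k‖ :=
              Finset.sum_le_sum fun k _ => hcle k
          _ ≤ C * (1 + (⌊X - 1⌋₊ : ℝ)) ^ (1 / 2 - s) * ‖u‖ := sum_low_modes_le h0 h1 u _
          _ ≤ C * X ^ (1 / 2 - s) * ‖u‖ := by
              have := Nat.floor_le (show 0 ≤ X - 1 by linarith)
              gcongr
              linarith
          _ = lam / 2 := by
              rw [hXa]
              field_simp
    · have hz : ∀ k, c k = 0 := by
        intro k
        by_contra hne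
        have := hlow k hne
        have := abs_nonneg (k : ℝ)
        linarith
      refine ⟨0, fun k _ => hz k, ?_⟩
      simp only [hz, norm_zero, Finset.sum_const_zero]
      positivity
  have hsum : HasSum (fun k => ‖fc v k‖) (∑ k ∈ Finset.Icc (-n : ℤ) n, ‖c k‖) := by
    simp only [hv]
    exact hasSum_sum_of_ne_finset_zero fun k hk => by rw [hn.1 k hk, norm_zero]
  have hvle : ∀ᵐ x, |v x| ≤ lam / 2 := by
    filter_upwards [ae_abs_le_tsum_fc v hsum.summable] with x hx
    exact hx.trans (hsum.tsum_eq.le.trans hn.2)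
  have hmeas : volume {x | lam < |toL2 u x|}
      ≤ volume {x | (ENNReal.ofReal (lam / 2)) ≤ ‖(toL2 u - v) x‖₊} := by
    apply measure_mono_ae
    filter_upwards [hvle, Lp.coeFn_sub (toL2 u) v] with x hx1 hx2 hx3
    change lam < |toL2 u x| at hx3
    change ENNReal.ofReal (lam / 2) ≤ ‖(toL2 u - v) x‖₊
    rw [hx2, Pi.sub_apply, ← enorm_eq_nnnorm, ← ofReal_norm]
    apply ENNReal.ofReal_le_ofReal
    rw [Real.norm_eq_abs]
    have := abs_sub_abs_le_abs_sub (toL2 u x) (v x)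
    linarith
  refine hmeas.trans ?_
  -- Chebyshev in `L²` at height `lam / 2`; Parseval then turns the right side into a sum over the
  -- removed modes, with the factor `4 / lam²`.
  have hcheb := Lp.meas_ge_le_mul_pow_enorm (toL2 u - v) (by norm_num) (by norm_num)
    (ε := ENNReal.ofReal (lam / 2)) (by
      rw [ne_eq, ENNReal.ofReal_eq_zero, not_le]
      positivity)
  refine hcheb.trans (le_of_eq ?_)
  have h2 : ((2 : ENNReal).toReal) = ((2 : ℕ) : ℝ) := by norm_num
  rw [h2, ENNReal.rpow_natCast, ENNReal.rpow_natCast, ← ENNReal.ofReal_inv_of_pos (by positivity),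
    ← ENNReal.ofReal_pow (by positivity), ← ENNReal.ofReal_pow (norm_nonneg _),
    ← ENNReal.ofReal_mul (by positivity), norm_sq_eq_tsum_fc, ← mul_assoc, ← tsum_mul_left,
    ENNReal.ofReal_tsum_of_nonneg (fun k => by positivity) ((summable_fc_sq _).mul_left _)]
  congr 1
  funext k
  have hfc : fc (⇑(toL2 u - v)) k = if lam < ev k then hat u k else 0 := by
    have h3 := fc_add (toL2 u - v) v k
    rw [sub_add_cancel, hv] at h3
    have h4 : fc (⇑(toL2 u - v)) k = hat u k - c k := by rw [hat, h3, add_sub_cancel_right]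
    rw [h4]
    simp only [c]
    split_ifs
    · rw [sub_zero]
    · rw [sub_self]
  rw [hfc]
  by_cases hk : lam < ev k
  · rw [if_pos hk, indicator_of_mem (show lam ∈ Iio (ev k) from hk),
      ← ENNReal.ofReal_mul (by positivity)]
    congr 1
    rw [Real.rpow_neg hlam.le, Real.rpow_ofNat]
    field_simp
    ring
  · rw [if_neg hk, indicator_of_notMem (show lam ∉ Iio (ev k) from hk)]
    simp

theorem lintegral_rpow_Ioi_indicator {b r : ℝ} (hb : 0 < b) (hr : -1 < r) :
    ∫⁻ t in Ioi 0, (Iio b).indicator (fun t => ENNReal.ofReal (t ^ r)) t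
      = ENNReal.ofReal (b ^ (r + 1) / (r + 1)) := by
  rw [lintegral_indicator measurableSet_Iio, Measure.restrict_restrict measurableSet_Iio,
    Iio_inter_Ioi, ← setLIntegral_congr Ioo_ae_eq_Ioc.symm,
    ← ofReal_integral_eq_lintegral_ofReal]
  · rw [← intervalIntegral.integral_of_le hb.le, integral_rpow (Or.inl hr),
      Real.zero_rpow (by linarith), sub_zero]
  · exact (intervalIntegrable_iff_integrableOn_Ioc_of_le hb.le).1
      (intervalIntegral.intervalIntegrable_rpow' hr)
  · filter_upwards [ae_restrict_mem measurableSet_Ioc] with t ht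
    exact Real.rpow_nonneg ht.1.le r

/-- The critical Sobolev inequality `‖u‖_{L^q} ≤ C ‖u‖_s`, `q = 2 / (1 - 2s)`. -/
theorem exists_lintegral_rpow_le {s q : ℝ} (h0 : 0 < s) (h1 : s < 1 / 2) (hq : 2 < q)
    (hqs : (1 / 2 - s) * (q - 2) = 2 * s) : ∃ C : ℝ, 0 ≤ C ∧ ∀ u : HPer L s,
    ∫⁻ x, ENNReal.ofReal (|toL2 u x| ^ q) ≤ ENNReal.ofReal (C * ‖u‖ ^ q) := by
  have hL : (0 : ℝ) < L := Fact.out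
  have hb0 : 0 < 1 - 2 * s := by linarith
  have ha0 : 0 < 1 / 2 - s := by linarith
  set D := √(4 / (1 - 2 * s) / L) with hD
  have hD0 : 0 < D := Real.sqrt_pos.2 (by positivity)
  have hq2 : 0 < q - 2 := by linarith
  -- The factor `q` comes from the layer cake formula and `1 / (q - 2)` from integrating `t^{q-3}`
  -- up to the threshold. The `8` is the `4` of Chebyshev times the `2` in `(1 + |k|)^{2s} ≤ 2 (1 +
  -- k²)^s`.
  refine ⟨q * (8 / (q - 2) * (2 * D) ^ (q - 2)), by positivity, fun u => ?_⟩
  rcases (norm_nonneg u).eq_or_lt with hu | hu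
  · have hu0 : u = 0 := norm_eq_zero.1 hu.symm
    rw [hu0, map_zero]
    have : ∫⁻ x, ENNReal.ofReal (|(0 : L2Per L) x| ^ q) = ∫⁻ _ : AddCircle L, 0 := by
      apply lintegral_congr_ae
      filter_upwards [Lp.coeFn_zero ℝ 2 (volume : Measure (AddCircle L))] with x hx
      rw [hx]
      simp [Real.zero_rpow (by linarith : q ≠ 0)]
    rw [this]
    simp
  rw [lintegral_rpow_eq_lintegral_meas_lt_mul volume (Eventually.of_forall fun x => abs_nonneg _)
    (by simpa using (Lp.aestronglyMeasurable (toL2 u)).norm.aemeasurable) (by linarith)]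
  set ev : ℤ → ℝ := fun k => 2 * D * ‖u‖ * (1 + |(k : ℝ)|) ^ (1 / 2 - s) with hev
  have hev0 : ∀ k, 0 < ev k := fun k => by
    have : 0 < 1 + |(k : ℝ)| := by positivity
    simp only [hev]
    positivity
  -- Tonelli: for fixed `k` the level `t` runs only up to `ev k`, and `t^{-2} t^{q-1}` is integrable
  -- at `0` because `q > 2`.
  have hA : ∫⁻ t in Ioi 0, volume {x | t < |toL2 u x|} * ENNReal.ofReal (t ^ (q - 1))
      ≤ ∑' k : ℤ, ENNReal.ofReal (4 * L * ‖hat u k‖ ^ 2)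
          * ENNReal.ofReal (ev k ^ (q - 2) / (q - 2)) := by
    have e2 : ∀ k, ENNReal.ofReal (4 * L * ‖hat u k‖ ^ 2)
        * ENNReal.ofReal (ev k ^ (q - 2) / (q - 2)) =
        ∫⁻ t in Ioi 0, ENNReal.ofReal (4 * L * ‖hat u k‖ ^ 2) *
          (Iio (ev k)).indicator (fun t => ENNReal.ofReal (t ^ (q - 3))) t := by
      intro k
      have hm : Measurable ((Iio (ev k)).indicator fun t : ℝ => ENNReal.ofReal (t ^ (q - 3))) :=
        Measurable.indicator (by fun_prop) measurableSet_Iio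
      rw [lintegral_const_mul _ hm, lintegral_rpow_Ioi_indicator (hev0 k) (by linarith)]
      congr 3 <;> ring_nf
    simp only [e2]
    rw [← lintegral_tsum fun k => by
      have hm : Measurable ((Iio (ev k)).indicator fun t : ℝ => ENNReal.ofReal (t ^ (q - 3))) :=
        Measurable.indicator (by fun_prop) measurableSet_Iio
      exact (hm.const_mul _).aemeasurable]
    apply setLIntegral_mono' measurableSet_Ioi
    intro t ht
    refine (mul_le_mul_left (measure_lt_abs_le h0 h1 u hu ht) _).trans (le_of_eq ?_)
    rw [← ENNReal.tsum_mul_right]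
    congr 1
    funext k
    rw [mul_assoc]
    congr 1
    by_cases hk : t < ev k
    · rw [indicator_of_mem (show t ∈ Iio (ev k) from hk),
        indicator_of_mem (show t ∈ Iio (ev k) from hk),
        ← ENNReal.ofReal_mul (Real.rpow_nonneg (le_of_lt ht) _), ← Real.rpow_add ht]
      congr 2
      ring
    · rw [indicator_of_notMem (show t ∉ Iio (ev k) from hk),
        indicator_of_notMem (show t ∉ Iio (ev k) from hk), zero_mul]
  refine (mul_le_mul_right hA _).trans ?_
  have hterm : ∀ k : ℤ, ENNReal.ofReal (4 * L * ‖hat u k‖ ^ 2)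
      * ENNReal.ofReal (ev k ^ (q - 2) / (q - 2)) ≤ ENNReal.ofReal
        (8 / (q - 2) * (2 * D) ^ (q - 2) * ‖u‖ ^ (q - 2) * L * (wt s k * ‖hat u k‖ ^ 2)) := by
    intro k
    rw [← ENNReal.ofReal_mul (by positivity)]
    apply ENNReal.ofReal_le_ofReal
    have hk1 : 0 < 1 + |(k : ℝ)| := by positivity
    -- Criticality of `q` enters here: `(1/2 - s)(q - 2) = 2s` turns the threshold power into the
    -- Sobolev weight.
    have h2 : ev k ^ (q - 2) = (2 * D) ^ (q - 2) * ‖u‖ ^ (q - 2) * (1 + |(k : ℝ)|) ^ (2 * s) := by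
      simp only [hev]
      rw [Real.mul_rpow (by positivity) (by positivity), Real.mul_rpow (by positivity) hu.le,
        ← Real.rpow_mul hk1.le, hqs]
    have h3 : (1 + |(k : ℝ)|) ^ (2 * s) ≤ 2 * wt s k := by
      rw [Real.rpow_mul hk1.le, Real.rpow_ofNat]
      have h4 : (1 + |(k : ℝ)|) ^ 2 ≤ 2 * (1 + (k : ℝ) ^ 2) := by
        nlinarith [sq_abs (k : ℝ), sq_nonneg (1 - |(k : ℝ)|)]
      refine (Real.rpow_le_rpow (by positivity) h4 h0.le).trans ?_
      rw [Real.mul_rpow (by norm_num) (by positivity)]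
      refine mul_le_mul_of_nonneg_right ?_ (wt_pos s k).le
      calc (2 : ℝ) ^ s ≤ 2 ^ (1 : ℝ) :=
            Real.rpow_le_rpow_of_exponent_le (by norm_num) (by linarith)
        _ = 2 := Real.rpow_one 2
    rw [h2]
    calc 4 * L * ‖hat u k‖ ^ 2 * ((2 * D) ^ (q - 2) * ‖u‖ ^ (q - 2) *
          (1 + |(k : ℝ)|) ^ (2 * s) / (q - 2))
        = 4 / (q - 2) * (2 * D) ^ (q - 2) * ‖u‖ ^ (q - 2) * L * ‖hat u k‖ ^ 2
          * (1 + |(k : ℝ)|) ^ (2 * s) := by ring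
      _ ≤ 4 / (q - 2) * (2 * D) ^ (q - 2) * ‖u‖ ^ (q - 2) * L * ‖hat u k‖ ^ 2
          * (2 * wt s k) := mul_le_mul_of_nonneg_left h3 (by positivity)
      _ = _ := by ring
  refine (mul_le_mul_right (ENNReal.tsum_le_tsum hterm) _).trans (le_of_eq ?_)
  rw [← ENNReal.ofReal_tsum_of_nonneg (fun k => by have := wt_pos s k; positivity)
    ((summable_hat u).mul_left _), tsum_mul_left, mul_assoc, ← hper_norm_sq,
    ← ENNReal.ofReal_mul (by linarith)]
  congr 1
  have : ‖u‖ ^ q = ‖u‖ ^ (q - 2) * ‖u‖ ^ 2 := by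
    rw [← Real.rpow_natCast ‖u‖ 2, ← Real.rpow_add hu]
    congr 1
    push_cast
    ring
  rw [this]
  ring

/-- The Sobolev embedding `H^r_per ⊆ L^q` for `r ≥ s`, `q = 2 / (1 - 2s)`. -/
theorem exists_eLpNorm_le {s r q : ℝ} (h0 : 0 < s) (h1 : s < 1 / 2) (hr : s ≤ r) (hq : 2 < q)
    (hqs : (1 / 2 - s) * (q - 2) = 2 * s) : ∃ C : ℝ, 0 ≤ C ∧ ∀ u : HPer L r,
    eLpNorm (toL2 u) (ENNReal.ofReal q) volume ≤ ENNReal.ofReal (C * ‖u‖) := by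
  obtain ⟨C, hC, h⟩ := exists_lintegral_rpow_le (L := L) h0 h1 hq hqs
  have hq0 : 0 < q := by linarith
  refine ⟨C ^ (1 / q), by positivity, fun u => ?_⟩
  rw [eLpNorm_eq_lintegral_rpow_enorm_toReal (by simpa using hq0) (by simp),
    ENNReal.toReal_ofReal hq0.le]
  have h2 := h (incl hr u)
  rw [toL2_incl] at h2
  have e : ∀ x, ‖toL2 u x‖ₑ ^ q = ENNReal.ofReal (|toL2 u x| ^ q) := by
    intro x
    rw [← ofReal_norm, ENNReal.ofReal_rpow_of_nonneg (norm_nonneg _) hq0.le, Real.norm_eq_abs]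
  simp only [e]
  have h3 : C * ‖incl hr u‖ ^ q ≤ C * ‖u‖ ^ q :=
    mul_le_mul_of_nonneg_left (Real.rpow_le_rpow (norm_nonneg _) (norm_incl_le hr u) hq0.le) hC
  refine (ENNReal.rpow_le_rpow (h2.trans (ENNReal.ofReal_le_ofReal h3)) (by positivity)).trans
    (le_of_eq ?_)
  rw [ENNReal.ofReal_rpow_of_nonneg (by positivity) (by positivity),
    Real.mul_rpow hC (by positivity), ← Real.rpow_mul (norm_nonneg _), mul_one_div_cancel hq0.ne',
    Real.rpow_one]

/-- The embedding `H^s_per ⊆ L^∞` for `s > 1/2`. -/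
theorem exists_ae_abs_le {s : ℝ} (hs : 1 / 2 < s) : ∃ C : ℝ, 0 ≤ C ∧ ∀ u : HPer L s,
    ∀ᵐ x, |toL2 u x| ≤ C * ‖u‖ := by
  have hL : (0 : ℝ) < L := Fact.out
  have hw := summable_wt hs
  refine ⟨√((∑' k, wt (-s) k) / L), Real.sqrt_nonneg _, fun u => ?_⟩
  have key : ∀ F : Finset ℤ, ∑ k ∈ F, ‖hat u k‖ ≤ √((∑' k, wt (-s) k) / L) * ‖u‖ := by
    intro F
    have hw0 : 0 ≤ ∑' k, wt (-s) k := tsum_nonneg fun k => (wt_pos _ k).le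
    apply le_of_sq_le_sq _ (by positivity)
    have hcs := Finset.sum_mul_sq_le_sq_mul_sq F
      (fun k => √(wt (-s) k)) (fun k => √(wt s k) * ‖hat u k‖)
    have e1 : ∀ k, √(wt (-s) k) * (√(wt s k) * ‖hat u k‖) = ‖hat u k‖ := by
      intro k
      rw [← mul_assoc, ← Real.sqrt_mul (wt_pos _ _).le, wt_mul_wt, neg_add_cancel, wt_zero,
        Real.sqrt_one, one_mul]
    simp only [e1, mul_pow, Real.sq_sqrt (wt_pos _ _).le] at hcs
    refine hcs.trans ?_
    have h2 : ∑ k ∈ F, wt s k * ‖hat u k‖ ^ 2 ≤ ‖u‖ ^ 2 / L := by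
      rw [hper_norm_sq, mul_div_cancel_left₀ _ hL.ne']
      exact (summable_hat u).sum_le_tsum _
        (fun k _ => mul_nonneg (wt_pos s k).le (sq_nonneg _))
    refine (mul_le_mul (hw.sum_le_tsum F fun k _ => (wt_pos _ k).le) h2
      (Finset.sum_nonneg fun k _ => mul_nonneg (wt_pos s k).le (sq_nonneg _)) hw0).trans
      (le_of_eq ?_)
    rw [mul_pow, Real.sq_sqrt (by positivity)]
    ring
  have hs1 : Summable fun k => ‖fc (toL2 u) k‖ :=
    summable_of_sum_le (fun k => norm_nonneg _) key
  filter_upwards [ae_abs_le_tsum_fc (toL2 u) hs1] with x hx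
  exact hx.trans (hs1.tsum_le_of_sum_le key)

end CriticalSobolev

/-! ### Taylor remainders in integral form and continuity of superposition operators. -/

noncomputable section Nemytskii
open Filter Topology

/-- Mean value of `g` on the segment from `a` to `a + b`. -/
def segmentMean (g : ℝ → ℝ) (z : ℝ × ℝ) : ℝ := ∫ s in (0 : ℝ)..1, g (z.1 + s * z.2)

/-- Integral remainder of the second order Taylor expansion. -/
def segmentMoment (g : ℝ → ℝ) (z : ℝ × ℝ) : ℝ :=
  ∫ s in (0 : ℝ)..1, s * segmentMean g (z.1, s * z.2)

theorem continuous_segmentMean {g : ℝ → ℝ} (hg : Continuous g) : Continuous (segmentMean g) := by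
  apply intervalIntegral.continuous_parametric_intervalIntegral_of_continuous'
  unfold Function.uncurry
  fun_prop

theorem continuous_segmentMoment {g : ℝ → ℝ} (hg : Continuous g) :
    Continuous (segmentMoment g) := by
  have := continuous_segmentMean hg
  apply intervalIntegral.continuous_parametric_intervalIntegral_of_continuous'
  unfold Function.uncurry
  fun_prop

theorem segmentMean_zero (g : ℝ → ℝ) (a : ℝ) : segmentMean g (a, 0) = g a := by
  simp [segmentMean]

theorem segmentMoment_zero (g : ℝ → ℝ) (a : ℝ) : segmentMoment g (a, 0) = 1 / 2 * g a := by
  simp only [segmentMoment, mul_zero, segmentMean_zero, intervalIntegral.integral_mul_const,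
    integral_id]
  norm_num

theorem segmentMean_mul {f g : ℝ → ℝ} (hg : Continuous g) (hf : ∀ x, HasDerivAt f (g x) x)
    (a b : ℝ) : segmentMean g (a, b) * b = f (a + b) - f a := by
  have h : ∀ s ∈ uIcc (0 : ℝ) 1, HasDerivAt (fun s => f (a + s * b)) (g (a + s * b) * b) s := by
    intro s _
    have h1 : HasDerivAt (fun s : ℝ => a + s * b) b s := by
      simpa using ((hasDerivAt_id s).mul_const b).const_add a
    exact (hf _).comp s h1
  have h2 := intervalIntegral.integral_eq_sub_of_hasDerivAt h
    (Continuous.intervalIntegrable (by fun_prop) _ _)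
  rw [intervalIntegral.integral_mul_const] at h2
  simpa [segmentMean] using h2

/-- Writing the remainder as a continuous function of `(a, b)` times `b²` lets the superposition
estimate apply to it, with no division by `b`. -/
theorem segmentMoment_mul {W f g : ℝ → ℝ} (hg : Continuous g) (hf : ∀ x, HasDerivAt f (g x) x)
    (hW : ∀ x, HasDerivAt W (f x) x) (a b : ℝ) :
    segmentMoment g (a, b) * b ^ 2 = W (a + b) - W a - f a * b := by
  have hfc : Continuous f := continuous_iff_continuousAt.2 fun x => (hf x).continuousAt
  rw [← segmentMean_mul hfc hW]
  simp only [segmentMoment, segmentMean]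
  rw [← intervalIntegral.integral_mul_const, ← intervalIntegral.integral_mul_const]
  have h1 : f a * b = ∫ s in (0 : ℝ)..1, f a * b := by simp
  rw [h1, ← intervalIntegral.integral_sub
    (Continuous.intervalIntegrable (by fun_prop) _ _) (by simp)]
  congr 1
  funext s
  have h2 := segmentMean_mul hg hf a (s * b)
  simp only [segmentMean] at h2
  linear_combination b * h2

theorem abs_segmentMean_le {g : ℝ → ℝ} {C p : ℝ} (hC : 0 ≤ C) (hp : 0 ≤ p)
    (hg : ∀ x, |g x| ≤ C * (1 + |x|) ^ p) (a b : ℝ) :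
    |segmentMean g (a, b)| ≤ C * (1 + |a| + |b|) ^ p := by
  have h := intervalIntegral.norm_integral_le_of_norm_le_const (a := (0 : ℝ)) (b := 1)
    (f := fun s => g (a + s * b)) (C := C * (1 + |a| + |b|) ^ p) (fun s hs => by
      rw [uIoc_of_le zero_le_one] at hs
      rw [Real.norm_eq_abs]
      refine (hg _).trans (mul_le_mul_of_nonneg_left ?_ hC)
      apply Real.rpow_le_rpow (by positivity) _ hp
      have h1 : |s * b| ≤ |b| := by
        rw [abs_mul, abs_of_pos hs.1]
        exact mul_le_of_le_one_left (abs_nonneg _) hs.2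
      have := abs_add_le a (s * b)
      linarith)
  simpa [segmentMean] using h

theorem abs_segmentMoment_le {g : ℝ → ℝ} {C p : ℝ} (hC : 0 ≤ C) (hp : 0 ≤ p)
    (hg : ∀ x, |g x| ≤ C * (1 + |x|) ^ p) (a b : ℝ) :
    |segmentMoment g (a, b)| ≤ C * (1 + |a| + |b|) ^ p := by
  have h := intervalIntegral.norm_integral_le_of_norm_le_const (a := (0 : ℝ)) (b := 1)
    (f := fun s => s * segmentMean g (a, s * b)) (C := C * (1 + |a| + |b|) ^ p) (fun s hs => by
      rw [uIoc_of_le zero_le_one] at hs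
      rw [Real.norm_eq_abs, abs_mul, abs_of_pos hs.1]
      refine (mul_le_of_le_one_left (abs_nonneg _) hs.2).trans ?_
      refine (abs_segmentMean_le hC hp hg _ _).trans (mul_le_mul_of_nonneg_left ?_ hC)
      apply Real.rpow_le_rpow (by positivity) _ hp
      have h1 : |s * b| ≤ |b| := by
        rw [abs_mul, abs_of_pos hs.1]
        exact mul_le_of_le_one_left (abs_nonneg _) hs.2
      linarith)
  simpa [segmentMoment] using h

variable {α : Type*} [MeasurableSpace α] {μ : Measure α} [IsFiniteMeasure μ]

theorem memLp_add_abs {Q : ENNReal} {v w : α → ℝ} (hv : MemLp v Q μ) (hw : MemLp w Q μ) :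
    MemLp (fun x => v x + |w x|) Q μ := hv.add hw.norm

/-- Growth of order `e` divides the integrability exponent by `e`; the constant `1` in the bound is
integrable because the measure is finite. -/
theorem memLp_superposition {Φ : ℝ × ℝ → ℝ} (hΦ : Continuous Φ) {C e q : ℝ} (he : 0 < e)
    (hb : ∀ a b, |Φ (a, b)| ≤ C * (1 + |a| + |b|) ^ e) {u h : α → ℝ}
    (hu : MemLp u (ENNReal.ofReal q) μ) (hh : MemLp h (ENNReal.ofReal q) μ) :
    MemLp (fun x => Φ (u x, h x)) (ENNReal.ofReal (q / e)) μ := by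
  have h1 : MemLp (fun x => 1 + |u x| + |h x|) (ENNReal.ofReal q) μ :=
    memLp_add_abs (memLp_add_abs (memLp_const (1 : ℝ)) hu) hh
  have h2 := h1.norm_rpow_div (ENNReal.ofReal e)
  rw [ENNReal.toReal_ofReal he.le, ← ENNReal.ofReal_div_of_pos he] at h2
  refine h2.of_le_mul (c := C)
    (hΦ.comp_aestronglyMeasurable (hu.aestronglyMeasurable.prodMk hh.aestronglyMeasurable))
    (Eventually.of_forall fun x => ?_)
  have h3 : 0 ≤ 1 + |u x| + |h x| := by positivity
  rw [Real.norm_of_nonneg (Real.rpow_nonneg (norm_nonneg _) e), Real.norm_of_nonneg h3]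
  exact hb _ _

/-- The superposition operator is continuous at `h = 0`. Along a subsequence converging almost
everywhere, the integrand is split into a part dominated by a fixed function of `u` and a part
controlled by `‖h‖`. Passing to subsequences loses nothing, since the limit is always `0`. -/
theorem tendsto_eLpNorm_superposition {Φ : ℝ × ℝ → ℝ} (hΦ : Continuous Φ) {C e q : ℝ}
    (he : 0 < e) (hq : 0 < q) [Fact (1 ≤ ENNReal.ofReal q)]
    (hb : ∀ a b, |Φ (a, b)| ≤ C * (1 + |a| + |b|) ^ e) (h0 : ∀ a, Φ (a, 0) = 0)
    (u : Lp ℝ (ENNReal.ofReal q) μ) :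
    Tendsto (fun h : Lp ℝ (ENNReal.ofReal q) μ =>
      eLpNorm (fun x => Φ (u x, h x)) (ENNReal.ofReal (q / e)) μ) (𝓝 0) (𝓝 0) := by
  have hr : 0 < q / e := by positivity
  have hC : 0 ≤ C := by simpa using (abs_nonneg _).trans (hb 0 0)
  apply tendsto_of_subseq_tendsto
  intro ns hns
  obtain ⟨ms, hms, hae⟩ := (tendstoInMeasure_of_tendsto_Lp hns).exists_seq_tendsto_ae
  refine ⟨ms, ?_⟩
  have hns' := hns.comp hms.tendsto_atTop
  set w : ℕ → Lp ℝ (ENNReal.ofReal q) μ := fun n => ns (ms n) with hw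
  have hQ0 : ENNReal.ofReal q ≠ 0 := by simpa using hq
  have hR0 : ENNReal.ofReal (q / e) ≠ 0 := by simpa using hr
  -- The factor `2 ^ q` comes from bounding `X + Y` by twice the maximum, for `X = 1 + |u|` and `Y =
  -- |w|`.
  set K : ℝ := C ^ (q / e) * 2 ^ q with hK
  have hK0 : 0 ≤ K := by positivity
  let A : α → ENNReal := fun x => ENNReal.ofReal (K * (1 + |u x|) ^ q)
  let F : ℕ → α → ENNReal := fun n x => ‖Φ (u x, w n x)‖ₑ ^ (q / e)
  -- Truncating at `A` makes dominated convergence available; what exceeds `A` is bounded by the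
  -- `L^q` mass of `w n`.
  have hpt : ∀ n x, F n x ≤ min (F n x) (A x) + ENNReal.ofReal K * ‖w n x‖ₑ ^ q := by
    intro n x
    have h1 : F n x ≤ A x + ENNReal.ofReal K * ‖w n x‖ₑ ^ q := by
      simp only [F, A]
      rw [← ofReal_norm, ← ofReal_norm, ENNReal.ofReal_rpow_of_nonneg (norm_nonneg _) hr.le,
        ENNReal.ofReal_rpow_of_nonneg (norm_nonneg _) hq.le, ← ENNReal.ofReal_mul hK0,
        ← ENNReal.ofReal_add (by positivity) (by positivity)]
      apply ENNReal.ofReal_le_ofReal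
      rw [Real.norm_eq_abs, Real.norm_eq_abs, ← mul_add]
      set X := 1 + |u x| with hX
      have hX0 : 0 ≤ X := by positivity
      set Y := |w n x| with hY
      have hY0 : 0 ≤ Y := abs_nonneg _
      calc |Φ (u x, w n x)| ^ (q / e) ≤ (C * (X + Y) ^ e) ^ (q / e) :=
            Real.rpow_le_rpow (abs_nonneg _) (hb _ _) hr.le
        _ = C ^ (q / e) * (X + Y) ^ q := by
            rw [Real.mul_rpow hC (by positivity), ← Real.rpow_mul (by positivity),
              mul_div_cancel₀ _ he.ne']
        _ ≤ C ^ (q / e) * (2 * max X Y) ^ q := by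
            refine mul_le_mul_of_nonneg_left (Real.rpow_le_rpow (by positivity) ?_ hq.le)
              (by positivity)
            linarith [le_max_left X Y, le_max_right X Y]
        _ = K * (max X Y) ^ q := by
            rw [Real.mul_rpow (by norm_num) (le_max_of_le_left hX0), hK, mul_assoc]
        _ ≤ K * (X ^ q + Y ^ q) := by
            refine mul_le_mul_of_nonneg_left ?_ hK0
            rcases max_choice X Y with h | h <;> rw [h]
            · linarith [Real.rpow_nonneg hY0 q]
            · linarith [Real.rpow_nonneg hX0 q]
    rcases le_total (F n x) (A x) with h | h
    · rw [min_eq_left h]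
      exact le_self_add
    · rw [min_eq_right h]
      exact h1
  have hFm : ∀ n, AEMeasurable (F n) μ := fun n =>
    ((hΦ.comp_aestronglyMeasurable ((Lp.aestronglyMeasurable u).prodMk
      (Lp.aestronglyMeasurable (w n)))).enorm).pow_const _
  have hAm : AEMeasurable A μ :=
    ENNReal.measurable_ofReal.comp_aemeasurable
      ((((Lp.aestronglyMeasurable u).norm.aemeasurable.const_add 1).pow_const q).const_mul K)
  have hAfin : ∫⁻ x, A x ∂μ ≠ ⊤ := by
    have h1 : MemLp (fun x => 1 + |u x|) (ENNReal.ofReal q) μ :=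
      memLp_add_abs (memLp_const (1 : ℝ)) (Lp.memLp u)
    have h2 := (h1.integrable_norm_rpow hQ0 (by simp)).const_mul K
    have h3 := h2.lintegral_lt_top
    refine (lt_of_le_of_lt (lintegral_mono fun x => ?_) h3).ne
    have h4 : 0 ≤ 1 + |u x| := by positivity
    rw [Real.norm_of_nonneg h4, ENNReal.toReal_ofReal hq.le]
  have hlim1 : Tendsto (fun n => ∫⁻ x, min (F n x) (A x) ∂μ) atTop (𝓝 0) := by
    have h1 := tendsto_lintegral_of_dominated_convergence' (μ := μ) (f := fun _ => 0) A
      (F := fun n x => min (F n x) (A x))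
      (fun n => (hFm n).min hAm) (fun n => Eventually.of_forall fun x => min_le_right _ _)
      hAfin ?_
    · simpa using h1
    · filter_upwards [hae, Lp.coeFn_zero ℝ (ENNReal.ofReal q) μ] with x hx hx0
      rw [hx0] at hx
      have h2 : Tendsto (fun n => Φ (u x, w n x)) atTop (𝓝 0) := by
        have := (hΦ.tendsto (u x, 0)).comp (tendsto_const_nhds.prodMk_nhds hx)
        rwa [h0] at this
      have h3 : Tendsto (fun n => F n x) atTop (𝓝 0) := by
        have := h2.enorm.ennrpow_const (q / e)
        simpa [F, ENNReal.zero_rpow_of_pos hr] using this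
      exact tendsto_of_tendsto_of_tendsto_of_le_of_le tendsto_const_nhds h3
        (fun n => zero_le) (fun n => min_le_left _ _)
  have hlim2 : Tendsto (fun n => ∫⁻ x, ENNReal.ofReal K * ‖w n x‖ₑ ^ q ∂μ) atTop (𝓝 0) := by
    have h1 : ∀ n, ∫⁻ x, ENNReal.ofReal K * ‖w n x‖ₑ ^ q ∂μ
        = ENNReal.ofReal K * (ENNReal.ofReal ‖w n‖) ^ q := by
      intro n
      rw [lintegral_const_mul'' _ ((Lp.aestronglyMeasurable (w n)).enorm.pow_const q),
        Lp.norm_def, ENNReal.ofReal_toReal (Lp.eLpNorm_ne_top _),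
        eLpNorm_eq_lintegral_rpow_enorm_toReal hQ0 (by simp), ENNReal.toReal_ofReal hq.le,
        ← ENNReal.rpow_mul, one_div_mul_cancel hq.ne', ENNReal.rpow_one]
    simp only [h1]
    have h2 : Tendsto (fun n => ENNReal.ofReal ‖w n‖) atTop (𝓝 0) := by
      have := ENNReal.tendsto_ofReal (hns'.norm)
      simpa using this
    have h3 := ENNReal.Tendsto.const_mul (h2.ennrpow_const q) (Or.inr ENNReal.ofReal_ne_top)
      (a := ENNReal.ofReal K)
    simpa [ENNReal.zero_rpow_of_pos hq] using h3
  have hlim3 : Tendsto (fun n => ∫⁻ x, F n x ∂μ) atTop (𝓝 0) := by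
    have h1 := hlim1.add hlim2
    rw [add_zero] at h1
    refine tendsto_of_tendsto_of_tendsto_of_le_of_le tendsto_const_nhds h1
        (fun n => zero_le) (fun n => ?_)
    refine (lintegral_mono (hpt n)).trans (le_of_eq ?_)
    exact lintegral_add_left' ((hFm n).min hAm) _
  have hfin := hlim3.ennrpow_const (1 / (q / e))
  rw [ENNReal.zero_rpow_of_pos (by positivity)] at hfin
  refine hfin.congr fun n => ?_
  rw [eLpNorm_eq_lintegral_rpow_enorm_toReal hR0 (by simp), ENNReal.toReal_ofReal hr.le]

end Nemytskii

/-! ### The functional `u ↦ ∫ W(u)` on `L^{p+2}` is `C²`. -/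

noncomputable section IntegralFunctional
set_option maxSynthPendingDepth 3
open Filter Topology

variable {α : Type*} [MeasurableSpace α] (μ : Measure α) [IsFiniteMeasure μ]
variable (p : ℝ) [hp : Fact (0 < p)]

instance : Fact (1 ≤ ENNReal.ofReal (p + 2)) :=
  ⟨ENNReal.one_le_ofReal.2 (by linarith [hp.out])⟩

instance : Fact (1 ≤ ENNReal.ofReal ((p + 2) / p)) :=
  ⟨ENNReal.one_le_ofReal.2 ((one_le_div hp.out).2 (by linarith))⟩

instance : Fact (1 ≤ ENNReal.ofReal ((p + 2) / (p + 1))) :=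
  ⟨ENNReal.one_le_ofReal.2 ((one_le_div (by linarith [hp.out])).2 (by linarith))⟩

/-- With `k`, `l` in `L^{p+2}`, `f'(u)` lies in `L^{(p+2)/p}` and `f(u)` in `L^{(p+2)/(p+1)}`; this
triple and the next one make `f'(u) k l` and `f(u) k` integrable. -/
instance : ENNReal.HolderTriple (ENNReal.ofReal ((p + 2) / p)) (ENNReal.ofReal (p + 2))
    (ENNReal.ofReal ((p + 2) / (p + 1))) := by
  have h := hp.out
  apply Real.HolderTriple.ennrealOfReal
  refine ⟨?_, by positivity, by positivity⟩
  field_simp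

instance : ENNReal.HolderTriple (ENNReal.ofReal ((p + 2) / (p + 1))) (ENNReal.ofReal (p + 2)) 1 := by
  have h := hp.out
  have h2 : Real.HolderTriple ((p + 2) / (p + 1)) (p + 2) 1 := by
    refine ⟨?_, by positivity, by positivity⟩
    field_simp
    ring
  simpa using h2.ennrealOfReal

/-- The trilinear form `(Φ, k, l) ↦ ∫ Φ k l`. -/
def triForm : Lp ℝ (ENNReal.ofReal ((p + 2) / p)) μ →L[ℝ]
    Lp ℝ (ENNReal.ofReal (p + 2)) μ →L[ℝ] Lp ℝ (ENNReal.ofReal (p + 2)) μ →L[ℝ] ℝ :=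
  (ContinuousLinearMap.compL ℝ _ _ _ ((ContinuousLinearMap.mul ℝ ℝ).lpPairing μ
    (ENNReal.ofReal ((p + 2) / (p + 1))) (ENNReal.ofReal (p + 2)))).comp
    ((ContinuousLinearMap.mul ℝ ℝ).holderL μ (ENNReal.ofReal ((p + 2) / p))
      (ENNReal.ofReal (p + 2)) (ENNReal.ofReal ((p + 2) / (p + 1))))

variable {μ p}

theorem triForm_apply (Φ : Lp ℝ (ENNReal.ofReal ((p + 2) / p)) μ)
    (k l : Lp ℝ (ENNReal.ofReal (p + 2)) μ) :
    triForm μ p Φ k l = ∫ x, Φ x * k x * l x ∂μ := by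
  change (ContinuousLinearMap.mul ℝ ℝ).lpPairing μ _ _
    ((ContinuousLinearMap.mul ℝ ℝ).holder (ENNReal.ofReal ((p + 2) / (p + 1))) Φ k) l = _
  rw [ContinuousLinearMap.lpPairing_eq_integral]
  apply integral_congr_ae
  filter_upwards [(ContinuousLinearMap.mul ℝ ℝ).coeFn_holder
    (r := ENNReal.ofReal ((p + 2) / (p + 1))) Φ k] with x hx
  rw [hx]
  rfl

theorem integrable_triple (Φ : Lp ℝ (ENNReal.ofReal ((p + 2) / p)) μ)
    (k l : Lp ℝ (ENNReal.ofReal (p + 2)) μ) : Integrable (fun x => Φ x * k x * l x) μ := by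
  have h1 : MemLp (fun x => Φ x * k x) (ENNReal.ofReal ((p + 2) / (p + 1))) μ :=
    (Lp.memLp k).mul (Lp.memLp Φ)
  exact memLp_one_iff_integrable.1 ((Lp.memLp l).mul h1)

theorem integrable_pairing (a : Lp ℝ (ENNReal.ofReal ((p + 2) / (p + 1))) μ)
    (k : Lp ℝ (ENNReal.ofReal (p + 2)) μ) : Integrable (fun x => a x * k x) μ :=
  memLp_one_iff_integrable.1 ((Lp.memLp k).mul (Lp.memLp a))

theorem integral_sub_sub {a b c : α → ℝ} (ha : Integrable a μ) (hb : Integrable b μ)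
    (hc : Integrable c μ) :
    ∫ x, a x ∂μ - ∫ x, b x ∂μ - ∫ x, c x ∂μ = ∫ x, (a x - b x - c x) ∂μ := by
  have h : Integrable (fun x => a x - b x) μ := ha.sub hb
  rw [integral_sub h hc, integral_sub ha hb]

theorem growth_le {C e : ℝ} (hC : 0 ≤ C) (he : 0 ≤ e) (a b : ℝ) :
    C * (1 + |a|) ^ e ≤ C * (1 + |a| + |b|) ^ e :=
  mul_le_mul_of_nonneg_left
    (Real.rpow_le_rpow (by positivity) (by linarith [abs_nonneg b]) he) hC

/-- The common mechanism behind both derivatives and the continuity of the second one: a remainder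
of order `p` vanishing at `h = 0` tends to `0` in `L^{(p+2)/p}`, and the trilinear form is bounded
there. -/
theorem exists_remainder {Ψ : ℝ × ℝ → ℝ} (hΨ : Continuous Ψ) {C : ℝ}
    (hb : ∀ a b, |Ψ (a, b)| ≤ C * (1 + |a| + |b|) ^ p) (h0 : ∀ a, Ψ (a, 0) = 0)
    (u : Lp ℝ (ENNReal.ofReal (p + 2)) μ) {ε : ℝ} (hε : 0 < ε) :
    ∀ᶠ h in 𝓝 (0 : Lp ℝ (ENNReal.ofReal (p + 2)) μ),
      ∃ R : Lp ℝ (ENNReal.ofReal ((p + 2) / p)) μ, R =ᵐ[μ] (fun x => Ψ (u x, h x)) ∧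
        ‖triForm μ p R‖ ≤ ε := by
  have hp0 := hp.out
  have h1 := tendsto_eLpNorm_superposition (μ := μ) hΨ hp0 (by linarith : 0 < p + 2) hb h0 u
  set B := ‖triForm μ p‖ + 1 with hB
  have hB0 : 0 < B := by positivity
  have h2 := h1.eventually (gt_mem_nhds (show 0 < ENNReal.ofReal (ε / B) by
    rw [ENNReal.ofReal_pos]; positivity))
  filter_upwards [h2] with h hh
  have hm := memLp_superposition hΨ hp0 hb (Lp.memLp u) (Lp.memLp h)
  refine ⟨hm.toLp _, hm.coeFn_toLp, ?_⟩
  have h3 : ‖hm.toLp _‖ ≤ ε / B := by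
    rw [Lp.norm_toLp]
    exact ENNReal.toReal_le_of_le_ofReal (by positivity) hh.le
  calc _ ≤ ‖triForm μ p‖ * ‖hm.toLp _‖ := ContinuousLinearMap.le_opNorm _ _
    _ ≤ B * (ε / B) := mul_le_mul (by linarith) h3 (norm_nonneg _) hB0.le
    _ = ε := by field_simp

/-- Data for an integral functional `u ↦ ∫ W(u)` on `L^{p+2}`: `W' = f`, `f' = g`, and `g`
grows at most like `|x|^p`. -/
structure HasGrowth (p : ℝ) (W f g : ℝ → ℝ) : Prop where
  cont : Continuous g
  deriv_f : ∀ x, HasDerivAt f (g x) x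
  deriv_W : ∀ x, HasDerivAt W (f x) x
  bound : ∃ C, 0 ≤ C ∧ ∀ x, |g x| ≤ C * (1 + |x|) ^ p

namespace HasGrowth

variable {W f g : ℝ → ℝ} (H : HasGrowth p W f g)

include H

theorem continuous_f : Continuous f :=
  continuous_iff_continuousAt.2 fun x => (H.deriv_f x).continuousAt

theorem continuous_W : Continuous W :=
  continuous_iff_continuousAt.2 fun x => (H.deriv_W x).continuousAt

/-- The mean value formula from `0` multiplies the bound on `g` by `|x|`, which raises the growth
exponent by one. -/
theorem bound_f : ∃ C, 0 ≤ C ∧ ∀ x, |f x| ≤ C * (1 + |x|) ^ (p + 1) := by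
  obtain ⟨C, hC, hb⟩ := H.bound
  have hp0 := hp.out
  refine ⟨|f 0| + C, by positivity, fun x => ?_⟩
  have h1 := segmentMean_mul H.cont H.deriv_f 0 x
  have h2 := abs_segmentMean_le hC hp0.le hb 0 x
  rw [abs_zero, add_zero] at h2
  rw [zero_add] at h1
  have h3 : |f x| ≤ |f 0| + |segmentMean g (0, x)| * |x| := by
    rw [← abs_mul, h1]
    have := abs_add_le (f 0) (f x - f 0)
    rwa [add_sub_cancel] at this
  have hX : 1 ≤ 1 + |x| := by linarith [abs_nonneg x]
  have h4 : (1 + |x|) ^ (p + 1) = (1 + |x|) ^ p * (1 + |x|) := by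
    rw [Real.rpow_add (by linarith), Real.rpow_one]
  have h5 : 1 ≤ (1 + |x|) ^ (p + 1) := Real.one_le_rpow hX (by linarith)
  have h6 : 0 ≤ (1 + |x|) ^ p := by positivity
  calc |f x| ≤ |f 0| + C * (1 + |x|) ^ p * |x| :=
        h3.trans (by gcongr)
    _ ≤ |f 0| * (1 + |x|) ^ (p + 1) + C * (1 + |x|) ^ p * (1 + |x|) := by
        refine add_le_add (le_mul_of_one_le_right (abs_nonneg _) h5)
          (mul_le_mul_of_nonneg_left (by linarith) (by positivity))
    _ = _ := by rw [h4]; ring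

theorem bound_W : ∃ C, 0 ≤ C ∧ ∀ x, |W x| ≤ C * (1 + |x|) ^ (p + 2) := by
  obtain ⟨C, hC, hb⟩ := H.bound_f
  have hp0 := hp.out
  refine ⟨|W 0| + C, by positivity, fun x => ?_⟩
  have h1 := segmentMean_mul H.continuous_f H.deriv_W 0 x
  have h2 := abs_segmentMean_le hC (by linarith) hb 0 x
  rw [abs_zero, add_zero] at h2
  rw [zero_add] at h1
  have h3 : |W x| ≤ |W 0| + |segmentMean f (0, x)| * |x| := by
    rw [← abs_mul, h1]
    have := abs_add_le (W 0) (W x - W 0)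
    rwa [add_sub_cancel] at this
  have hX : 1 ≤ 1 + |x| := by linarith [abs_nonneg x]
  have h4 : (1 + |x|) ^ (p + 2) = (1 + |x|) ^ (p + 1) * (1 + |x|) := by
    rw [show p + 2 = (p + 1) + 1 by ring, Real.rpow_add (by linarith), Real.rpow_one]
  have h5 : 1 ≤ (1 + |x|) ^ (p + 2) := Real.one_le_rpow hX (by linarith)
  have h6 : 0 ≤ (1 + |x|) ^ (p + 1) := by positivity
  calc |W x| ≤ |W 0| + C * (1 + |x|) ^ (p + 1) * |x| :=
        h3.trans (by gcongr)
    _ ≤ |W 0| * (1 + |x|) ^ (p + 2) + C * (1 + |x|) ^ (p + 1) * (1 + |x|) := by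
        refine add_le_add (le_mul_of_one_le_right (abs_nonneg _) h5)
          (mul_le_mul_of_nonneg_left (by linarith) (by positivity))
    _ = _ := by rw [h4]; ring

theorem memLp_g (u : Lp ℝ (ENNReal.ofReal (p + 2)) μ) :
    MemLp (fun x => g (u x)) (ENNReal.ofReal ((p + 2) / p)) μ := by
  obtain ⟨C, hC, hb⟩ := H.bound
  have hp0 := hp.out
  refine memLp_superposition (Φ := fun z => g z.1) (H.cont.comp continuous_fst) (C := C) hp0
    (fun a b => (hb a).trans (growth_le hC (by linarith) a b))
    (Lp.memLp u) (Lp.memLp u)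

theorem memLp_f (u : Lp ℝ (ENNReal.ofReal (p + 2)) μ) :
    MemLp (fun x => f (u x)) (ENNReal.ofReal ((p + 2) / (p + 1))) μ := by
  obtain ⟨C, hC, hb⟩ := H.bound_f
  have hp0 := hp.out
  refine memLp_superposition (Φ := fun z => f z.1) (H.continuous_f.comp continuous_fst) (C := C)
    (by linarith) (fun a b => (hb a).trans (growth_le hC (by linarith) a b))
    (Lp.memLp u) (Lp.memLp u)

theorem integrable_W (u : Lp ℝ (ENNReal.ofReal (p + 2)) μ) :
    Integrable (fun x => W (u x)) μ := by
  obtain ⟨C, hC, hb⟩ := H.bound_W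
  have hp0 := hp.out
  have h : MemLp (fun x => W (u x)) (ENNReal.ofReal ((p + 2) / (p + 2))) μ := by
    refine memLp_superposition (Φ := fun z => W z.1) (H.continuous_W.comp continuous_fst) (C := C)
      (by linarith) (fun a b => (hb a).trans (growth_le hC (by linarith) a b))
      (Lp.memLp u) (Lp.memLp u)
  rw [div_self (by linarith), ENNReal.ofReal_one] at h
  exact memLp_one_iff_integrable.1 h

/-- The first derivative of the functional `u ↦ ∫ W(u)`. -/
def D1 (u : Lp ℝ (ENNReal.ofReal (p + 2)) μ) : Lp ℝ (ENNReal.ofReal (p + 2)) μ →L[ℝ] ℝ :=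
  (ContinuousLinearMap.mul ℝ ℝ).lpPairing μ (ENNReal.ofReal ((p + 2) / (p + 1)))
    (ENNReal.ofReal (p + 2)) ((H.memLp_f u).toLp _)

/-- The second derivative of the functional `u ↦ ∫ W(u)`. -/
def D2 (u : Lp ℝ (ENNReal.ofReal (p + 2)) μ) :
    Lp ℝ (ENNReal.ofReal (p + 2)) μ →L[ℝ] Lp ℝ (ENNReal.ofReal (p + 2)) μ →L[ℝ] ℝ :=
  triForm μ p ((H.memLp_g u).toLp _)

theorem D1_apply (u k : Lp ℝ (ENNReal.ofReal (p + 2)) μ) :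
    H.D1 u k = ∫ x, f (u x) * k x ∂μ := by
  rw [D1, ContinuousLinearMap.lpPairing_eq_integral]
  apply integral_congr_ae
  filter_upwards [(H.memLp_f u).coeFn_toLp] with x hx
  rw [hx]
  rfl

theorem D2_apply (u k l : Lp ℝ (ENNReal.ofReal (p + 2)) μ) :
    H.D2 u k l = ∫ x, g (u x) * k x * l x ∂μ := by
  rw [D2, triForm_apply]
  apply integral_congr_ae
  filter_upwards [(H.memLp_g u).coeFn_toLp] with x hx
  rw [hx]

theorem integrable_f_mul (u k : Lp ℝ (ENNReal.ofReal (p + 2)) μ) :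
    Integrable (fun x => f (u x) * k x) μ := by
  refine (integrable_pairing ((H.memLp_f u).toLp _) k).congr ?_
  filter_upwards [(H.memLp_f u).coeFn_toLp] with x hx
  rw [hx]

theorem integrable_g_mul (u k l : Lp ℝ (ENNReal.ofReal (p + 2)) μ) :
    Integrable (fun x => g (u x) * k x * l x) μ := by
  refine (integrable_triple ((H.memLp_g u).toLp _) k l).congr ?_
  filter_upwards [(H.memLp_g u).coeFn_toLp] with x hx
  rw [hx]

/-- Here `Ψ = segmentMoment g - g / 2` vanishes at `b = 0`, and the error is exactly `∫ Ψ(u, h) h²`.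
-/
theorem taylor (u : Lp ℝ (ENNReal.ofReal (p + 2)) μ) {ε : ℝ} (hε : 0 < ε) :
    ∀ᶠ h in 𝓝 (0 : Lp ℝ (ENNReal.ofReal (p + 2)) μ),
      |∫ x, W ((u + h) x) ∂μ - ∫ x, W (u x) ∂μ - H.D1 u h - 1 / 2 * H.D2 u h h|
        ≤ ε * ‖h‖ ^ 2 := by
  obtain ⟨C, hC, hb⟩ := H.bound
  have hp0 := hp.out
  let Ψ : ℝ × ℝ → ℝ := fun z => segmentMoment g z - 1 / 2 * g z.1
  have hΨ : Continuous Ψ :=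
    (continuous_segmentMoment H.cont).sub ((H.cont.comp continuous_fst).const_mul _)
  have hΨb : ∀ a b, |Ψ (a, b)| ≤ (2 * C) * (1 + |a| + |b|) ^ p := by
    intro a b
    have h1 := abs_segmentMoment_le hC hp0.le hb a b
    have h2 : |g a| ≤ C * (1 + |a| + |b|) ^ p := (hb a).trans (growth_le hC hp0.le a b)
    have h3 := abs_sub (segmentMoment g (a, b)) (1 / 2 * g a)
    rw [abs_mul, abs_of_pos (by norm_num : (0 : ℝ) < 1 / 2)] at h3
    simp only [Ψ]
    linarith [abs_nonneg (g a)]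
  filter_upwards [exists_remainder (μ := μ) hΨ hΨb
    (fun a => by simp only [Ψ, segmentMoment_zero, sub_self]) u hε] with h hh
  obtain ⟨R, hR, hRn⟩ := hh
  have hi : Integrable (fun x => W ((u + h) x) - W (u x) - f (u x) * h x) μ :=
    ((H.integrable_W _).sub (H.integrable_W u)).sub (H.integrable_f_mul u h)
  have e : ∫ x, W ((u + h) x) ∂μ - ∫ x, W (u x) ∂μ - H.D1 u h - 1 / 2 * H.D2 u h h
      = triForm μ p R h h := by
    rw [D1_apply, D2_apply, triForm_apply, ← integral_const_mul,
      integral_sub_sub (H.integrable_W _) (H.integrable_W u) (H.integrable_f_mul u h),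
      ← integral_sub hi ((H.integrable_g_mul u h h).const_mul _)]
    apply integral_congr_ae
    filter_upwards [hR, Lp.coeFn_add u h] with x hx1 hx2
    rw [hx1, hx2, Pi.add_apply]
    have := segmentMoment_mul H.cont H.deriv_f H.deriv_W (u x) (h x)
    simp only [Ψ]
    linear_combination -this
  rw [e, ← Real.norm_eq_abs]
  calc _ ≤ ‖triForm μ p R‖ * ‖h‖ * ‖h‖ := ContinuousLinearMap.le_opNorm₂ _ _ _
    _ ≤ ε * ‖h‖ * ‖h‖ := by gcongr
    _ = _ := by ring

theorem hasFDerivAt (u : Lp ℝ (ENNReal.ofReal (p + 2)) μ) :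
    HasFDerivAt (fun u : Lp ℝ (ENNReal.ofReal (p + 2)) μ => ∫ x, W (u x) ∂μ) (H.D1 u) u := by
  rw [hasFDerivAt_iff_isLittleO_nhds_zero, Asymptotics.isLittleO_iff]
  intro c hc
  set B := 1 + ‖H.D2 u‖ with hB
  have hB0 : 0 < B := by positivity
  filter_upwards [H.taylor u one_pos, Metric.ball_mem_nhds 0 (div_pos hc hB0)] with h h1 h2
  rw [mem_ball_zero_iff, lt_div_iff₀ hB0] at h2
  have h3 : |H.D2 u h h| ≤ ‖H.D2 u‖ * ‖h‖ * ‖h‖ := by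
    rw [← Real.norm_eq_abs]
    exact ContinuousLinearMap.le_opNorm₂ _ _ _
  rw [Real.norm_eq_abs]
  rw [abs_le] at *
  have h4 : B * ‖h‖ ^ 2 ≤ c * ‖h‖ := by nlinarith [norm_nonneg h]
  have h5 : B * ‖h‖ ^ 2 = ‖h‖ ^ 2 + ‖H.D2 u‖ * ‖h‖ * ‖h‖ := by rw [hB]; ring
  have h6 : 0 ≤ ‖H.D2 u‖ * ‖h‖ * ‖h‖ := by positivity
  constructor <;> linarith [h1.1, h1.2, h3.1, h3.2]

/-- The same argument with the first order remainder `segmentMean g - g`. -/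
theorem hasFDerivAt_D1 (u : Lp ℝ (ENNReal.ofReal (p + 2)) μ) :
    HasFDerivAt (fun u : Lp ℝ (ENNReal.ofReal (p + 2)) μ => H.D1 u) (H.D2 u) u := by
  rw [hasFDerivAt_iff_isLittleO_nhds_zero, Asymptotics.isLittleO_iff]
  intro c hc
  obtain ⟨C, hC, hb⟩ := H.bound
  have hp0 := hp.out
  let Ψ : ℝ × ℝ → ℝ := fun z => segmentMean g z - g z.1
  have hΨ : Continuous Ψ := (continuous_segmentMean H.cont).sub (H.cont.comp continuous_fst)
  have hΨb : ∀ a b, |Ψ (a, b)| ≤ (2 * C) * (1 + |a| + |b|) ^ p := by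
    intro a b
    have h1 := abs_segmentMean_le hC hp0.le hb a b
    have h2 : |g a| ≤ C * (1 + |a| + |b|) ^ p := (hb a).trans (growth_le hC hp0.le a b)
    have h3 := abs_sub (segmentMean g (a, b)) (g a)
    simp only [Ψ]
    linarith
  filter_upwards [exists_remainder (μ := μ) hΨ hΨb
    (fun a => by simp only [Ψ, segmentMean_zero, sub_self]) u hc] with h hh
  obtain ⟨R, hR, hRn⟩ := hh
  have e : H.D1 (u + h) - H.D1 u - H.D2 u h = triForm μ p R h := by
    ext k
    rw [sub_apply, sub_apply, D1_apply, D1_apply,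
      D2_apply, triForm_apply, integral_sub_sub (H.integrable_f_mul _ k) (H.integrable_f_mul u k)
        (H.integrable_g_mul u h k)]
    apply integral_congr_ae
    filter_upwards [hR, Lp.coeFn_add u h] with x hx1 hx2
    rw [hx1, hx2, Pi.add_apply]
    have := segmentMean_mul H.cont H.deriv_f (u x) (h x)
    simp only [Ψ]
    linear_combination (-k x) * this
  rw [e]
  exact (ContinuousLinearMap.le_opNorm _ _).trans (by gcongr)

theorem continuous_D2 : Continuous (fun u : Lp ℝ (ENNReal.ofReal (p + 2)) μ => H.D2 u) := by
  rw [continuous_iff_continuousAt]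
  intro u
  rw [Metric.continuousAt_iff']
  intro c hc
  obtain ⟨C, hC, hb⟩ := H.bound
  have hp0 := hp.out
  let Ψ : ℝ × ℝ → ℝ := fun z => g (z.1 + z.2) - g z.1
  have hΨ : Continuous Ψ :=
    (H.cont.comp (continuous_fst.add continuous_snd)).sub (H.cont.comp continuous_fst)
  have hΨb : ∀ a b, |Ψ (a, b)| ≤ (2 * C) * (1 + |a| + |b|) ^ p := by
    intro a b
    have h1 : |g (a + b)| ≤ C * (1 + |a| + |b|) ^ p := 
      (hb _).trans (mul_le_mul_of_nonneg_left (Real.rpow_le_rpow (by positivity)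
        (by linarith [abs_add_le a b]) hp0.le) hC)
    have h2 : |g a| ≤ C * (1 + |a| + |b|) ^ p := (hb a).trans (growth_le hC hp0.le a b)
    have h3 := abs_sub (g (a + b)) (g a)
    simp only [Ψ]
    linarith
  have h1 := exists_remainder (μ := μ) hΨ hΨb
    (fun a => by simp only [Ψ, add_zero, sub_self]) u (half_pos hc)
  have h2 : Tendsto (fun v => v - u) (𝓝 u) (𝓝 0) := by
    have := (continuous_sub_right u).tendsto u
    rwa [sub_self] at this
  filter_upwards [h2.eventually h1] with v hv
  obtain ⟨R, hR, hRn⟩ := hv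
  have e : H.D2 v - H.D2 u = triForm μ p R := by
    ext k l
    rw [sub_apply, sub_apply, D2_apply, D2_apply,
      triForm_apply, ← integral_sub (H.integrable_g_mul v k l) (H.integrable_g_mul u k l)]
    apply integral_congr_ae
    filter_upwards [hR, Lp.coeFn_sub v u] with x hx1 hx2
    rw [hx1, hx2, Pi.sub_apply]
    simp only [Ψ, add_sub_cancel]
    ring
  rw [dist_eq_norm, e]
  linarith

theorem contDiff_two :
    ContDiff ℝ 2 (fun u : Lp ℝ (ENNReal.ofReal (p + 2)) μ => ∫ x, W (u x) ∂μ) := by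
  have h1 : ContDiff ℝ 1 (fun u : Lp ℝ (ENNReal.ofReal (p + 2)) μ => H.D1 u) :=
    contDiff_one_iff_hasFDerivAt.2 ⟨_, H.continuous_D2, H.hasFDerivAt_D1⟩
  have h2 := (contDiff_succ_iff_hasFDerivAt (𝕜 := ℝ) (n := 1)
    (f := fun u : Lp ℝ (ENNReal.ofReal (p + 2)) μ => ∫ x, W (u x) ∂μ)).2
    ⟨_, by exact_mod_cast h1, H.hasFDerivAt⟩
  norm_num at h2
  exact h2

end HasGrowth

end IntegralFunctional

/-! ### Transfer of the `C²` property to the energy space under the growth condition. -/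

noncomputable section Potential
set_option maxSynthPendingDepth 3
open Filter Topology

variable {L : ℝ} [Fact (0 < L)]

/-- A function agreeing with `W` on a given interval whose second derivative is bounded. -/
theorem exists_cutoff {f W : ℝ → ℝ} (hf : ContDiff ℝ ∞ f) (hW : ∀ x, HasDerivAt W (f x) x)
    {p : ℝ} (hp : 0 ≤ p) (R : ℝ) : ∃ W₁ f₁ g₁ : ℝ → ℝ, HasGrowth p W₁ f₁ g₁ ∧
    ∀ x, |x| < R → W x = W₁ x ∧ f x = f₁ x ∧ deriv f x = g₁ x := by
  have hWd : deriv W = f := funext fun x => (hW x).deriv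
  have hWs : ContDiff ℝ ∞ W := contDiff_infty_iff_deriv.2
    ⟨fun x => (hW x).differentiableAt, by rwa [hWd]⟩
  -- The cut is applied to the primitive `W`, so that the three new functions remain successive
  -- derivatives; the second derivative then has compact support and is bounded.
  let b : ContDiffBump (0 : ℝ) := ⟨max R 1, max R 1 + 1, by positivity, by linarith⟩
  let W₁ : ℝ → ℝ := fun x => b x * W x
  have h1 : ContDiff ℝ ∞ W₁ := b.contDiff.mul hWs
  have h2 := contDiff_infty_iff_deriv.1 h1
  have h3 := contDiff_infty_iff_deriv.1 h2.2
  have hc : HasCompactSupport W₁ := b.hasCompactSupport.mul_right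
  obtain ⟨C, hC⟩ := hc.deriv.deriv.exists_bound_of_continuous h3.2.continuous
  have hloc : ∀ x, |x| < R → W =ᶠ[𝓝 x] W₁ := by
    intro x hx
    filter_upwards [(isOpen_lt continuous_abs continuous_const).mem_nhds hx] with y hy
    have hy' : |y| < R := hy
    have : b y = 1 := b.one_of_mem_closedBall (by
      rw [mem_closedBall_zero_iff, Real.norm_eq_abs]
      exact hy'.le.trans (le_max_left _ _))
    simp only [W₁, this, one_mul]
  refine ⟨W₁, deriv W₁, deriv (deriv W₁), ⟨h3.2.continuous, fun x => (h3.1 x).hasDerivAt,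
    fun x => (h2.1 x).hasDerivAt, C, (norm_nonneg _).trans (hC 0), fun x => ?_⟩, fun x hx => ?_⟩
  · have h4 : 1 ≤ (1 + |x|) ^ p := Real.one_le_rpow (by linarith [abs_nonneg x]) hp
    exact (hC x).trans (le_mul_of_one_le_right ((norm_nonneg _).trans (hC 0)) h4)
  · have e1 := hloc x hx
    refine ⟨e1.eq_of_nhds, ?_, ?_⟩
    · rw [← hWd]
      exact e1.deriv_eq
    · rw [← hWd]
      exact e1.deriv.deriv_eq

/-- The energy space embeds in some `L^{p+2}`, `p > 0`, in such a way that, on bounded sets, the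
nonlinearity has the corresponding growth. -/
theorem exists_embedding_of_growthCondition {m : ℝ} (hm : 0 < m) {f W : ℝ → ℝ}
    (hf : ContDiff ℝ ∞ f) (hW : ∀ x, HasDerivAt W (f x) x) (hg : GrowthCondition m f) :
    ∃ p : ℝ, 0 < p ∧ (∃ C : ℝ, 0 ≤ C ∧ ∀ u : HPer L (m / 2),
      eLpNorm (toL2 u) (ENNReal.ofReal (p + 2)) volume ≤ ENNReal.ofReal (C * ‖u‖)) ∧
    ∀ ρ : ℝ, ∃ W₁ f₁ g₁ : ℝ → ℝ, HasGrowth p W₁ f₁ g₁ ∧ ∀ u : HPer L (m / 2), ‖u‖ < ρ →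
      ∀ᵐ x, W (toL2 u x) = W₁ (toL2 u x) ∧ f (toL2 u x) = f₁ (toL2 u x) ∧
        deriv f (toL2 u x) = g₁ (toL2 u x) := by
  by_cases hm1 : 1 < m
  -- For `m > 1` any exponent would do; `H^{1/4} ⊆ L⁴` corresponds to `p = 2`. The supremum bound
  -- then restricts the values of `u` to an interval on which `W` agrees with its cutoff.
  · refine ⟨2, two_pos, exists_eLpNorm_le (s := 1 / 4) (by norm_num) (by norm_num)
      (by linarith) (by norm_num) (by norm_num), fun ρ => ?_⟩
    obtain ⟨C, hC, hb⟩ := exists_ae_abs_le (L := L) (s := m / 2) (by linarith)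
    obtain ⟨W₁, f₁, g₁, H, h⟩ := exists_cutoff hf hW (zero_le_two (α := ℝ)) (C * ρ + 1)
    refine ⟨W₁, f₁, g₁, H, fun u hu => ?_⟩
    filter_upwards [hb u] with x hx
    exact h _ (by nlinarith)
  · obtain ⟨p₀, C₀, hp₀, hpm, hb⟩ := hg.resolve_left hm1
    obtain ⟨s, hs0, hs1, hsm, hsp⟩ : ∃ s : ℝ, 0 < s ∧ s < 1 / 2 ∧ s ≤ m / 2 ∧
        p₀ * (1 / 2 - s) ≤ 2 * s := by
      rcases lt_or_eq_of_le (not_lt.1 hm1) with h | h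
      · exact ⟨m / 2, by linarith, by linarith, le_rfl, by linarith⟩
      -- For `m = 1` the endpoint `s = 1/2` is not available. This `s < 1/2` satisfies `2s / (1/2 -
      -- s) = p₀ + 1`, enough for the growth of `f'` and positive even if `p₀ = 0`.
      · refine ⟨(p₀ + 1) / (2 * (p₀ + 3)), by positivity, ?_, ?_, ?_⟩
        · rw [div_lt_iff₀ (by positivity)]
          linarith
        · rw [div_le_iff₀ (by positivity), h]
          linarith
        · have e1 : (1 / 2 - (p₀ + 1) / (2 * (p₀ + 3))) = 1 / (p₀ + 3) := by
            field_simp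
            ring
          rw [e1]
          have e2 : 2 * ((p₀ + 1) / (2 * (p₀ + 3))) = (p₀ + 1) * (1 / (p₀ + 3)) := by
            field_simp
          rw [e2]
          exact mul_le_mul_of_nonneg_right (by linarith) (by positivity)
    have hd : 0 < 1 / 2 - s := by linarith
    set p := 2 * s / (1 / 2 - s) with hp
    have hp0 : 0 < p := by positivity
    have hpp : p₀ ≤ p := by rwa [hp, le_div_iff₀ hd]
    refine ⟨p, hp0, exists_eLpNorm_le hs0 hs1 hsm (by linarith) ?_, fun ρ =>
      ⟨W, f, deriv f, ⟨?_, ?_, hW, ?_⟩, fun u _ => Eventually.of_forall fun x => ⟨rfl, rfl, rfl⟩⟩⟩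
    · rw [add_sub_cancel_right, hp, mul_div_cancel₀ _ hd.ne']
    · exact (contDiff_infty_iff_deriv.1 hf).2.continuous
    · exact fun x => ((contDiff_infty_iff_deriv.1 hf).1 x).hasDerivAt
    · have hC : 0 ≤ C₀ := by
        by_contra hcon
        push Not at hcon
        have h1 := (abs_nonneg _).trans (hb 0)
        have h2 : (0 : ℝ) ≤ |(0 : ℝ)| ^ p₀ := by positivity
        nlinarith
      refine ⟨2 * C₀, by positivity, fun x => (hb x).trans ?_⟩
      have hX : 1 ≤ 1 + |x| := by linarith [abs_nonneg x]
      have h1 : 1 ≤ (1 + |x|) ^ p := Real.one_le_rpow hX hp0.le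
      have h2 : |x| ^ p₀ ≤ (1 + |x|) ^ p :=
        (Real.rpow_le_rpow (abs_nonneg x) (by linarith) hp₀).trans
          (Real.rpow_le_rpow_of_exponent_le hX hpp)
      nlinarith

theorem memLp_of_eLpNorm_le {Q : ENNReal} {u : L2Per L} {C : ℝ}
    (h : eLpNorm u Q volume ≤ ENNReal.ofReal C) : MemLp u Q volume :=
  ⟨Lp.aestronglyMeasurable _, h.trans_lt ENNReal.ofReal_lt_top⟩

/-- A bounded embedding of `H^s_per` in `L^q`. -/
def embedLp {s : ℝ} {Q : ENNReal} [Fact (1 ≤ Q)] {C : ℝ}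
    (h : ∀ u : HPer L s, eLpNorm (toL2 u) Q volume ≤ ENNReal.ofReal (C * ‖u‖)) (hC : 0 ≤ C) :
    HPer L s →L[ℝ] Lp ℝ Q (volume : Measure (AddCircle L)) :=
  LinearMap.mkContinuous
    { toFun := fun u => (memLp_of_eLpNorm_le (h u)).toLp _
      map_add' := fun u v => by
        rw [← MemLp.toLp_add, MemLp.toLp_eq_toLp_iff, map_add]
        exact Lp.coeFn_add _ _
      map_smul' := fun a u => by
        rw [RingHom.id_apply, ← MemLp.toLp_const_smul, MemLp.toLp_eq_toLp_iff, map_smul]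
        exact Lp.coeFn_smul _ _ } C
    fun u => by
      change ‖(memLp_of_eLpNorm_le (h u)).toLp _‖ ≤ _
      rw [Lp.norm_toLp]
      exact ENNReal.toReal_le_of_le_ofReal (mul_nonneg hC (norm_nonneg _)) (h u)

theorem coeFn_embedLp {s : ℝ} {Q : ENNReal} [Fact (1 ≤ Q)] {C : ℝ}
    (h : ∀ u : HPer L s, eLpNorm (toL2 u) Q volume ≤ ENNReal.ofReal (C * ‖u‖)) (hC : 0 ≤ C)
    (u : HPer L s) : embedLp h hC u =ᵐ[volume] toL2 u :=
  (memLp_of_eLpNorm_le (h u)).coeFn_toLp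

/-- Regularity of `u ↦ ∫ W(u) dx` on the energy space. -/
theorem potential_local {m : ℝ} (hm : 0 < m) {f W : ℝ → ℝ}
    (hf : ContDiff ℝ ∞ f) (hW : ∀ x, HasDerivAt W (f x) x) (hg : GrowthCondition m f)
    (u : HPer L (m / 2)) :
    ContDiffAt ℝ 2 (fun u : HPer L (m / 2) => ∫ x, W (toL2 u x)) u ∧
    (∃ D : HPer L (m / 2) →L[ℝ] ℝ,
      HasFDerivAt (fun u : HPer L (m / 2) => ∫ x, W (toL2 u x)) D u ∧
      ∀ k, D k = ∫ x, f (toL2 u x) * toL2 k x) ∧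
    ∀ ε > 0, ∀ᶠ h in 𝓝 (0 : HPer L (m / 2)),
      |(∫ x, W (toL2 (u + h) x)) - (∫ x, W (toL2 u x)) - (∫ x, f (toL2 u x) * toL2 h x)
        - 1 / 2 * ∫ x, deriv f (toL2 u x) * toL2 h x * toL2 h x| ≤ ε * ‖h‖ ^ 2 := by
  obtain ⟨p, hp, ⟨C, hC, hemb⟩, hloc⟩ :=
    exists_embedding_of_growthCondition (L := L) hm hf hW hg
  -- All the claims are local at `u`, so agreement on the ball of radius `‖u‖ + 1` suffices.
  obtain ⟨W₁, f₁, g₁, H, hag⟩ := hloc (‖u‖ + 1)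
  have : Fact (0 < p) := ⟨hp⟩
  let J := embedLp hemb hC
  have hJ : ∀ v, J v =ᵐ[volume] toL2 v := coeFn_embedLp hemb hC
  have hball : ∀ᶠ v in 𝓝 u, ‖v‖ < ‖u‖ + 1 :=
    (continuous_norm.tendsto u).eventually (gt_mem_nhds (lt_add_one _))
  have hu := hag u (lt_add_one _)
  have hval : ∀ v : HPer L (m / 2), ‖v‖ < ‖u‖ + 1 → ∫ x, W (toL2 v x) = ∫ x, W₁ (J v x) := by
    intro v hv
    apply integral_congr_ae
    filter_upwards [hag v hv, hJ v] with x hx1 hx2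
    rw [hx2, hx1.1]
  have heq : (fun v : HPer L (m / 2) => ∫ x, W (toL2 v x))
      =ᶠ[𝓝 u] (fun v => ∫ x, W₁ (v x)) ∘ J := hball.mono hval
  have hD1 : ∀ k, H.D1 (J u) (J k) = ∫ x, f (toL2 u x) * toL2 k x := by
    intro k
    rw [H.D1_apply]
    apply integral_congr_ae
    filter_upwards [hu, hJ u, hJ k] with x hx1 hx2 hx3
    rw [hx2, hx3, hx1.2.1]
  have hD2 : ∀ k, H.D2 (J u) (J k) (J k) = ∫ x, deriv f (toL2 u x) * toL2 k x * toL2 k x := by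
    intro k
    rw [H.D2_apply]
    apply integral_congr_ae
    filter_upwards [hu, hJ u, hJ k] with x hx1 hx2 hx3
    rw [hx2, hx3, hx1.2.2]
  refine ⟨?_, ⟨(H.D1 (J u)).comp J, ?_, hD1⟩, fun ε hε => ?_⟩
  · exact (H.contDiff_two.contDiffAt.comp u J.contDiff.contDiffAt).congr_of_eventuallyEq heq
  · exact ((H.hasFDerivAt (J u)).comp u J.hasFDerivAt).congr_of_eventuallyEq heq
  · set B := (‖J‖ + 1) ^ 2 with hB
    have hB0 : 0 < B := by positivity
    have h1 := (J.continuous.tendsto 0)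
    rw [map_zero] at h1
    have h2 := h1.eventually (H.taylor (J u) (div_pos hε hB0))
    have h3 : ∀ᶠ h in 𝓝 (0 : HPer L (m / 2)), ‖u + h‖ < ‖u‖ + 1 := by
      have : Tendsto (fun h => u + h) (𝓝 0) (𝓝 u) := by
        have := (continuous_const_add u).tendsto 0
        rwa [add_zero] at this
      exact this.eventually hball
    filter_upwards [h2, h3] with h h4 h5
    rw [← map_add, ← hval _ h5, ← hval _ (lt_add_one _), hD1, hD2] at h4
    refine h4.trans ?_
    have h6 : ‖J h‖ ≤ (‖J‖ + 1) * ‖h‖ :=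
      (J.le_opNorm h).trans (mul_le_mul_of_nonneg_right (by linarith) (norm_nonneg _))
    calc ε / B * ‖J h‖ ^ 2 ≤ ε / B * ((‖J‖ + 1) * ‖h‖) ^ 2 := by gcongr
      _ = ε * ‖h‖ ^ 2 := by
          rw [mul_pow, ← hB]
          field_simp

end Potential

/-! ### Regularity, derivatives and translation invariance of `P`, `F`, `M` and `V`. -/

noncomputable section EnergyFunctionals
set_option maxSynthPendingDepth 3
open Filter Topology

variable {L : ℝ} [Fact (0 < L)] (S : DispersionSymbol)

theorem DispersionSymbol.exists_abs_le :
    ∃ C : ℝ, 0 ≤ C ∧ ∀ k : ℤ, |S.θ k| ≤ C * wt (S.m / 2) k := by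
  obtain ⟨C, hC⟩ := S.sq_le
  refine ⟨√|C|, Real.sqrt_nonneg _, fun k => ?_⟩
  apply le_of_sq_le_sq _ (mul_nonneg (Real.sqrt_nonneg _) (wt_pos _ k).le)
  rw [sq_abs, mul_pow, Real.sq_sqrt (abs_nonneg _), sq (wt _ k), wt_mul_wt, add_halves]
  exact (hC k).trans (mul_le_mul_of_nonneg_right (le_abs_self C) (wt_pos _ k).le)

theorem wt_mul_abs_conj_mul_re_le {s : ℝ} (u v : HPer L s) (k : ℤ) :
    wt s k * |((starRingEnd ℂ) (hat u k) * hat v k).re|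
      ≤ (√(wt s k) * ‖hat u k‖) * (√(wt s k) * ‖hat v k‖) := by
  have h1 : |((starRingEnd ℂ) (hat u k) * hat v k).re| ≤ ‖hat u k‖ * ‖hat v k‖ := by
    refine (Complex.abs_re_le_norm _).trans ?_
    rw [norm_mul, RCLike.norm_conj]
  calc _ ≤ wt s k * (‖hat u k‖ * ‖hat v k‖) := mul_le_mul_of_nonneg_left h1 (wt_pos s k).le
    _ = (√(wt s k) * √(wt s k)) * (‖hat u k‖ * ‖hat v k‖) := by
        rw [Real.mul_self_sqrt (wt_pos s k).le]
    _ = _ := by ring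

theorem summable_theta (u v : HPer L (S.m / 2)) :
    Summable fun k : ℤ => S.θ k * ((starRingEnd ℂ) (hat u k) * hat v k).re := by
  obtain ⟨C, hC, h⟩ := S.exists_abs_le
  refine Summable.of_norm_bounded ((summable_inner u v).abs.mul_left C) (fun k => ?_)
  rw [Real.norm_eq_abs, abs_mul, abs_mul, abs_of_pos (wt_pos _ k), ← mul_assoc]
  exact mul_le_mul_of_nonneg_right (h k) (abs_nonneg _)

/-- Cauchy–Schwarz with the absolute values inside the sum, as needed because `θ` has no fixed sign
at low frequencies. -/
theorem tsum_wt_abs_le {s : ℝ} (u v : HPer L s) :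
    L * ∑' k : ℤ, wt s k * |((starRingEnd ℂ) (hat u k) * hat v k).re| ≤ ‖u‖ * ‖v‖ := by
  have hL : (0 : ℝ) < L := Fact.out
  have hsu : ∀ w : HPer L s, Summable fun k => (√(wt s k) * ‖hat w k‖) ^ 2 := fun w => by
    simpa only [mul_pow, Real.sq_sqrt (wt_pos s _).le] using summable_hat w
  have hnn : ∀ (w : HPer L s) k, 0 ≤ √(wt s k) * ‖hat w k‖ := fun w k => by positivity
  have hmul : Summable fun k => (√(wt s k) * ‖hat u k‖) * (√(wt s k) * ‖hat v k‖) := by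
    refine Summable.of_nonneg_of_le (fun k => mul_nonneg (hnn u k) (hnn v k)) (fun k => ?_)
      ((hsu u).add (hsu v))
    nlinarith [sq_nonneg (√(wt s k) * ‖hat u k‖ - √(wt s k) * ‖hat v k‖),
      sq_nonneg (√(wt s k) * ‖hat u k‖), sq_nonneg (√(wt s k) * ‖hat v k‖)]
  have hlhs : Summable fun k : ℤ => wt s k * |((starRingEnd ℂ) (hat u k) * hat v k).re| :=
    Summable.of_nonneg_of_le (fun k => mul_nonneg (wt_pos s k).le (abs_nonneg _))
      (wt_mul_abs_conj_mul_re_le u v) hmul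
  have key : ∀ F : Finset ℤ, L * ∑ k ∈ F, wt s k * |((starRingEnd ℂ) (hat u k) * hat v k).re|
      ≤ ‖u‖ * ‖v‖ := by
    intro F
    have hF : ∀ w : HPer L s, L * ∑ k ∈ F, (√(wt s k) * ‖hat w k‖) ^ 2 ≤ ‖w‖ ^ 2 := fun w => by
      rw [hper_norm_sq]
      refine mul_le_mul_of_nonneg_left ?_ hL.le
      simp only [mul_pow, Real.sq_sqrt (wt_pos s _).le]
      exact (summable_hat w).sum_le_tsum F (fun k _ => mul_nonneg (wt_pos s k).le (sq_nonneg _))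
    have h1 := Finset.sum_le_sum fun k (_ : k ∈ F) => wt_mul_abs_conj_mul_re_le u v k
    have h2 := Finset.sum_mul_sq_le_sq_mul_sq F
      (fun k => √(wt s k) * ‖hat u k‖) (fun k => √(wt s k) * ‖hat v k‖)
    apply le_of_sq_le_sq _ (by positivity)
    have h3 : 0 ≤ ∑ k ∈ F, wt s k * |((starRingEnd ℂ) (hat u k) * hat v k).re| :=
      Finset.sum_nonneg fun k _ => mul_nonneg (wt_pos s k).le (abs_nonneg _)
    calc (L * ∑ k ∈ F, wt s k * |((starRingEnd ℂ) (hat u k) * hat v k).re|) ^ 2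
        ≤ (L * ∑ k ∈ F, (√(wt s k) * ‖hat u k‖) * (√(wt s k) * ‖hat v k‖)) ^ 2 := by gcongr
      _ ≤ (L * ∑ k ∈ F, (√(wt s k) * ‖hat u k‖) ^ 2)
          * (L * ∑ k ∈ F, (√(wt s k) * ‖hat v k‖) ^ 2) := by
          rw [mul_pow]
          nlinarith [sq_nonneg L]
      _ ≤ ‖u‖ ^ 2 * ‖v‖ ^ 2 := mul_le_mul (hF u) (hF v)
          (mul_nonneg hL.le (Finset.sum_nonneg fun k _ => sq_nonneg _)) (sq_nonneg _)
      _ = _ := by ring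
  have := hlhs.tsum_le_of_sum_le (a₂ := ‖u‖ * ‖v‖ / L) fun F => by
    rw [le_div_iff₀ hL, mul_comm]
    exact key F
  rw [le_div_iff₀ hL] at this
  linarith

/-- The duality pairing `⟨𝓜u, v⟩` on the energy space. -/
def formM : HPer L (S.m / 2) →L[ℝ] HPer L (S.m / 2) →L[ℝ] ℝ :=
  LinearMap.mkContinuous₂
    (LinearMap.mk₂ ℝ (fun u v : HPer L (S.m / 2) =>
      L * ∑' k : ℤ, S.θ k * ((starRingEnd ℂ) (hat u k) * hat v k).re)
      (fun u v w => by
        rw [← mul_add, ← (summable_theta S u w).tsum_add (summable_theta S v w)]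
        congr 2
        funext k
        rw [hat_add, map_add, add_mul, Complex.add_re]
        ring)
      (fun a u v => by
        rw [smul_eq_mul, mul_left_comm]
        congr 1
        rw [← tsum_mul_left]
        congr 1
        funext k
        rw [hat_smul, map_mul, Complex.conj_ofReal, mul_assoc, Complex.re_ofReal_mul]
        ring)
      (fun u v w => by
        rw [← mul_add, ← (summable_theta S u v).tsum_add (summable_theta S u w)]
        congr 2
        funext k
        rw [hat_add, mul_add, Complex.add_re]
        ring)
      (fun a u v => by
        rw [smul_eq_mul, mul_left_comm]
        congr 1
        rw [← tsum_mul_left]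
        congr 1
        funext k
        rw [hat_smul, mul_left_comm, Complex.re_ofReal_mul]
        ring))
    S.exists_abs_le.choose (fun u v => by
      have hL : (0 : ℝ) < L := Fact.out
      obtain ⟨hC, h⟩ := S.exists_abs_le.choose_spec
      set C := S.exists_abs_le.choose
      rw [LinearMap.mk₂_apply, norm_mul, Real.norm_of_nonneg hL.le, mul_assoc C]
      have h1 : ‖∑' k : ℤ, S.θ k * ((starRingEnd ℂ) (hat u k) * hat v k).re‖
          ≤ C * ∑' k : ℤ, wt (S.m / 2) k * |((starRingEnd ℂ) (hat u k) * hat v k).re| := by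
        rw [← tsum_mul_left]
        refine (norm_tsum_le_tsum_norm (summable_theta S u v).norm).trans ?_
        refine (summable_theta S u v).norm.tsum_le_tsum (fun k => ?_) ?_
        · rw [Real.norm_eq_abs, abs_mul, ← mul_assoc]
          exact mul_le_mul_of_nonneg_right (h k) (abs_nonneg _)
        · have := (summable_inner u v).abs.mul_left C
          simpa only [abs_mul, abs_of_pos (wt_pos _ _)] using this
      calc L * ‖∑' k : ℤ, S.θ k * ((starRingEnd ℂ) (hat u k) * hat v k).re‖
          ≤ L * (C * ∑' k : ℤ, wt (S.m / 2) k * |((starRingEnd ℂ) (hat u k) * hat v k).re|) :=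
            mul_le_mul_of_nonneg_left h1 hL.le
        _ = C * (L * ∑' k : ℤ, wt (S.m / 2) k * |((starRingEnd ℂ) (hat u k) * hat v k).re|) := by
            ring
        _ ≤ C * (‖u‖ * ‖v‖) := mul_le_mul_of_nonneg_left (tsum_wt_abs_le u v) hC)

theorem formM_apply (u v : HPer L (S.m / 2)) :
    formM S u v = L * ∑' k : ℤ, S.θ k * ((starRingEnd ℂ) (hat u k) * hat v k).re := rfl

theorem formM_comm (u v : HPer L (S.m / 2)) : formM S u v = formM S v u := by
  rw [formM_apply, formM_apply]
  congr 2
  ext k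
  simp only [Complex.mul_re, Complex.conj_re, Complex.conj_im]
  ring

theorem quadM_eq (u : HPer L (S.m / 2)) : quadM S u = formM S u u := by
  rw [formM_apply, quadM]
  simp only [conj_mul_self_re]

/-- Links the operator `𝓜` on `H^m`, in which the hypotheses are phrased, to the form on the energy
space, in which `V` is expanded. -/
theorem inner_M (hm : S.m / 2 ≤ S.m) (u : HPer L S.m) (v : HPer L (S.m / 2)) :
    inner ℝ (S.M u) (toL2 v) = formM S (incl hm u) v := by
  rw [inner_eq_tsum_fc, formM_apply]
  congr 2
  ext k
  rw [S.fc_M, hat_incl, map_mul, Complex.conj_ofReal, mul_assoc, Complex.re_ofReal_mul]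
  rfl

theorem integral_mul_eq_inner {a b : AddCircle L → ℝ} {u v : L2Per L} (ha : u =ᵐ[volume] a)
    (hb : v =ᵐ[volume] b) : ∫ x, a x * b x = inner ℝ u v := by
  rw [L2.inner_def]
  apply integral_congr_ae
  filter_upwards [ha, hb] with x hx1 hx2
  rw [hx1, hx2]
  simp [mul_comm]

theorem SmoothPer.onCircle_one (x : AddCircle L) : (SmoothPer.one L).onCircle x = 1 := by
  obtain ⟨y, rfl⟩ := QuotientAddGroup.mk_surjective x
  rfl

theorem SmoothPer.onCircle_comp (h : ℝ → ℝ) (hh : ContDiff ℝ ∞ h) (g : SmoothPer L)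
    (x : AddCircle L) : (g.comp h hh).onCircle x = h (g.onCircle x) := by
  obtain ⟨y, rfl⟩ := QuotientAddGroup.mk_surjective x
  rfl

theorem massM_eq_inner {s : ℝ} (u : HPer L s) :
    massM u = inner ℝ (SmoothPer.one L).inL2 (toL2 u) := by
  rw [massM, ← integral_mul_eq_inner (SmoothPer.one L).coeFn_inL2 (Filter.EventuallyEq.rfl)]
  simp only [SmoothPer.onCircle_one, one_mul]

theorem momentumF_eq {s : ℝ} (u : HPer L s) :
    momentumF u = 1 / 2 * inner ℝ (toL2 u) (toL2 u) := by
  rw [momentumF, ← integral_mul_eq_inner (Filter.EventuallyEq.rfl) (Filter.EventuallyEq.rfl)]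
  simp only [sq]

/-- The mass as a continuous linear functional. -/
def massCLM {s : ℝ} (hs : 0 ≤ s) : HPer L s →L[ℝ] ℝ :=
  (innerSL ℝ (SmoothPer.one L).inL2).comp (toL2CLM hs)

theorem massCLM_apply {s : ℝ} (hs : 0 ≤ s) (u : HPer L s) : massCLM hs u = massM u := by
  rw [massM_eq_inner]
  rfl

theorem hasFDerivAt_massM {s : ℝ} (hs : 0 ≤ s) (u : HPer L s) :
    HasFDerivAt massM (massCLM (L := L) hs) u := by
  have : (massM : HPer L s → ℝ) = massCLM hs := funext fun v => (massCLM_apply hs v).symm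
  rw [this]
  exact (massCLM hs).hasFDerivAt

theorem contDiff_massM {s : ℝ} (hs : 0 ≤ s) {n : WithTop ℕ∞} :
    ContDiff ℝ n (massM : HPer L s → ℝ) := by
  have : (massM : HPer L s → ℝ) = massCLM hs := funext fun v => (massCLM_apply hs v).symm
  rw [this]
  exact (massCLM hs).contDiff

/-- The derivative of the momentum. -/
def momentumD {s : ℝ} (hs : 0 ≤ s) (u : HPer L s) : HPer L s →L[ℝ] ℝ :=
  (innerSL ℝ (toL2 u)).comp (toL2CLM hs)

theorem momentumD_apply {s : ℝ} (hs : 0 ≤ s) (u v : HPer L s) :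
    momentumD hs u v = inner ℝ (toL2 u) (toL2 v) := rfl

theorem hasFDerivAt_momentumF {s : ℝ} (hs : 0 ≤ s) (u : HPer L s) :
    HasFDerivAt momentumF (momentumD hs u) u := by
  have h : (momentumF : HPer L s → ℝ) =
      fun v => 1 / 2 * inner ℝ (toL2CLM hs v) (toL2CLM hs v) := funext fun v => momentumF_eq v
  rw [h]
  have h1 := (toL2CLM (L := L) hs).hasFDerivAt (x := u)
  refine ((h1.inner ℝ h1).const_mul (1 / 2)).congr_fderiv ?_
  ext v
  have e : inner ℝ (toL2CLM hs v) (toL2CLM hs u) = inner ℝ (toL2 u) (toL2 v) :=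
    real_inner_comm _ _
  have e2 : inner ℝ (toL2CLM hs u) (toL2CLM hs v) = inner ℝ (toL2 u) (toL2 v) := rfl
  simp only [FunLike.coe_smul, Pi.smul_apply, ContinuousLinearMap.coe_comp,
    Function.comp_apply, ContinuousLinearMap.prod_apply, fderivInnerCLM_apply, smul_eq_mul, e, e2,
    momentumD_apply]
  ring

theorem contDiff_momentumF {s : ℝ} (hs : 0 ≤ s) {n : WithTop ℕ∞} :
    ContDiff ℝ n (momentumF : HPer L s → ℝ) := by
  have h : (momentumF : HPer L s → ℝ) =
      fun v => 1 / 2 * inner ℝ (toL2CLM hs v) (toL2CLM hs v) := funext fun v => momentumF_eq v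
  rw [h]
  exact contDiff_const.mul ((toL2CLM hs).contDiff.inner ℝ (toL2CLM hs).contDiff)

theorem hasFDerivAt_quadM (u : HPer L (S.m / 2)) :
    HasFDerivAt (quadM S) ((2 : ℝ) • formM S u) u := by
  have h : quadM (L := L) S = fun v => formM S v v := funext (quadM_eq S)
  rw [h]
  refine ((formM S).hasFDerivAt.clm_apply (hasFDerivAt_id u)).congr_fderiv ?_
  ext v
  change formM S u v + formM S v u = 2 * formM S u v
  rw [formM_comm S v u]
  ring

theorem contDiff_quadM {n : WithTop ℕ∞} : ContDiff ℝ n (quadM (L := L) S) := by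
  have h : quadM (L := L) S = fun v => formM S v v := funext (quadM_eq S)
  rw [h]
  exact (formM S).contDiff.clm_apply contDiff_id

theorem DispersionSymbol.half_nonneg : 0 ≤ S.m / 2 := by linarith [S.m_pos]

theorem DispersionSymbol.half_le : S.m / 2 ≤ S.m := by linarith [S.m_pos]

section Smoothness

variable {f W : ℝ → ℝ} (hf : ContDiff ℝ ∞ f) (hW : ∀ x, HasDerivAt W (f x) x)
  (hg : GrowthCondition S.m f)

include hf hW hg

theorem contDiff_energyP : ContDiff ℝ 2 (energyP (L := L) S W) := by
  have h1 : ContDiff ℝ 2 (fun u : HPer L (S.m / 2) => ∫ x, W (toL2 u x)) :=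
    contDiff_iff_contDiffAt.2 fun u => (potential_local S.m_pos hf hW hg u).1
  exact (contDiff_const.mul (contDiff_quadM S)).sub h1

theorem exists_hasFDerivAt_energyP (u : HPer L (S.m / 2)) :
    ∃ D : HPer L (S.m / 2) →L[ℝ] ℝ, HasFDerivAt (energyP S W) D u ∧
      ∀ k, D k = formM S u k - ∫ x, f (toL2 u x) * toL2 k x := by
  obtain ⟨D, hD, hDk⟩ := (potential_local S.m_pos hf hW hg u).2.1
  refine ⟨_, ((hasFDerivAt_quadM S u).const_mul (1 / 2)).sub hD, fun k => ?_⟩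
  rw [← hDk]
  simp

theorem contDiff_functionalV (speed A μ ν σ : ℝ) (φ : SmoothPer L) :
    ContDiff ℝ 2 (functionalV S W speed A μ ν σ φ) := by
  have hF : ContDiff ℝ 2 (momentumF : HPer L (S.m / 2) → ℝ) := contDiff_momentumF S.half_nonneg
  have hM : ContDiff ℝ 2 (massM : HPer L (S.m / 2) → ℝ) := contDiff_massM S.half_nonneg
  have hP := contDiff_energyP (L := L) S hf hW hg
  have hG : ContDiff ℝ 2 (functionalG (L := L) S W speed A) :=
    (hP.add (contDiff_const.mul hF)).add (contDiff_const.mul hM)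
  have hQ : ContDiff ℝ 2 (functionalQ μ ν : HPer L (S.m / 2) → ℝ) :=
    (contDiff_const.mul hM).add (contDiff_const.mul hF)
  exact (hG.sub contDiff_const).add (contDiff_const.mul ((hQ.sub contDiff_const).pow 2))

end Smoothness

section Invariance

theorem integral_comp_translate {s : ℝ} (h : ℝ → ℝ) (r : ℝ) (u : HPer L s) :
    ∫ x, h (toL2 (translate r u) x) = ∫ x, h (toL2 u x) := by
  have e : toL2 (translate r u) = translateL2 r (toL2 u) := rfl
  rw [e, ← integral_add_right_eq_self (fun x => h (toL2 u x)) (r : AddCircle L)]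
  apply integral_congr_ae
  have := Lp.coeFn_compMeasurePreserving (toL2 u)
    (measurePreserving_add_right volume (r : AddCircle L))
  filter_upwards [this] with x hx
  rw [translateL2, hx]
  rfl

theorem energyP_translate (W : ℝ → ℝ) (r : ℝ) (u : HPer L (S.m / 2)) :
    energyP S W (translate r u) = energyP S W u := by
  simp only [energyP, quadM, norm_hat_translate, integral_comp_translate]

theorem momentumF_translate {s : ℝ} (r : ℝ) (u : HPer L s) :
    momentumF (translate r u) = momentumF u := by
  rw [momentumF, momentumF, integral_comp_translate (fun y => y ^ 2)]

theorem massM_translate {s : ℝ} (r : ℝ) (u : HPer L s) : massM (translate r u) = massM u := by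
  rw [massM, massM, integral_comp_translate (fun y => y)]

theorem functionalV_translate (W : ℝ → ℝ) (speed A μ ν σ : ℝ) (φ : SmoothPer L) (r : ℝ)
    (v : HPer L (S.m / 2)) : functionalV S W speed A μ ν σ φ (translate r v)
      = functionalV S W speed A μ ν σ φ v := by
  simp only [functionalV, functionalG, functionalQ, energyP_translate, momentumF_translate,
    massM_translate]

/-- A translation invariant functional is stationary in the direction `∂ₓ v`. -/
theorem fderiv_eq_zero_of_invariant {s : ℝ} {V : HPer L s → ℝ} {D : HPer L s →L[ℝ] ℝ}
    {v w : HPer L s} (hV : ∀ r, V (translate r v) = V v) (hD : HasFDerivAt V D v)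
    (hw : IsDerivativeOf w v) : D w = 0 := by
  have h1 := hasDerivAt_translate hw
  have hD' : HasFDerivAt V D (translate 0 v) := by rwa [translate_zero]
  have h2 := hD'.comp_hasDerivAt (0 : ℝ) h1
  have h3 : (V ∘ fun r => translate r v) = fun _ => V v := funext hV
  rw [h3] at h2
  exact h2.unique (hasDerivAt_const _ _)

end Invariance

end EnergyFunctionals

/-! ### Coercivity of the second variation. -/

noncomputable section Coercivity
set_option maxSynthPendingDepth 3
open Filter Topology

/-- A symmetric operator that is positive on the orthogonal complement of two orthogonal vectors
becomes positive after adding a multiple of the squares of the corresponding components. -/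
theorem exists_penalized_lower_bound {V H : Type*} [AddCommGroup V] [Module ℝ V]
    [NormedAddCommGroup H] [InnerProductSpace ℝ H] (J T : V →ₗ[ℝ] H)
    (hsymm : ∀ a b, inner ℝ (T a) (J b) = inner ℝ (T b) (J a)) (p q : V)
    (hpq : inner ℝ (J p) (J q) = 0) {c : ℝ} (hc : 0 < c)
    (hpos : ∀ v, inner ℝ (J v) (J p) = 0 → inner ℝ (J v) (J q) = 0 →
      c * ‖J v‖ ^ 2 ≤ inner ℝ (T v) (J v)) :
    ∃ K > 0, ∃ c' > 0, ∀ v, c' * ‖J v‖ ^ 2 ≤ inner ℝ (T v) (J v)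
      + K * (inner ℝ (J v) (J q) ^ 2 + inner ℝ (J v) (J p) ^ 2) := by
  -- Write `v = y + z` with `y` in the span of `p`, `q` and `J z` orthogonal to `J p`, `J q`.
  -- Young's inequality spends half of `c ‖J z‖²` on the cross term, at the price `2/c ‖T y‖²`. The
  -- halves come from `‖T y‖ ‖J y‖`, and `c/2` from recovering `‖J v‖²`.
  obtain ⟨A, hA⟩ : ∃ A, A = c / 2 + 1 / 2 := ⟨_, rfl⟩
  obtain ⟨B, hB⟩ : ∃ B, B = 2 / c + 1 / 2 := ⟨_, rfl⟩
  have hA0 : 0 < A := by rw [hA]; positivity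
  have hB0 : 0 < B := by rw [hB]; positivity
  obtain ⟨K₁, hK₁⟩ : ∃ r, r = (2 * A * ‖J p‖ ^ 2 + 2 * B * ‖T p‖ ^ 2) / (‖J p‖ ^ 2) ^ 2 := ⟨_, rfl⟩
  obtain ⟨K₂, hK₂⟩ : ∃ r, r = (2 * A * ‖J q‖ ^ 2 + 2 * B * ‖T q‖ ^ 2) / (‖J q‖ ^ 2) ^ 2 := ⟨_, rfl⟩
  have hK₁0 : 0 ≤ K₁ := by rw [hK₁]; positivity
  have hK₂0 : 0 ≤ K₂ := by rw [hK₂]; positivity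
  refine ⟨K₁ + K₂ + 1, by positivity, c / 4, by positivity, fun v => ?_⟩
  obtain ⟨α, hα⟩ : ∃ r, r = inner ℝ (J v) (J p) / ‖J p‖ ^ 2 := ⟨_, rfl⟩
  obtain ⟨β, hβ⟩ : ∃ r, r = inner ℝ (J v) (J q) / ‖J q‖ ^ 2 := ⟨_, rfl⟩
  -- If `J w = 0` the quotient is `0` by convention and both sides vanish, so `p` and `q` may be
  -- degenerate.
  have hself : ∀ w : V, inner ℝ (J v) (J w) / ‖J w‖ ^ 2 * inner ℝ (J w) (J w)
      = inner ℝ (J v) (J w) := by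
    intro w
    rw [real_inner_self_eq_norm_sq]
    by_cases h : J w = 0
    · rw [h]
      simp
    · have : ‖J w‖ ^ 2 ≠ 0 := by positivity
      field_simp
  obtain ⟨y, hy⟩ : ∃ y, y = α • p + β • q := ⟨_, rfl⟩
  obtain ⟨z, hz⟩ : ∃ z, z = v - y := ⟨_, rfl⟩
  have hv : v = y + z := by rw [hz]; abel
  have hqp : inner ℝ (J q) (J p) = 0 := by rw [real_inner_comm, hpq]
  have hzp : inner ℝ (J z) (J p) = 0 := by
    rw [hz, hy, map_sub, map_add, map_smul, map_smul, inner_sub_left, inner_add_left,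
      real_inner_smul_left, real_inner_smul_left, hqp, hα, hself p]
    ring
  have hzq : inner ℝ (J z) (J q) = 0 := by
    rw [hz, hy, map_sub, map_add, map_smul, map_smul, inner_sub_left, inner_add_left,
      real_inner_smul_left, real_inner_smul_left, hpq, hβ, hself q]
    ring
  have hzz := hpos z hzp hzq
  have hexp : inner ℝ (T v) (J v) = inner ℝ (T y) (J y) + 2 * inner ℝ (T y) (J z)
      + inner ℝ (T z) (J z) := by
    have hvT : T v = T y + T z := by rw [← map_add, ← hv]
    have hvJ : J v = J y + J z := by rw [← map_add, ← hv]
    rw [hvT, hvJ, inner_add_left, inner_add_right, inner_add_right, hsymm z y]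
    ring
  have h1 : -(‖T y‖ * ‖J y‖) ≤ inner ℝ (T y) (J y) :=
    (abs_le.1 (abs_real_inner_le_norm (T y) (J y))).1
  have h2 : -(‖T y‖ * ‖J z‖) ≤ inner ℝ (T y) (J z) :=
    (abs_le.1 (abs_real_inner_le_norm (T y) (J z))).1
  have h3 : 2 * (‖T y‖ * ‖J z‖) ≤ c / 2 * ‖J z‖ ^ 2 + 2 / c * ‖T y‖ ^ 2 := by
    have h4 : 0 ≤ c / 2 * (‖J z‖ - 2 / c * ‖T y‖) ^ 2 := by positivity
    have h5 : c / 2 * (‖J z‖ - 2 / c * ‖T y‖) ^ 2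
        = c / 2 * ‖J z‖ ^ 2 + 2 / c * ‖T y‖ ^ 2 - 2 * (‖T y‖ * ‖J z‖) := by
      field_simp
      ring
    linarith
  have h6 : ‖J v‖ ^ 2 ≤ 2 * ‖J z‖ ^ 2 + 2 * ‖J y‖ ^ 2 := by
    have : ‖J v‖ ≤ ‖J y‖ + ‖J z‖ := by
      have hvJ : J v = J y + J z := by rw [← map_add, ← hv]
      rw [hvJ]
      exact norm_add_le _ _
    nlinarith [norm_nonneg (J v), sq_nonneg (‖J y‖ - ‖J z‖)]
  have hlin : ∀ R : V →ₗ[ℝ] H, ‖R y‖ ^ 2 ≤ 2 * (α ^ 2 * ‖R p‖ ^ 2) + 2 * (β ^ 2 * ‖R q‖ ^ 2) := by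
    intro R
    have h7 : ‖R y‖ ≤ |α| * ‖R p‖ + |β| * ‖R q‖ := by
      rw [hy, map_add, map_smul, map_smul]
      refine (norm_add_le _ _).trans (le_of_eq ?_)
      rw [norm_smul, norm_smul, Real.norm_eq_abs, Real.norm_eq_abs]
    have h8 : ‖R y‖ ^ 2 ≤ (|α| * ‖R p‖ + |β| * ‖R q‖) ^ 2 :=
      pow_le_pow_left₀ (norm_nonneg _) h7 2
    have h9 := sq_nonneg (|α| * ‖R p‖ - |β| * ‖R q‖)
    rw [← sq_abs α, ← sq_abs β]
    linarith
  have hJy := mul_le_mul_of_nonneg_left (hlin J) hA0.le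
  have hTy := mul_le_mul_of_nonneg_left (hlin T) hB0.le
  have hKα : A * (2 * (α ^ 2 * ‖J p‖ ^ 2)) + B * (2 * (α ^ 2 * ‖T p‖ ^ 2))
      = K₁ * inner ℝ (J v) (J p) ^ 2 := by
    rw [hα, hK₁, div_pow]
    ring
  have hKβ : A * (2 * (β ^ 2 * ‖J q‖ ^ 2)) + B * (2 * (β ^ 2 * ‖T q‖ ^ 2))
      = K₂ * inner ℝ (J v) (J q) ^ 2 := by
    rw [hβ, hK₂, div_pow]
    ring
  have h10 : A * ‖J y‖ ^ 2 = c / 2 * ‖J y‖ ^ 2 + 1 / 2 * ‖J y‖ ^ 2 := by rw [hA]; ring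
  have h11 : B * ‖T y‖ ^ 2 = 2 / c * ‖T y‖ ^ 2 + 1 / 2 * ‖T y‖ ^ 2 := by rw [hB]; ring
  have h12 : ‖T y‖ * ‖J y‖ ≤ 1 / 2 * ‖T y‖ ^ 2 + 1 / 2 * ‖J y‖ ^ 2 := by
    nlinarith [sq_nonneg (‖T y‖ - ‖J y‖)]
  have h13 : c / 4 * ‖J v‖ ^ 2 ≤ c / 2 * ‖J z‖ ^ 2 + c / 2 * ‖J y‖ ^ 2 := by
    have := mul_le_mul_of_nonneg_left h6 (show 0 ≤ c / 4 by positivity)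
    linarith
  have h14 : 0 ≤ (K₁ + 1) * inner ℝ (J v) (J q) ^ 2 := by positivity
  have h15 : 0 ≤ (K₂ + 1) * inner ℝ (J v) (J p) ^ 2 := by positivity
  rw [hexp]
  linarith

variable {L : ℝ} [Fact (0 < L)] (S : DispersionSymbol)

theorem SmoothPer.exists_norm_mulL2_le (g : SmoothPer L) :
    ∃ C : ℝ, ∀ u : L2Per L, ‖g.mulL2 u‖ ≤ C * ‖u‖ := by
  obtain ⟨C, hC⟩ := isCompact_univ.exists_bound_of_continuousOn
    (f := g.onCircle) g.continuous_onCircle.continuousOn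
  refine ⟨C, fun u => Lp.norm_le_mul_norm_of_ae_le_mul ?_⟩
  filter_upwards [(g.memLp_mul u).coeFn_toLp] with x hx
  change ‖(g.memLp_mul u).toLp _ x‖ ≤ _
  rw [hx, norm_mul]
  exact mul_le_mul_of_nonneg_right (hC x (mem_univ x)) (norm_nonneg _)

/-- Multiplication by a smooth periodic function as a continuous linear map of `L²_per`. -/
def SmoothPer.mulCLM (g : SmoothPer L) : L2Per L →L[ℝ] L2Per L :=
  g.mulL2.mkContinuous g.exists_norm_mulL2_le.choose g.exists_norm_mulL2_le.choose_spec

theorem SmoothPer.inner_mulL2 (g : SmoothPer L) (u v : L2Per L) :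
    inner ℝ (g.mulL2 u) v = ∫ x, g.onCircle x * u x * v x :=
  (integral_mul_eq_inner (g.memLp_mul u).coeFn_toLp (Filter.EventuallyEq.rfl)).symm

theorem SmoothPer.inner_mulL2_comm (g : SmoothPer L) (u v : L2Per L) :
    inner ℝ (g.mulL2 u) v = inner ℝ (g.mulL2 v) u := by
  rw [g.inner_mulL2, g.inner_mulL2]
  congr 1
  funext x
  ring

variable {f : ℝ → ℝ} (hf : ContDiff ℝ ∞ f) (speed : ℝ) (φ : SmoothPer L)

/-- The quadratic form `(𝓛h, h)` on the energy space. -/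
def hessForm (h : HPer L (S.m / 2)) : ℝ :=
  formM S h h + speed * inner ℝ (toL2CLM S.half_nonneg h) (toL2CLM S.half_nonneg h)
    - inner ℝ ((φ.comp (deriv f) (contDiff_infty_iff_deriv.1 hf).2).mulCLM
        (toL2CLM S.half_nonneg h)) (toL2CLM S.half_nonneg h)

theorem continuous_hessForm : Continuous (hessForm S hf speed φ) := by
  have h1 := (toL2CLM (L := L) S.half_nonneg).continuous
  have h2 : Continuous fun h : HPer L (S.m / 2) => formM S h h :=
    (formM S).continuous.clm_apply continuous_id
  exact (h2.add (continuous_const.mul (h1.inner h1))).sub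
    ((((φ.comp (deriv f) (contDiff_infty_iff_deriv.1 hf).2).mulCLM).continuous.comp h1).inner h1)

theorem inner_linOp (v w : HPer L S.m) : inner ℝ (linOp S f hf speed φ v) (toL2 w)
    = formM S (incl S.half_le v) (incl S.half_le w) + speed * inner ℝ (toL2 v) (toL2 w)
      - inner ℝ ((φ.comp (deriv f) (contDiff_infty_iff_deriv.1 hf).2).mulL2 (toL2 v)) (toL2 w) := by
  have e : linOp S f hf speed φ v = S.M v + speed • toL2 v
      - (φ.comp (deriv f) (contDiff_infty_iff_deriv.1 hf).2).mulL2 (toL2 v) := rfl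
  rw [e, inner_sub_left, inner_add_left, real_inner_smul_left, ← inner_M, toL2_incl]

theorem inner_linOp_self (v : HPer L S.m) : inner ℝ (linOp S f hf speed φ v) (toL2 v)
    = hessForm S hf speed φ (incl S.half_le v) := by
  rw [inner_linOp, hessForm, toL2CLM_apply, toL2_incl]
  rfl

theorem inner_linOp_comm (v w : HPer L S.m) : inner ℝ (linOp S f hf speed φ v) (toL2 w)
    = inner ℝ (linOp S f hf speed φ w) (toL2 v) := by
  rw [inner_linOp, inner_linOp, formM_comm, real_inner_comm, SmoothPer.inner_mulL2_comm]

theorem isDerivativeOf_derivative (s : ℝ) : IsDerivativeOf (φ.derivative.inH s) (φ.inH s) := by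
  intro k
  rw [hat_inH, hat_inH, φ.fc_derivative]

/-- `M` and `F` are translation invariant, so their gradients `1` and `φ` are orthogonal to `φ'`.
This supplies the orthogonality of the two penalized directions. -/
theorem inner_derivative_derivQ (μ ν : ℝ) : inner ℝ φ.derivative.inL2 (derivQ μ ν φ) = 0 := by
  have h1 := fderiv_eq_zero_of_invariant (fun r => massM_translate r _)
    (hasFDerivAt_massM le_rfl _) (isDerivativeOf_derivative φ 0)
  have h2 := fderiv_eq_zero_of_invariant (fun r => momentumF_translate r _)
    (hasFDerivAt_momentumF le_rfl _) (isDerivativeOf_derivative φ 0)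
  rw [massCLM_apply, massM_eq_inner, toL2_inH] at h1
  rw [momentumD_apply, toL2_inH, toL2_inH] at h2
  rw [derivQ, inner_add_right, real_inner_smul_right, real_inner_smul_right, real_inner_comm, h1,
    real_inner_comm, h2]
  ring

theorem dense_smooth {s : ℝ} (hs : 0 ≤ s) :
    Dense (range fun g : SmoothPer L => g.inH s) := by
  rw [Metric.dense_iff]
  intro u ε hε
  obtain ⟨g, hg⟩ := exists_smoothPer_near hs u hε
  exact ⟨g.inH s, by rwa [mem_ball_iff_norm], g, rfl⟩

/-- Coercivity of the second derivative on the energy space. -/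
theorem exists_coercive {μ ν : ℝ} (H1 : GardingHyp S f hf speed φ)
    (H2 : PositivityHyp S f hf speed μ ν φ) : ∃ K > 0, ∃ c > 0, ∀ h : HPer L (S.m / 2),
      c * ‖h‖ ^ 2 ≤ hessForm S hf speed φ h
        + K * (inner ℝ (toL2 h) (derivQ μ ν φ) ^ 2 + inner ℝ (toL2 h) φ.derivative.inL2 ^ 2) := by
  obtain ⟨c₁, hc₁, c₂, hc₂, hG⟩ := H1
  obtain ⟨c₃, hc₃, hP⟩ := H2
  obtain ⟨K, hK, c, hc, hpen⟩ := exists_penalized_lower_bound (toL2 : HPer L S.m →ₗ[ℝ] L2Per L)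
    (linOp S f hf speed φ) (inner_linOp_comm S hf speed φ) (φ.derivative.inH S.m)
    (μ • (SmoothPer.one L).inH S.m + ν • φ.inH S.m)
    (inner_derivative_derivQ φ μ ν) hc₃ hP
  -- Gårding's inequality plus `c₂ / c` times the penalized `L²` bound cancels `c₂ ‖v‖²` and leaves
  -- `a` copies of the form.
  set a := 1 + c₂ / c with ha
  have ha0 : 0 < a := by positivity
  refine ⟨c₂ * K / c / a, by positivity, c₁ / a, by positivity, fun h => ?_⟩
  -- Both sides are continuous in the `H^{m/2}` norm, so it is enough to treat smooth functions.
  have hcl : IsClosed {h : HPer L (S.m / 2) | c₁ / a * ‖h‖ ^ 2 ≤ hessForm S hf speed φ h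
      + c₂ * K / c / a * (inner ℝ (toL2 h) (derivQ μ ν φ) ^ 2
        + inner ℝ (toL2 h) φ.derivative.inL2 ^ 2)} := by
    have h1 := (toL2CLM (L := L) S.half_nonneg).continuous
    refine isClosed_le (continuous_const.mul (continuous_norm.pow 2))
      ((continuous_hessForm S hf speed φ).add (continuous_const.mul
        (((h1.inner continuous_const).pow 2).add ((h1.inner continuous_const).pow 2))))
  have hmem : range (fun g : SmoothPer L => g.inH (S.m / 2)) ⊆
      {h : HPer L (S.m / 2) | c₁ / a * ‖h‖ ^ 2 ≤ hessForm S hf speed φ h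
      + c₂ * K / c / a * (inner ℝ (toL2 h) (derivQ μ ν φ) ^ 2
        + inner ℝ (toL2 h) φ.derivative.inL2 ^ 2)} := by
    rintro _ ⟨g, rfl⟩
    have h1 := hG g
    have h2 : c * ‖g.inL2‖ ^ 2 ≤ inner ℝ (linOp S f hf speed φ (g.inH S.m)) g.inL2
        + K * (inner ℝ g.inL2 (derivQ μ ν φ) ^ 2 + inner ℝ g.inL2 φ.derivative.inL2 ^ 2) :=
      hpen (g.inH S.m)
    have h3 : inner ℝ (linOp S f hf speed φ (g.inH S.m)) g.inL2
        = hessForm S hf speed φ (g.inH (S.m / 2)) := by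
      have := inner_linOp_self S hf speed φ (g.inH S.m)
      rwa [incl_inH] at this
    rw [h3] at h1 h2
    change c₁ / a * ‖g.inH (S.m / 2)‖ ^ 2 ≤ hessForm S hf speed φ (g.inH (S.m / 2))
      + c₂ * K / c / a * (inner ℝ g.inL2 (derivQ μ ν φ) ^ 2
        + inner ℝ g.inL2 φ.derivative.inL2 ^ 2)
    set sq := inner ℝ g.inL2 (derivQ μ ν φ) ^ 2 + inner ℝ g.inL2 φ.derivative.inL2 ^ 2
    set B := hessForm S hf speed φ (g.inH (S.m / 2))
    have h4 : c₂ * ‖g.inL2‖ ^ 2 ≤ c₂ / c * (B + K * sq) := by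
      have := mul_le_mul_of_nonneg_left h2 (show 0 ≤ c₂ / c by positivity)
      calc c₂ * ‖g.inL2‖ ^ 2 = c₂ / c * (c * ‖g.inL2‖ ^ 2) := by field_simp
        _ ≤ _ := this
    have h5 : c₁ * ‖g.inH (S.m / 2)‖ ^ 2 ≤ a * B + c₂ * K / c * sq := by
      have : a * B + c₂ * K / c * sq = B + c₂ / c * (B + K * sq) := by rw [ha]; ring
      linarith
    have h6 : c₁ / a * ‖g.inH (S.m / 2)‖ ^ 2 = c₁ * ‖g.inH (S.m / 2)‖ ^ 2 / a := by ring
    have h7 : B + c₂ * K / c / a * sq = (a * B + c₂ * K / c * sq) / a := by field_simp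
    rw [h6, h7]
    exact div_le_div_of_nonneg_right h5 ha0.le
  have := hcl.closure_subset_iff.2 hmem
  rw [(dense_smooth S.half_nonneg).closure_eq] at this
  exact this (mem_univ h)

end Coercivity

/-! ### Modulation along the orbit and the quadratic lower bound for `V`. -/

noncomputable section LowerBound
set_option maxSynthPendingDepth 3
open Filter Topology
variable {L : ℝ} [Fact (0 < L)]

theorem inner_hper_zero (u v : HPer L 0) : inner ℝ u v = inner ℝ (toL2 u) (toL2 v) := by
  rw [inner_eq_tsum_fc]
  change L * ∑' k : ℤ, wt 0 k * ((starRingEnd ℂ) (hat u k) * hat v k).re = _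
  simp only [wt_zero, one_mul]
  rfl

/-- Interpolation between `L²` and `H^{2a}`. -/
theorem norm_incl_sq_le {a b : ℝ} (hab : a ≤ b) (hb : b = 2 * a) (g : HPer L b) :
    ‖incl hab g‖ ^ 2 ≤ ‖toL2 g‖ * ‖g‖ := by
  have hw : ∀ k, wt a k * wt a k = wt b k := fun k => by rw [wt_mul_wt, hb, two_mul]
  have hc : ∀ k, ‖(wt a k : ℂ) * hat g k‖ ^ 2 = wt b k * ‖hat g k‖ ^ 2 := by
    intro k
    rw [norm_mul, mul_pow, Complex.norm_real, Real.norm_eq_abs, sq_abs, sq, hw]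
  -- `ψ = (1 + k²)^a g` on the Fourier side: its `L²` norm is the `H^{2a}` norm of `g`, and its
  -- pairing with `g` is the squared `H^a` norm.
  obtain ⟨ψ, hψ⟩ := exists_fc_eq (L := L) (fun k => (wt a k : ℂ) * hat g k)
    (by simpa only [hc] using summable_hat g) (fun k => by
      rw [hat_neg_index, map_mul, Complex.conj_ofReal]
      unfold wt
      push_cast
      rw [neg_sq])
  have h1 : ‖ψ‖ = ‖g‖ := by
    rw [← sq_eq_sq₀ (norm_nonneg _) (norm_nonneg _), norm_sq_eq_tsum_fc, hper_norm_sq]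
    simp only [hψ, hc]
  have h2 : ‖incl hab g‖ ^ 2 = inner ℝ (toL2 g) ψ := by
    rw [hper_norm_sq, inner_eq_tsum_fc]
    congr 1
    congr 1
    funext k
    rw [hat_incl, hψ, mul_left_comm, Complex.re_ofReal_mul, ← conj_mul_self_re]
    rfl
  rw [h2, ← h1]
  exact real_inner_le_norm _ _

theorem incl_translate {r s : ℝ} (h : r ≤ s) (a : ℝ) (u : HPer L s) :
    incl h (translate a u) = translate a (incl h u) :=
  hper_ext fun k => by rw [hat_incl, hat_translate, hat_translate, hat_incl]

theorem inner_translate {s : ℝ} (r : ℝ) (u v : HPer L s) :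
    inner ℝ (translate r u) (translate r v) = inner ℝ u v := by
  rw [real_inner_eq_norm_mul_self_add_norm_mul_self_sub_norm_sub_mul_self_div_two,
    real_inner_eq_norm_mul_self_add_norm_mul_self_sub_norm_sub_mul_self_div_two,
    ← translate_sub, norm_translate, norm_translate, norm_translate]

theorem IsDerivativeOf.translate {s : ℝ} {v w : HPer L s} (h : IsDerivativeOf w v) (r : ℝ) :
    IsDerivativeOf (translate r w) (translate r v) := fun k => by
  rw [hat_translate, hat_translate, h k]
  ring

theorem hasDerivAt_translate_of {s : ℝ} {v w : HPer L s} (h : IsDerivativeOf w v) (r : ℝ) :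
    HasDerivAt (fun r' => PeriodicWave.translate r' v) (PeriodicWave.translate r w) r := by
  have h1 := hasDerivAt_translate (h.translate r)
  have h2 : HasDerivAt (fun r' : ℝ => r' - r) 1 r := (hasDerivAt_id r).sub_const r
  rw [← sub_self r] at h1
  have h3 := HasDerivAt.scomp (h := fun r' : ℝ => r' - r) r h1 h2
  rw [one_smul] at h3
  refine h3.congr_of_eventuallyEq (Eventually.of_forall fun r' => ?_)
  change _ = PeriodicWave.translate (r' - r) (PeriodicWave.translate r v)
  rw [translate_translate, sub_add_cancel]

/-- A closest point of the orbit, and the orthogonality it entails. -/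
theorem exists_modulation {s : ℝ} (v : HPer L s) (φ : SmoothPer L) :
    ∃ r, (∀ r', ‖v - translate r (φ.inH s)‖ ≤ ‖v - translate r' (φ.inH s)‖) ∧
      inner ℝ (translate (-r) v - φ.inH s) (φ.derivative.inH s) = 0 := by
  have hL : (0 : ℝ) < L := Fact.out
  have hd := fun r => hasDerivAt_translate_of (isDerivativeOf_derivative φ s) r
  have hcont : Continuous fun r => ‖v - translate r (φ.inH s)‖ := by
    refine (continuous_const.sub ?_).norm
    exact continuous_iff_continuousAt.2 fun r => (hd r).continuousAt
  have hper : Function.Periodic (fun r => ‖v - translate r (φ.inH s)‖) L := fun r => by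
    change ‖v - translate (r + L) (φ.inH s)‖ = ‖v - translate r (φ.inH s)‖
    rw [← translate_translate, translate_period]
  obtain ⟨r, -, hr⟩ := isCompact_Icc.exists_isMinOn (nonempty_Icc.2 hL.le) hcont.continuousOn
  have hmin : ∀ r', ‖v - translate r (φ.inH s)‖ ≤ ‖v - translate r' (φ.inH s)‖ := by
    intro r'
    obtain ⟨r'', hr'', he⟩ := hper.exists_mem_Ico₀ hL r'
    exact (hr (Ico_subset_Icc_self hr'')).trans_eq he.symm
  refine ⟨r, hmin, ?_⟩
  -- The square is differentiable in `r'`, and its vanishing derivative at the minimum is the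
  -- orthogonality relation.
  have hloc : IsLocalMin (fun r' => ‖v - translate r' (φ.inH s)‖ ^ 2) r :=
    Eventually.of_forall fun r' => pow_le_pow_left₀ (norm_nonneg _) (hmin r') 2
  have h0 := hloc.hasDerivAt_eq_zero ((hd r).const_sub v).norm_sq
  rw [inner_neg_right] at h0
  rw [← inner_translate r, translate_sub, translate_translate, add_neg_cancel, translate_zero]
  linarith

variable (S : DispersionSymbol)

/-- The `L²`-closest translate gives the `L²` orthogonality. It differs from an energy-close
translate by a function small in `L²` and bounded in `H^m`, hence small in `H^{m/2}` by
interpolation. -/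
theorem exists_close_translate (φ : SmoothPer L) {ε : ℝ} (hε : 0 < ε) : ∃ ρ > 0,
    ∀ v ∈ orbitNhd (S.m / 2) φ ρ, ∃ r, ‖translate (-r) v - φ.inH (S.m / 2)‖ < ε ∧
      inner ℝ (toL2 (translate (-r) v - φ.inH (S.m / 2))) φ.derivative.inL2 = 0 := by
  set B := ‖φ.inH S.m‖ with hB
  have hB0 : 0 ≤ B := norm_nonneg _
  -- Interpolation bounds the squared distance of the two translates by `2ρ · 2B`, which must stay
  -- below `(ε / 2)²`; `B + 1` makes this strict and covers `B = 0`.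
  refine ⟨min (ε / 2) (ε ^ 2 / (16 * (B + 1))), by positivity, fun v hv => ?_⟩
  set ρ := min (ε / 2) (ε ^ 2 / (16 * (B + 1)))
  have hρ1 : ρ ≤ ε / 2 := min_le_left _ _
  have hρ2 : ρ ≤ ε ^ 2 / (16 * (B + 1)) := min_le_right _ _
  obtain ⟨_, ⟨r₁, rfl⟩, hr₁⟩ := (Metric.infDist_lt_iff (range_nonempty _)).1 hv
  rw [dist_eq_norm] at hr₁
  obtain ⟨r, hr, horth⟩ := exists_modulation (incl S.half_nonneg v) φ
  have e0 : ∀ a, incl S.half_nonneg (v - translate a (φ.inH (S.m / 2)))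
      = incl S.half_nonneg v - translate a (φ.inH 0) := fun a => by
    rw [map_sub, incl_translate, incl_inH]
  have h1 : ‖incl S.half_nonneg v - translate r₁ (φ.inH 0)‖ ≤ ρ := by
    rw [← e0]
    exact (norm_incl_le _ _).trans hr₁.le
  have h2 := (hr r₁).trans h1
  set g := translate r (φ.inH S.m) - translate r₁ (φ.inH S.m) with hg
  have hginc : ∀ {b : ℝ} (hb : b ≤ S.m), incl hb g
      = translate r (φ.inH b) - translate r₁ (φ.inH b) := fun hb => by
    rw [hg, map_sub, incl_translate, incl_translate, incl_inH]
  have h3 : ‖toL2 g‖ ≤ 2 * ρ := by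
    have h4 : toL2 g = toL2 (incl S.m_pos.le g) := (toL2_incl _ _).symm
    rw [h4]
    refine (norm_toL2_le le_rfl _).trans ?_
    rw [hginc]
    have h5 : translate r (φ.inH 0) - translate r₁ (φ.inH 0)
        = (incl S.half_nonneg v - translate r₁ (φ.inH 0))
          - (incl S.half_nonneg v - translate r (φ.inH 0)) := by abel
    rw [h5]
    exact (norm_sub_le _ _).trans (by linarith)
  have h6 : ‖g‖ ≤ 2 * B := by
    rw [hg]
    refine (norm_sub_le _ _).trans ?_
    rw [norm_translate, norm_translate]
    linarith
  have h7 : ‖translate r (φ.inH (S.m / 2)) - translate r₁ (φ.inH (S.m / 2))‖ < ε / 2 := by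
    rw [← hginc S.half_le]
    refine lt_of_pow_lt_pow_left₀ 2 (by positivity) ?_
    calc ‖incl S.half_le g‖ ^ 2 ≤ ‖toL2 g‖ * ‖g‖ := norm_incl_sq_le _ (by ring) g
      _ ≤ (2 * ρ) * (2 * B) := mul_le_mul h3 h6 (norm_nonneg _) ((norm_nonneg _).trans h3)
      _ ≤ 2 * (ε ^ 2 / (16 * (B + 1))) * (2 * B) := by gcongr
      _ = ε ^ 2 / 4 * (B / (B + 1)) := by field_simp; ring
      _ < ε ^ 2 / 4 * 1 := by
          refine mul_lt_mul_of_pos_left ?_ (by positivity)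
          rw [div_lt_one (by positivity)]
          linarith
      _ = (ε / 2) ^ 2 := by ring
  refine ⟨r, ?_, ?_⟩
  · have h8 : ‖translate (-r) v - φ.inH (S.m / 2)‖ = ‖v - translate r (φ.inH (S.m / 2))‖ := by
      have := norm_sub_translate (-r) 0 v (φ.inH (S.m / 2))
      rwa [translate_zero, zero_sub, neg_neg] at this
    have h9 : v - translate r (φ.inH (S.m / 2)) = (v - translate r₁ (φ.inH (S.m / 2)))
        - (translate r (φ.inH (S.m / 2)) - translate r₁ (φ.inH (S.m / 2))) := by abel
    rw [h8, h9]
    exact (norm_sub_le _ _).trans_lt (by linarith)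
  · rw [inner_hper_zero, ← incl_translate, ← incl_inH S.half_nonneg, ← map_sub, toL2_incl,
      toL2_inH] at horth
    exact horth

theorem infDist_orbit_le (φ : SmoothPer L) {s : ℝ} (v : HPer L s) (r : ℝ) :
    Metric.infDist v (orbit s φ) ≤ ‖translate (-r) v - φ.inH s‖ := by
  have h := norm_sub_translate (-r) 0 v (φ.inH s)
  rw [translate_zero, zero_sub, neg_neg] at h
  rw [h, ← dist_eq_norm]
  exact Metric.infDist_le_dist_of_mem ⟨r, rfl⟩

variable {f W : ℝ → ℝ} (hf : ContDiff ℝ ∞ f) (hW : ∀ x, HasDerivAt W (f x) x)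
  (hgrowth : GrowthCondition S.m f) {speed A : ℝ} {φ : SmoothPer L}

theorem functionalQ_add_sub (μ ν : ℝ) (φ : SmoothPer L) {s : ℝ} (h : HPer L s) :
    functionalQ μ ν (φ.inH s + h) - functionalQ μ ν (φ.inH s)
      = inner ℝ (toL2 h) (derivQ μ ν φ) + ν / 2 * ‖toL2 h‖ ^ 2 := by
  unfold functionalQ derivQ
  rw [massM_eq_inner, massM_eq_inner, momentumF_eq, momentumF_eq, map_add, inner_add_right,
    inner_add_left, inner_add_right, inner_add_right, inner_add_right, real_inner_smul_right,
    real_inner_smul_right, toL2_inH, real_inner_comm φ.inL2 (toL2 h),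
    real_inner_comm (SmoothPer.one L).inL2 (toL2 h), real_inner_self_eq_norm_sq (toL2 h)]
  ring

include hf hW hgrowth in
/-- Taylor expansion of `G` at a wave. -/
theorem functionalG_taylor (hφ : IsWave S f hf speed A φ) {ε : ℝ} (hε : 0 < ε) :
    ∀ᶠ h in 𝓝 (0 : HPer L (S.m / 2)),
      |functionalG S W speed A (φ.inH (S.m / 2) + h) - functionalG S W speed A (φ.inH (S.m / 2))
        - 1 / 2 * hessForm S hf speed φ h| ≤ ε * ‖h‖ ^ 2 := by
  filter_upwards [(potential_local S.m_pos hf hW hgrowth (φ.inH (S.m / 2))).2.2 ε hε] with h hh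
  have hφc : toL2 (φ.inH (S.m / 2)) =ᵐ[volume] φ.onCircle := φ.coeFn_inL2
  have h1 : ∫ x, f (toL2 (φ.inH (S.m / 2)) x) * toL2 h x
      = inner ℝ (φ.comp f hf).inL2 (toL2 h) := by
    refine integral_mul_eq_inner ?_ EventuallyEq.rfl
    filter_upwards [hφc, (φ.comp f hf).coeFn_inL2] with x hx hx'
    rw [hx', hx, SmoothPer.onCircle_comp]
  have h2 : ∫ x, deriv f (toL2 (φ.inH (S.m / 2)) x) * toL2 h x * toL2 h x
      = inner ℝ ((φ.comp (deriv f) (contDiff_infty_iff_deriv.1 hf).2).mulL2 (toL2 h))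
        (toL2 h) := by
    rw [SmoothPer.inner_mulL2]
    refine integral_congr_ae ?_
    filter_upwards [hφc] with x hx
    rw [hx, SmoothPer.onCircle_comp]
  -- The wave equation tested against `h`: the first variation of `G` at `φ` vanishes.
  have h3 : formM S (φ.inH (S.m / 2)) h + speed * inner ℝ φ.inL2 (toL2 h)
      - inner ℝ (φ.comp f hf).inL2 (toL2 h) + A * inner ℝ (SmoothPer.one L).inL2 (toL2 h) = 0 := by
    have h4 := congrArg (fun g => inner ℝ g (toL2 h)) hφ
    simp only [inner_zero_left] at h4
    rw [inner_add_left, inner_sub_left, inner_add_left, real_inner_smul_left,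
      real_inner_smul_left, inner_M S S.half_le, incl_inH] at h4
    exact h4
  rw [h1, h2] at hh
  convert hh using 1
  rw [← abs_neg]
  congr 1
  have hM : massM (φ.inH (S.m / 2) + h) = massM (φ.inH (S.m / 2))
      + inner ℝ (SmoothPer.one L).inL2 (toL2 h) := by
    rw [massM_eq_inner, massM_eq_inner, map_add, inner_add_right]
  have hF : momentumF (φ.inH (S.m / 2) + h) = momentumF (φ.inH (S.m / 2))
      + inner ℝ φ.inL2 (toL2 h) + 1 / 2 * inner ℝ (toL2 h) (toL2 h) := by
    rw [momentumF_eq, momentumF_eq, map_add, inner_add_right, inner_add_left, inner_add_left,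
      real_inner_comm _ (toL2 h), toL2_inH]
    ring
  have hq : quadM S (φ.inH (S.m / 2) + h) = quadM S (φ.inH (S.m / 2))
      + 2 * formM S (φ.inH (S.m / 2)) h + formM S h h := by
    rw [quadM_eq, quadM_eq, map_add, map_add, add_apply,
      add_apply, formM_comm S h (φ.inH _)]
    ring
  have hH : hessForm S hf speed φ h = formM S h h + speed * inner ℝ (toL2 h) (toL2 h)
      - inner ℝ ((φ.comp (deriv f) (contDiff_infty_iff_deriv.1 hf).2).mulL2 (toL2 h))
        (toL2 h) := rfl
  unfold functionalG energyP
  rw [hM, hF, hq, hH]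
  linarith

include hf hW hgrowth in
-- With `σ = K`, the square of `Q - Q(φ)` compensates the penalty in the coercivity estimate. Of the
-- `c/2` from half the second variation, `c/8` is lost to the Taylor error and `c/8` to the
-- quadratic part of `Q`, leaving `c/4`.
theorem exists_functionalV_lower_bound {μ ν : ℝ} (hφ : IsWave S f hf speed A φ)
    (H1 : GardingHyp S f hf speed φ) (H2 : PositivityHyp S f hf speed μ ν φ) :
    ∃ σ > 0, ∃ ε > 0, ∃ c > 0, ∀ h : HPer L (S.m / 2), ‖h‖ < ε →
      inner ℝ (toL2 h) φ.derivative.inL2 = 0 →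
      c * ‖h‖ ^ 2 ≤ functionalV S W speed A μ ν σ φ (φ.inH (S.m / 2) + h) := by
  obtain ⟨K, hK, c, hc, hcoer⟩ := exists_coercive S hf speed φ H1 H2
  have ht := functionalG_taylor S hf hW hgrowth hφ (show 0 < c / 8 by positivity)
  obtain ⟨ε₁, hε₁, ht⟩ := Metric.eventually_nhds_iff.1 ht
  set B := K * ν ^ 2 / 4 with hB
  have hB0 : 0 ≤ B := by positivity
  refine ⟨K, hK, min ε₁ (√(c / (8 * (B + 1)))), by positivity, c / 4, by positivity,
    fun h hh horth => ?_⟩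
  have h1 := (abs_le.1 (ht (y := h) (by
    rw [dist_zero_right]; exact hh.trans_le (min_le_left _ _)))).1
  have h2 := hcoer h
  rw [horth] at h2
  have h3 : ‖h‖ ^ 2 ≤ c / (8 * (B + 1)) := by
    rw [← Real.sq_sqrt (show 0 ≤ c / (8 * (B + 1)) by positivity)]
    exact pow_le_pow_left₀ (norm_nonneg _) (hh.le.trans (min_le_right _ _)) 2
  have h4 : B * ‖h‖ ^ 2 ≤ c / 8 := by
    calc B * ‖h‖ ^ 2 ≤ (B + 1) * (c / (8 * (B + 1))) :=
          mul_le_mul (by linarith) h3 (by positivity) (by positivity)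
      _ = c / 8 := by field_simp
  have h5 : ‖toL2 h‖ ^ 2 ≤ ‖h‖ ^ 2 :=
    pow_le_pow_left₀ (norm_nonneg _) (norm_toL2_le S.half_nonneg h) 2
  unfold functionalV
  rw [functionalQ_add_sub]
  set a := inner ℝ (toL2 h) (derivQ μ ν φ)
  set N := ‖h‖ ^ 2
  set n := ‖toL2 h‖ ^ 2
  have hn : 0 ≤ n := sq_nonneg _
  -- With `B = K ν² / 4` the difference of the two sides is the perfect square `K/2 (a + ν n)²`; the
  -- term `B n²` is of fourth order in `h`.
  have h6 : K * (a + ν / 2 * n) ^ 2 ≥ K / 2 * a ^ 2 - B * n ^ 2 := by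
    have : K * (a + ν / 2 * n) ^ 2 - (K / 2 * a ^ 2 - B * n ^ 2) = K / 2 * (a + ν * n) ^ 2 := by
      rw [hB]; ring
    have : 0 ≤ K / 2 * (a + ν * n) ^ 2 := by positivity
    linarith
  have h7 : B * n ^ 2 ≤ c / 8 * N := by
    calc B * n ^ 2 ≤ B * N ^ 2 := by gcongr
      _ = B * N * N := by ring
      _ ≤ c / 8 * N := mul_le_mul_of_nonneg_right h4 (sq_nonneg _)
  linarith

end LowerBound

/-! ### The local properties of `V` near the orbit. -/

noncomputable section NearOrbit
set_option maxSynthPendingDepth 3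
open Filter Topology
variable {L : ℝ} [Fact (0 < L)] (S : DispersionSymbol)
variable {f W : ℝ → ℝ} (hf : ContDiff ℝ ∞ f) (hW : ∀ x, HasDerivAt W (f x) x)
  (hgrowth : GrowthCondition S.m f) {speed A : ℝ} {φ : SmoothPer L}

theorem functionalV_wave (W : ℝ → ℝ) (speed A μ ν σ : ℝ) (φ : SmoothPer L) :
    functionalV S W speed A μ ν σ φ (φ.inH (S.m / 2)) = 0 := by
  unfold functionalV
  ring

include hf hW hgrowth in
theorem exists_near_orbit {μ ν : ℝ} (hφ : IsWave S f hf speed A φ)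
    (H1 : GardingHyp S f hf speed φ) (H2 : PositivityHyp S f hf speed μ ν φ) :
    ∃ σ > 0, ∃ ρ > 0,
    ContDiffOn ℝ 2 (functionalV S W speed A μ ν σ φ) (orbitNhd (S.m / 2) φ ρ) ∧
    (∀ v ∈ orbit (S.m / 2) φ, functionalV S W speed A μ ν σ φ v = 0 ∧
      fderiv ℝ (functionalV S W speed A μ ν σ φ) v = 0) ∧
    (∃ c > 0, ∀ v ∈ orbitNhd (S.m / 2) φ ρ,
      c * Metric.infDist v (orbit (S.m / 2) φ) ^ 2 ≤ functionalV S W speed A μ ν σ φ v) ∧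
    (∀ v ∈ orbitNhd (S.m / 2) φ ρ, ∀ w, IsDerivativeOf w v →
      fderiv ℝ (functionalV S W speed A μ ν σ φ) v w = 0) := by
  obtain ⟨σ, hσ, ε, hε, c, hc, hlow⟩ := exists_functionalV_lower_bound S hf hW hgrowth hφ H1 H2
  obtain ⟨ρ, hρ, hclose⟩ := exists_close_translate S φ hε
  have hC2 := contDiff_functionalV S hf hW hgrowth speed A μ ν σ φ
  have hlb : ∀ v ∈ orbitNhd (S.m / 2) φ ρ,
      c * Metric.infDist v (orbit (S.m / 2) φ) ^ 2 ≤ functionalV S W speed A μ ν σ φ v := by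
    intro v hv
    obtain ⟨r, hr, horth⟩ := hclose v hv
    have h1 := hlow _ hr horth
    rw [add_sub_cancel, functionalV_translate] at h1
    refine le_trans ?_ h1
    have := infDist_orbit_le φ v r
    have h0 : 0 ≤ Metric.infDist v (orbit (S.m / 2) φ) := Metric.infDist_nonneg
    gcongr
  refine ⟨σ, hσ, ρ, hρ, hC2.contDiffOn, ?_, ⟨c, hc, hlb⟩, ?_⟩
  · intro v hv
    have hv0 : functionalV S W speed A μ ν σ φ v = 0 := by
      obtain ⟨r, rfl⟩ := hv
      exact (functionalV_translate S W speed A μ ν σ φ r _).trans (functionalV_wave S W _ _ _ _ _ φ)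
    -- Nonnegativity near the orbit makes every orbit point a local minimum, so its first derivative
    -- needs no computation.
    refine ⟨hv0, IsLocalMin.fderiv_eq_zero ?_⟩
    have hopen : IsOpen (orbitNhd (S.m / 2) φ ρ) :=
      isOpen_lt (Metric.continuous_infDist_pt _) continuous_const
    have hmem : v ∈ orbitNhd (S.m / 2) φ ρ := by
      change Metric.infDist v _ < ρ
      rwa [Metric.infDist_zero_of_mem hv]
    filter_upwards [hopen.mem_nhds hmem] with u hu
    rw [hv0]
    exact le_trans (by positivity) (hlb u hu)
  · intro v _ w hw
    exact fderiv_eq_zero_of_invariant (fun r => functionalV_translate S W _ _ _ _ _ φ r v)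
      (hC2.differentiable (by norm_num) v).hasFDerivAt hw

end NearOrbit

/-! ### Smoothness and Fourier decay, uniform over families. -/

noncomputable section UniformSmoothness
set_option maxSynthPendingDepth 3
open Filter Topology
variable {L : ℝ} [Fact (0 < L)]

/-- Uniformly rapidly decaying Fourier coefficients belong to smooth functions with uniformly
bounded derivatives. -/
theorem exists_smoothPer_family {ι : Type*} (u : ι → L2Per L)
    (hu : ∀ n : ℕ, ∃ C ≥ 0, ∀ i k, wt n k * ‖fc (u i) k‖ ^ 2 ≤ C ^ 2) :
    ∃ g : ι → SmoothPer L, (∀ i, (g i).inL2 = u i) ∧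
      ∀ n : ℕ, ∃ D ≥ 0, ∀ i x, ‖iteratedFDeriv ℝ n (g i).toFun x‖ ≤ D := by
  have hL : (0 : ℝ) < L := Fact.out
  have key : ∀ n : ℕ, ∃ D ≥ 0, ∀ i,
      (Summable fun k : ℤ => (2 * Real.pi * |(k : ℝ)| / L) ^ n * ‖fc (u i) k‖) ∧
      ∑' k : ℤ, (2 * Real.pi * |(k : ℝ)| / L) ^ n * ‖fc (u i) k‖ ≤ D := by
    intro n
    obtain ⟨C, hC, h⟩ := hu (n + 2)
    push_cast at h
    have hpos : 0 ≤ ∑' k : ℤ, wt (-1) k := tsum_nonneg fun k => (wt_pos _ _).le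
    have := Real.pi_pos
    exact ⟨(2 * Real.pi / L) ^ n * C * ∑' k : ℤ, wt (-1) k, by positivity,
      fun i => summable_moments (h i) hC⟩
  choose g hg hb using fun i => exists_smoothPer (u i) fun n => ((key n).choose_spec.2 i).1
  refine ⟨g, hg, fun n => ⟨(key n).choose, (key n).choose_spec.1, fun i x => ?_⟩⟩
  exact (hb i n x).trans ((key n).choose_spec.2 i).2

theorem exists_bound_le {a : ℕ → ℝ → Prop} (ha : ∀ n, ∃ C ≥ 0, a n C)
    (hmono : ∀ n C C', C ≤ C' → a n C → a n C') (n : ℕ) : ∃ C ≥ 0, ∀ i ≤ n, a i C := by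
  choose C hC h using ha
  refine ⟨∑ i ∈ Finset.range (n + 1), C i, Finset.sum_nonneg fun i _ => hC i, fun i hi => ?_⟩
  exact hmono i _ _ (Finset.single_le_sum (f := C) (fun j _ => hC j)
    (Finset.mem_range.2 (Nat.lt_succ_of_le hi))) (h i)

/-- Composition with a smooth function preserves uniform bounds of all derivatives. -/
theorem exists_bound_comp {ι : Type*} (g : ι → SmoothPer L)
    (hg : ∀ n : ℕ, ∃ D ≥ 0, ∀ i x, ‖iteratedFDeriv ℝ n (g i).toFun x‖ ≤ D)
    {f : ℝ → ℝ} (hf : ContDiff ℝ ∞ f) (n : ℕ) :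
    ∃ D ≥ 0, ∀ i x, ‖iteratedFDeriv ℝ n ((g i).comp f hf).toFun x‖ ≤ D := by
  obtain ⟨D₀, hD₀, h0⟩ := hg 0
  obtain ⟨D, hD, hgD⟩ := exists_bound_le hg (fun n C C' h hC i x => (hC i x).trans h) n
  have hfb : ∀ j : ℕ, ∃ C ≥ 0, ∀ y ∈ Icc (-D₀) D₀, ‖iteratedFDeriv ℝ j f y‖ ≤ C := by
    intro j
    obtain ⟨C, hC⟩ := (isCompact_Icc (a := -D₀) (b := D₀)).exists_bound_of_continuousOn
      (hf.continuous_iteratedFDeriv (m := j) (mod_cast le_top)).continuousOn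
    exact ⟨max C 0, le_max_right _ _, fun y hy => (hC y hy).trans (le_max_left _ _)⟩
  obtain ⟨C, hC, hfC⟩ := exists_bound_le hfb (fun n C C' h hC y hy => (hC y hy).trans h) n
  -- The Faà di Bruno bound asks that the `j`-th derivative be at most the `j`-th power of a
  -- constant; `D + 1 ≥ 1` dominates `D` in every positive power.
  refine ⟨n.factorial * C * (D + 1) ^ n, by positivity, fun i x => ?_⟩
  refine norm_iteratedFDeriv_comp_le (N := ∞) hf (g i).smooth (mod_cast le_top) x
    (fun j hj => hfC j hj _ ?_) (fun j hj1 hj => ?_)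
  · have := h0 i x
    rw [norm_iteratedFDeriv_zero, Real.norm_eq_abs] at this
    exact abs_le.1 this
  · exact (hgD j hj i x).trans ((le_add_of_nonneg_right zero_le_one).trans
      (le_self_pow₀ (by linarith) (by omega)))

theorem wt_natCast (n : ℕ) (k : ℤ) : wt n k = (1 + (k : ℝ) ^ 2) ^ n := Real.rpow_natCast _ _

/-- Uniform bounds of all derivatives give uniform rapid decay of the Fourier coefficients. -/
theorem exists_decay {ι : Type*} (g : ι → SmoothPer L)
    (hg : ∀ n : ℕ, ∃ D ≥ 0, ∀ i x, ‖iteratedFDeriv ℝ n (g i).toFun x‖ ≤ D) (n : ℕ) :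
    ∃ C ≥ 0, ∀ i k, wt n k * ‖fc (g i).onCircle k‖ ≤ C := by
  have hL : (0 : ℝ) < L := Fact.out
  have hpi := Real.pi_pos
  obtain ⟨D₀, hD₀, h0⟩ := hg 0
  obtain ⟨D, hD, h2⟩ := hg (2 * n)
  refine ⟨2 ^ (n - 1) * (D₀ + (L / (2 * Real.pi)) ^ (2 * n) * D), by positivity, fun i k => ?_⟩
  have h3 := norm_fc_mul_pow_le (g i) 0 (h0 i) k
  have h4 := norm_fc_mul_pow_le (g i) (2 * n) (h2 i) k
  rw [pow_zero, one_mul] at h3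
  set a := ‖fc (g i).onCircle k‖
  have ha : 0 ≤ a := norm_nonneg _
  have h5 : ((k : ℝ) ^ 2) ^ n * a ≤ (L / (2 * Real.pi)) ^ (2 * n) * D := by
    calc ((k : ℝ) ^ 2) ^ n * a
        = (L / (2 * Real.pi)) ^ (2 * n) * ((2 * Real.pi * |(k : ℝ)| / L) ^ (2 * n) * a) := by
          rw [← mul_assoc, ← mul_pow, ← sq_abs, ← pow_mul]
          congr 2
          field_simp
      _ ≤ _ := by gcongr
  calc wt n k * a ≤ (2 ^ (n - 1) * (1 ^ n + ((k : ℝ) ^ 2) ^ n)) * a := by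
        rw [wt_natCast]
        exact mul_le_mul_of_nonneg_right (add_pow_le zero_le_one (sq_nonneg _) n) ha
    _ = 2 ^ (n - 1) * (a + ((k : ℝ) ^ 2) ^ n * a) := by rw [one_pow]; ring
    _ ≤ _ := by gcongr

theorem wt_mul_norm_hat_sq_le {s : ℝ} (u : HPer L s) (k : ℤ) :
    wt s k * ‖hat u k‖ ^ 2 ≤ (‖u‖ / √L) ^ 2 := by
  have hL : (0 : ℝ) < L := Fact.out
  rw [div_pow, Real.sq_sqrt hL.le, hper_norm_sq, mul_div_cancel_left₀ _ hL.ne']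
  exact (summable_hat u).le_tsum k fun j _ => mul_nonneg (wt_pos s j).le (sq_nonneg _)

theorem abs_intCast_le_wt (k : ℤ) : |(k : ℝ)| ≤ wt 1 k := by
  unfold wt
  rw [Real.rpow_one, ← sq_abs]
  nlinarith [sq_nonneg (|(k : ℝ)| - 1)]

end UniformSmoothness

/-! ### Conservation of `V` along the flow. -/

noncomputable section Conservation
set_option maxSynthPendingDepth 3
open Filter Topology
variable {L : ℝ} [Fact (0 < L)] (S : DispersionSymbol)

/-- The `k`-th Fourier coefficient of `-(f(u) - 𝓜u)_x`. -/
def rhs (f : ℝ → ℝ) (u : L2Per L) (k : ℤ) : ℂ :=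
  -(2 * Real.pi * Complex.I * k / L) * (fc (fun x => f (u x)) k - (S.θ k : ℂ) * fc u k)

theorem rhs_neg_index (f : ℝ → ℝ) (u : L2Per L) (k : ℤ) :
    rhs S f u (-k) = (starRingEnd ℂ) (rhs S f u k) := by
  unfold rhs
  rw [fc_neg_index, fc_neg_index]
  push_cast
  rw [S.even_θ]
  simp only [map_mul, map_neg, map_sub, map_div₀, Complex.conj_ofReal, Complex.conj_I, map_ofNat,
    map_intCast]
  ring

theorem fc_comp_eq {f : ℝ → ℝ} (hf : ContDiff ℝ ∞ f) (g : SmoothPer L) (k : ℤ) :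
    fc (fun x => f (g.inL2 x)) k = fc (g.comp f hf).onCircle k :=
  fc_congr (by
    filter_upwards [g.coeFn_inL2] with x hx
    rw [hx, SmoothPer.onCircle_comp]) k

/-- The outer derivative costs one power of the weight, and `θ` costs `n₀ ≥ m/2` further ones. -/
theorem exists_rhs_decay {ι : Type*} {f : ℝ → ℝ} (hf : ContDiff ℝ ∞ f) (g : ι → SmoothPer L)
    (hg : ∀ n : ℕ, ∃ D ≥ 0, ∀ i x, ‖iteratedFDeriv ℝ n (g i).toFun x‖ ≤ D) (n : ℕ) :
    ∃ C ≥ 0, ∀ i k, wt n k * ‖rhs S f (g i).inL2 k‖ ≤ C := by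
  have hL : (0 : ℝ) < L := Fact.out
  have hpi := Real.pi_pos
  obtain ⟨B, hB, hθ⟩ := S.exists_abs_le
  obtain ⟨n₀, hn₀⟩ := exists_nat_ge (S.m / 2)
  obtain ⟨C₁, hC₁, h1⟩ := exists_decay _ (exists_bound_comp g hg hf) (n + 1)
  obtain ⟨C₂, hC₂, h2⟩ := exists_decay g hg (n + 1 + n₀)
  refine ⟨2 * Real.pi / L * (C₁ + B * C₂), by positivity, fun i k => ?_⟩
  have h1 := h1 i k
  have h2 := h2 i k
  rw [← fc_comp_eq hf] at h1
  rw [← fc_inL2] at h2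
  unfold rhs
  set a := fc (fun x => f ((g i).inL2 x)) k
  set b := fc (g i).inL2 k
  have h3 : ‖-(2 * Real.pi * Complex.I * k / L : ℂ)‖ ≤ 2 * Real.pi / L * wt 1 k := by
    have : ‖-(2 * Real.pi * Complex.I * k / L : ℂ)‖ = 2 * Real.pi / L * |(k : ℝ)| := by
      rw [norm_neg]
      simp only [norm_div, norm_mul, Complex.norm_I, Complex.norm_real, Complex.norm_intCast,
        Complex.norm_ofNat, Real.norm_eq_abs, abs_of_pos hpi, abs_of_pos hL]
      ring
    rw [this]
    exact mul_le_mul_of_nonneg_left (abs_intCast_le_wt k) (by positivity)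
  have h4 : ‖a - (S.θ k : ℂ) * b‖ ≤ ‖a‖ + B * wt n₀ k * ‖b‖ := by
    refine (norm_sub_le _ _).trans ?_
    rw [norm_mul, Complex.norm_real, Real.norm_eq_abs]
    have : |S.θ k| ≤ B * wt n₀ k :=
      (hθ k).trans (mul_le_mul_of_nonneg_left (wt_mono hn₀ k) hB)
    gcongr
  have h5 : wt n k * wt 1 k = wt ((n + 1 : ℕ) : ℝ) k := by
    rw [wt_mul_wt]
    push_cast
    rfl
  have h6 : wt ((n + 1 : ℕ) : ℝ) k * wt n₀ k = wt ((n + 1 + n₀ : ℕ) : ℝ) k := by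
    rw [wt_mul_wt]
    push_cast
    rfl
  have hw := (wt_pos n k).le
  have hw1 := (wt_pos 1 k).le
  rw [norm_mul]
  calc wt n k * (‖-(2 * Real.pi * Complex.I * k / L : ℂ)‖ * ‖a - (S.θ k : ℂ) * b‖)
      ≤ wt n k * ((2 * Real.pi / L * wt 1 k) * (‖a‖ + B * wt n₀ k * ‖b‖)) := by gcongr
    _ = 2 * Real.pi / L * (wt ((n + 1 : ℕ) : ℝ) k * ‖a‖
          + B * (wt ((n + 1 + n₀ : ℕ) : ℝ) k * ‖b‖)) := by
        rw [← h6, ← h5]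
        ring
    _ ≤ _ := by gcongr

/-- Smooth solutions are differentiable curves in every Sobolev space. -/
theorem exists_hasDerivWithinAt {f : ℝ → ℝ} (hf : ContDiff ℝ ∞ f) {s : ℝ} {u : ℝ → HPer L s}
    (hu : IsGlobalSolution S f u) {T : ℝ} {g : Icc 0 T → SmoothPer L}
    (hgu : ∀ t, (g t).inL2 = toL2 (u t))
    (hg : ∀ n : ℕ, ∃ D ≥ 0, ∀ i x, ‖iteratedFDeriv ℝ n (g i).toFun x‖ ≤ D)
    {r : ℝ} (hr : 0 ≤ r) (hrs : r ≤ s) {t : ℝ} (ht : t ∈ Icc 0 T) :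
    ∃ G : HPer L r, (∀ k, hat G k = rhs S f (toL2 (u t)) k) ∧
      HasDerivWithinAt (fun τ => incl hrs (u τ)) G (Icc 0 T) t := by
  -- Decay of order `n` leaves the weight `(1 + k²)^{r - 2n}`, which is summable since `r - 2n ≤
  -- -1`.
  obtain ⟨n, hn⟩ := exists_nat_ge ((r + 1) / 2)
  obtain ⟨C, hC, hdec⟩ := exists_rhs_decay S hf g hg n
  have hb : ∀ τ ∈ Icc 0 T, ∀ k, ‖rhs S f (toL2 (u τ)) k‖ ≤ C * wt (-n) k := by
    intro τ hτ k
    have h := hdec ⟨τ, hτ⟩ k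
    rw [hgu] at h
    have h1 : wt (-n) k * wt n k = 1 := by rw [wt_mul_wt, neg_add_cancel, wt_zero]
    calc ‖rhs S f (toL2 (u τ)) k‖ = wt (-n) k * (wt n k * ‖rhs S f (toL2 (u τ)) k‖) := by
          rw [← mul_assoc, h1, one_mul]
      _ ≤ wt (-n) k * C := mul_le_mul_of_nonneg_left h (wt_pos _ _).le
      _ = _ := mul_comm _ _
  have hsum : Summable fun k => wt r k * (C * wt (-n) k) ^ 2 := by
    refine Summable.of_nonneg_of_le (fun k => mul_nonneg (wt_pos _ _).le (sq_nonneg _))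
      (fun k => ?_) ((summable_wt (s := 1) (by norm_num)).mul_left (C ^ 2))
    have h1 : wt r k * (wt (-n) k * wt (-n) k) ≤ wt (-1) k := by
      rw [wt_mul_wt, wt_mul_wt]
      exact wt_mono (by linarith) k
    calc wt r k * (C * wt (-n) k) ^ 2 = C ^ 2 * (wt r k * (wt (-n) k * wt (-n) k)) := by ring
      _ ≤ _ := mul_le_mul_of_nonneg_left h1 (sq_nonneg _)
  obtain ⟨G, hG⟩ := exists_hat_eq (L := L) hr (rhs S f (toL2 (u t)))
    (hsum.of_nonneg_of_le (fun k => mul_nonneg (wt_pos _ _).le (sq_nonneg _)) fun k =>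
      mul_le_mul_of_nonneg_left (pow_le_pow_left₀ (norm_nonneg _) (hb t ht k) 2) (wt_pos _ _).le)
    (rhs_neg_index S f _)
  have hd : ∀ τ ∈ Icc 0 T, ∀ k, HasDerivWithinAt (fun τ => hat (incl hrs (u τ)) k)
      (rhs S f (toL2 (u τ)) k) (Icc 0 T) τ := by
    intro τ hτ k
    simp only [hat_incl]
    exact (hu.equation τ hτ.1 k).mono Icc_subset_Ici_self
  refine ⟨G, hG, hasDerivWithinAt_of_hat hsum (fun k => ?_) ?_⟩
  · rw [hG]
    exact hd t ht k
  · filter_upwards [self_mem_nhdsWithin] with τ hτ k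
    exact Convex.norm_image_sub_le_of_norm_hasDerivWithin_le (fun x hx => hd x hx k)
      (fun x hx => hb x hx k) (convex_Icc 0 T) ht hτ

/-- The right side is `∂ₓ` of `z = P'(u)`, so each mode contributes `|z_k|²` times an imaginary
number. This is conservation of `P`, mode by mode. -/
theorem re_conj_mul_rhs {f : ℝ → ℝ} (u : L2Per L) (k : ℤ) :
    ((starRingEnd ℂ) ((S.θ k : ℂ) * fc u k - fc (fun x => f (u x)) k) * rhs S f u k).re = 0 := by
  set z := (S.θ k : ℂ) * fc u k - fc (fun x => f (u x)) k with hz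
  have h1 : (starRingEnd ℂ) z * rhs S f u k
      = ((2 * Real.pi * k / L * ‖z‖ ^ 2 : ℝ) : ℂ) * Complex.I := by
    have h2 : rhs S f u k = (2 * Real.pi * Complex.I * k / L) * z := by
      rw [rhs, hz]
      ring
    rw [h2]
    push_cast
    rw [← Complex.conj_mul']
    ring
  rw [h1, Complex.re_ofReal_mul, Complex.I_re, mul_zero]

/-- `P'(v) G` as a sum over the Fourier coefficients. -/
theorem energyP_derivative_eq {f : ℝ → ℝ} (hf : ContDiff ℝ ∞ f) (g : SmoothPer L)
    (G : HPer L (S.m / 2)) :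
    formM S (g.inH (S.m / 2)) G - ∫ x, f (toL2 (g.inH (S.m / 2)) x) * toL2 G x
      = L * ∑' k : ℤ, ((starRingEnd ℂ) ((S.θ k : ℂ) * fc g.inL2 k
          - fc (fun x => f (g.inL2 x)) k) * hat G k).re := by
  have h1 : ∫ x, f (toL2 (g.inH (S.m / 2)) x) * toL2 G x
      = inner ℝ (g.comp f hf).inL2 (toL2 G) := by
    refine integral_mul_eq_inner ?_ EventuallyEq.rfl
    filter_upwards [g.coeFn_inL2, (g.comp f hf).coeFn_inL2] with x hx hx'
    rw [hx', toL2_inH, hx, SmoothPer.onCircle_comp]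
  have h2 := summable_conj_mul_re (summable_fc_sq (g.comp f hf).inL2) (summable_fc_sq (toL2 G))
  rw [h1, formM_apply, inner_eq_tsum_fc, ← mul_sub, ← (summable_theta S _ _).tsum_sub h2]
  congr 1
  congr 1
  funext k
  rw [fc_comp_eq hf, ← fc_inL2 (g.comp f hf), map_sub, map_mul, Complex.conj_ofReal, sub_mul,
    Complex.sub_re, mul_assoc, Complex.re_ofReal_mul]
  rfl

variable {f W : ℝ → ℝ} (hf : ContDiff ℝ ∞ f) (hW : ∀ x, HasDerivAt W (f x) x)
  (hgrowth : GrowthCondition S.m f)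

include hf hW hgrowth in
/-- The vector field of the equation is tangent to the level sets of `P`, `F` and `M`. -/
theorem tangent_levels (g : SmoothPer L) {G : HPer L (S.m / 2)}
    (hG : ∀ k, hat G k = rhs S f g.inL2 k) {D : HPer L (S.m / 2) →L[ℝ] ℝ}
    (hD : HasFDerivAt (energyP S W) D (g.inH (S.m / 2))) :
    D G = 0 ∧ momentumD S.half_nonneg (g.inH (S.m / 2)) G = 0 ∧
      massCLM S.half_nonneg G = 0 := by
  have hL : (0 : ℝ) < L := Fact.out
  obtain ⟨D', hD', hDk⟩ := exists_hasFDerivAt_energyP S hf hW hgrowth (g.inH (S.m / 2))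
  obtain rfl := hD.unique hD'
  refine ⟨?_, ?_, ?_⟩
  · rw [hDk, energyP_derivative_eq S hf]
    simp only [hG, re_conj_mul_rhs, tsum_zero, mul_zero]
  -- Noether's argument: `(u, ∂ₓ P'(u)) = -(∂ₓ u, P'(u))`, and the latter is the derivative of `P`
  -- along translations, which is zero.
  · have h1 := fderiv_eq_zero_of_invariant (fun r => energyP_translate S W r _) hD
      (isDerivativeOf_derivative g (S.m / 2))
    rw [hDk, energyP_derivative_eq S hf] at h1
    rw [momentumD_apply, inner_eq_tsum_fc, ← neg_eq_zero, ← mul_neg, ← tsum_neg, ← h1]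
    congr 1
    congr 1
    funext k
    rw [isDerivativeOf_derivative g (S.m / 2) k]
    change -(((starRingEnd ℂ) (fc g.inL2 k) * hat G k).re) = _
    rw [hG, rhs]
    change _ = (_ * (_ * fc g.inL2 k)).re
    rw [← Complex.neg_re, ← Complex.conj_re (_ * (_ * fc g.inL2 k))]
    congr 1
    simp only [map_mul, map_div₀, map_ofNat, Complex.conj_ofReal, Complex.conj_I, map_intCast,
      Complex.conj_conj]
    ring
  · rw [massCLM_apply]
    have h1 := fc_zero_index (toL2 G)
    have h2 : hat G 0 = 0 := by
      rw [hG, rhs]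
      simp
    change _ = _ * hat G 0 at h1
    rw [h2, mul_zero] at h1
    exact_mod_cast h1

/-- Persistence gives continuity in every `H^n`, hence bounds on the compact interval `[0, T]`.
Uniformity in time is what later makes the curve differentiable in Sobolev norm. -/
theorem exists_smooth_evolution {s : ℝ} {u : ℝ → HPer L s}
    (hu : ∀ r : ℝ, ∃ w : ℝ → HPer L r, ContinuousOn w (Ici 0) ∧ ∀ t ≥ 0, toL2 (w t) = toL2 (u t))
    (T : ℝ) : ∃ g : Icc 0 T → SmoothPer L, (∀ t, (g t).inL2 = toL2 (u t)) ∧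
      ∀ n : ℕ, ∃ D ≥ 0, ∀ i x, ‖iteratedFDeriv ℝ n (g i).toFun x‖ ≤ D := by
  have hL : (0 : ℝ) < L := Fact.out
  refine exists_smoothPer_family (fun t : Icc 0 T => toL2 (u t)) fun n => ?_
  obtain ⟨w, hw, hwu⟩ := hu n
  obtain ⟨C, hC⟩ := (isCompact_Icc (a := 0) (b := T)).exists_bound_of_continuousOn
    (hw.mono Icc_subset_Ici_self)
  refine ⟨max C 0 / √L, by positivity, fun t k => ?_⟩
  rw [← hwu t t.2.1]
  refine (wt_mul_norm_hat_sq_le (w t) k).trans (pow_le_pow_left₀ (by positivity) ?_ 2)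
  gcongr
  exact (hC t t.2).trans (le_max_left _ _)

include hf hW hgrowth in
theorem conserved_of_persistence {s : ℝ} (hs : S.m / 2 ≤ s) {u : ℝ → HPer L s}
    (hu : IsGlobalSolution S f u)
    (hreg : ∀ r : ℝ, ∃ w : ℝ → HPer L r, ContinuousOn w (Ici 0) ∧ ∀ t ≥ 0,
      toL2 (w t) = toL2 (u t)) {T : ℝ} (hT : 0 ≤ T) :
    energyP S W (incl hs (u T)) = energyP S W (incl hs (u 0)) ∧
      momentumF (incl hs (u T)) = momentumF (incl hs (u 0)) ∧
      massM (incl hs (u T)) = massM (incl hs (u 0)) := by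
  obtain ⟨g, hgu, hg⟩ := exists_smooth_evolution hreg T
  have hconst : ∀ Φ : HPer L (S.m / 2) → ℝ, (∀ t ∈ Icc 0 T, ∀ G,
      HasDerivWithinAt (fun τ => incl hs (u τ)) G (Icc 0 T) t →
      (∀ k, hat G k = rhs S f (toL2 (u t)) k) →
      HasDerivWithinAt (fun τ => Φ (incl hs (u τ))) 0 (Icc 0 T) t) →
      Φ (incl hs (u T)) = Φ (incl hs (u 0)) := by
    intro Φ hΦ
    have h := Convex.norm_image_sub_le_of_norm_hasDerivWithin_le (C := 0) (f' := fun _ => 0)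
      (f := fun τ => Φ (incl hs (u τ))) (s := Icc 0 T) (x := 0) (y := T) (fun t ht => by
        obtain ⟨G, hG, hd⟩ := exists_hasDerivWithinAt S hf hu hgu hg S.half_nonneg hs ht
        exact hΦ t ht G hd hG) (fun t _ => by simp) (convex_Icc 0 T)
      (left_mem_Icc.2 hT) (right_mem_Icc.2 hT)
    rw [zero_mul] at h
    exact sub_eq_zero.1 (norm_le_zero_iff.1 h)
  have hinc : ∀ t (ht : t ∈ Icc 0 T), incl hs (u t) = (g ⟨t, ht⟩).inH (S.m / 2) := by
    intro t ht
    apply toL2_injective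
    rw [toL2_incl, toL2_inH, hgu]
  refine ⟨hconst _ ?_, hconst _ ?_, hconst _ ?_⟩ <;> intro t ht G hd hG <;>
    (rw [← hgu ⟨t, ht⟩] at hG) <;>
    obtain ⟨D, hD, -⟩ := exists_hasFDerivAt_energyP S hf hW hgrowth ((g ⟨t, ht⟩).inH (S.m / 2)) <;>
    obtain ⟨h1, h2, h3⟩ := tangent_levels S hf hW hgrowth (g ⟨t, ht⟩) hG hD
  · rw [← hinc] at hD
    exact (hD.comp_hasDerivWithinAt t hd).congr_deriv h1
  · rw [← hinc] at h2
    exact ((hasFDerivAt_momentumF S.half_nonneg (incl hs (u t))).comp_hasDerivWithinAt t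
      hd).congr_deriv h2
  · exact ((hasFDerivAt_massM S.half_nonneg (incl hs (u t))).comp_hasDerivWithinAt t
      hd).congr_deriv h3

include hf hW hgrowth in
-- Smooth data near `u 0` launch solutions that conserve `V`; continuity of `V` at `u 0` and at `u
-- t`, with continuous dependence between them, passes the equality to the limit.
theorem functionalV_conserved {s : ℝ} (hs : S.m / 2 ≤ s) {X : Set (ℝ → HPer L s)}
    (hwp : GloballyWellPosed S f s X) (speed A μ ν σ : ℝ) (φ : SmoothPer L) {u : ℝ → HPer L s}
    (huX : u ∈ X) (hu : IsGlobalSolution S f u) {t : ℝ} (ht : 0 ≤ t) :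
    functionalV S W speed A μ ν σ φ (incl hs (u t))
      = functionalV S W speed A μ ν σ φ (incl hs (u 0)) := by
  set Φ := fun x : HPer L s => functionalV S W speed A μ ν σ φ (incl hs x) with hΦ
  have hcont : Continuous Φ := (contDiff_functionalV S hf hW hgrowth speed A μ ν σ φ).continuous.comp
    (inclCLM hs).continuous
  change Φ (u t) = Φ (u 0)
  refine eq_of_forall_dist_le fun ε hε => ?_
  obtain ⟨δ₁, hδ₁, h1⟩ := Metric.continuousAt_iff.1 (hcont.continuousAt (x := u t)) (ε / 2)
    (by positivity)
  obtain ⟨δ₂, hδ₂, h2⟩ := Metric.continuousAt_iff.1 (hcont.continuousAt (x := u 0)) (ε / 2)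
    (by positivity)
  -- The horizon is `t + 1` because it has to be positive even when `t = 0`.
  obtain ⟨δ₃, hδ₃, h3⟩ := hwp.continuous_dependence u huX hu (t + 1) (by linarith) δ₁ hδ₁
  obtain ⟨g, hg⟩ := exists_smoothPer_near (S.half_nonneg.trans hs) (u 0)
    (show 0 < min δ₂ δ₃ from lt_min hδ₂ hδ₃)
  obtain ⟨v, hvX, hv, hv0⟩ := hwp.existence (g.inH s)
  rw [← hv0] at hg
  have h4 : Φ (v t) = Φ (v 0) := by
    obtain ⟨hP, hF, hM⟩ := conserved_of_persistence S hf hW hgrowth hs hv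
      (hwp.persistence v hvX hv ⟨g, hv0⟩) ht
    simp only [hΦ, functionalV, functionalG, functionalQ, hP, hF, hM]
  have h5 := h1 (x := v t) (by
    rw [dist_eq_norm]
    exact h3 v hvX hv (hg.trans_le (min_le_right _ _)) t ⟨ht, by linarith⟩)
  have h6 := h2 (x := v 0) (by
    rw [dist_eq_norm]
    exact hg.trans_le (min_le_left _ _))
  rw [h4] at h5
  have := dist_triangle_left (Φ (u t)) (Φ (u 0)) (Φ (v 0))
  linarith

end Conservation
end PeriodicWave

/-! ### Assembly of the Lyapunov function. -/

theorem proposition3p1 (L : ℝ) [Fact (0 < L)] (S : PeriodicWave.DispersionSymbol)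
    (f W : ℝ → ℝ) (hf : ContDiff ℝ ∞ f) (hW : ∀ x, HasDerivAt W (f x) x)
    (hgrowth : PeriodicWave.GrowthCondition S.m f)
    (speed A μ ν : ℝ) (hμν : μ ≠ 0 ∨ ν ≠ 0)
    (φ : PeriodicWave.SmoothPer L) (hφ : PeriodicWave.IsWave S f hf speed A φ)
    (H0 : PeriodicWave.SpectralHyp S f hf speed φ)
    (H1 : PeriodicWave.GardingHyp S f hf speed φ)
    (H2 : PeriodicWave.PositivityHyp S f hf speed μ ν φ)
    (s : ℝ) (hs : S.m / 2 ≤ s) (X : Set (ℝ → PeriodicWave.HPer L s))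
    (hwp : PeriodicWave.GloballyWellPosed S f s X) :
    ∃ σ > 0, PeriodicWave.IsLyapunov S f hs X φ
      (PeriodicWave.functionalV S W speed A μ ν σ φ) := by
  obtain ⟨σ, hσ, hV⟩ := PeriodicWave.exists_near_orbit S hf hW hgrowth (μ := μ) (ν := ν) hφ H1 H2
  exact ⟨σ, hσ, hV, fun v r => PeriodicWave.functionalV_translate S W speed A μ ν σ φ r v,
    fun u huX hu t ht =>
      PeriodicWave.functionalV_conserved S hf hW hgrowth hs hwp speed A μ ν σ φ huX hu ht⟩
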